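/- **Partial orders.** Let $P$ be a poset; $x\sim y$ means that $x,y$ are incomparable. A *simply connected extension* of the order assigns to each pair $x\sim y$ exactly one of two symmetric types $\sim_u,\sim_l$, where the type is $\sim_u$ if $x,y$ have a common upper bound and $\sim_l$ if they have a common lower bound, such that $x\sim_u y$ and $x\sim_l z$ imply $y<z$. It is *trivial* if there is at least one incomparable pair and all incomparable pairs have the same type. For $a\ne c$, the element $b$ is *between* $a$ and $c$ if, up to exchanging $a$ and $c$, one of the following holds: (1) $a<c$ and either $a<b<c$, or $a\sim_u b$ and $b\sim_l c$; (2) $a\sim_l c$, $a\sim_l b$ and $b<c$; (3) $a\sim_u c$, $a\sim_u b$ and $b>c$. Let $B_{a,b}$ consist of $a$, $b$ and all elements between them. The extension is *rectifiable* if every $B_{a,b}$ has finitely many classes under the relation "$B_{x,y}$ is totally ordered by $<$". If $P=G$ is a group, the extension is *left-invariant* if $\le$, $\sim_u$ and $\sim_l$ are preserved by all left translations. **Order trees.** A *segment* in a set $T$ is a linearly ordered subset $\sigma$ with distinct least and greatest elements $i(\sigma),f(\sigma)$; $-\sigma$ is $\sigma$ with the reverse order. An *order tree* is a set $T$ with a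 collection $\mathcal S$ of segments such that: $-\sigma\in\mathcal S$ for $\sigma\in\mathcal S$; nondegenerate closed subintervals of members of $\mathcal S$ are in $\mathcal S$; any two points are joined by a path $\sigma_1\cdots\sigma_k$ in $\mathcal S$ with $f(\sigma_j)=i(\sigma_{j+1})$; every closed path has a subdivision that reduces to the empty word by cancelling adjacent pairs $(\rho)(-\rho)$; if $f(\sigma_1)=i(\sigma_2)$ is the only point of $\sigma_1\cap\sigma_2$, then $\sigma_1\cup\sigma_2\in\mathcal S$; each segment is order isomorphic to a compact interval of $\mathbb R$; and $T$ is a union of countably many segments. A subset of $T$ is open if its trace on every segment is open. An *orientation* is a subset $\mathcal S_+\subset\mathcal S$ with $\mathcal S_+\cap(-\mathcal S_+)=\emptyset$, closed under nondegenerate closed subintervals and under unions as above, such that any two points are joined by a path in $\mathcal S_+\cup(-\mathcal S_+)$. A homeomorphism of $T$ is *orientation preserving* if it maps $\mathcal S$ to $\mathcal S$ and $\mathcal S_+$ to $\mathcal S_+$. **1-manifolds.** A 1-manifold is a second countable, not necessarily Hausdorff space that is locally homeomorphic to $\mathbb R$. If $M$ is an oriented simply connected 1-manifold and $x\in M$,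 let $x^+$ be the component of $M\setminus\{x\}$ that contains the points just above $x$; the points of $M$ are partially ordered by $x\le y\iff y^+\subseteq x^+$. The segments of $M$ are its embedded compact intervals. **Actions.** An action on an order tree or a 1-manifold is *nontrivial* if there is no point $x$ such that for every $g$ the points $gx$ and $x$ have no disjoint neighbourhoods. The *geodesic spine* from $x$ to $y$ is the intersection of all paths of segments from $x$ to $y$. An *infinite ray* is an increasing union of geodesic spines from a point $x$ to points $x_1,x_2,\dots$, where $(x_i)$ has no limit. Two infinite rays are equivalent if their intersection contains an infinite ray, and an *end* is an equivalence class. **Theorem 4.1.** Let $G$ be a countable group with more than one element and with a partial order that has a left-invariant, rectifiable, simply connected extension that is not trivial. Then $G$ acts by orientation-preserving homeomorphisms on an oriented order tree $T$, and the action is faithful, nontrivial and does not fix exactly one end. Moreover, $G$ acts by orientation-preserving homeomorphisms on an oriented simply connected 1-manifold $M$, again faithfully, nontrivially and without fixing exactly one end, and $M$ can be chosen to have a point $x$ with trivial stabilizer such that $g\le h\iff gx\le hx$ for all $g,h\in G$. -/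

import Mathlib

open Set Topology

universe u

namespace OrderTrees

/-! ### Simply connected extensions of partial orders -/

/-- A simply connected extension of a partial order on `P`.  The relations `simU` and `simL` are
the two incomparability types `∼_u` and `∼_l`; they are forced on incomparable pairs with a common
upper, respectively lower, bound and chosen on the remaining incomparable pairs. -/
structure SCExtension (P : Type u) [PartialOrder P] where
  simU : P → P → Prop
  simL : P → P → Prop
  simU_symm : ∀ x y, simU x y → simU y x
  simL_symm : ∀ x y, simL x y → simL y x
  not_comparable_of_simU : ∀ x y, simU x y → ¬ x ≤ y ∧ ¬ y ≤ x
  not_comparable_of_simL : ∀ x y, simL x y → ¬ x ≤ y ∧ ¬ y ≤ x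
  /-- Every incomparable pair has one of the two types ... -/
  simU_or_simL : ∀ x y, ¬ x ≤ y → ¬ y ≤ x → simU x y ∨ simL x y
  /-- ... and only one. -/
  not_simU_and_simL : ∀ x y, ¬ (simU x y ∧ simL x y)
  simU_of_bound : ∀ x y z, ¬ x ≤ y → ¬ y ≤ x → x ≤ z → y ≤ z → simU x y
  simL_of_bound : ∀ x y z, ¬ x ≤ y → ¬ y ≤ x → z ≤ x → z ≤ y → simL x y
  acyclic : ∀ x y z, simU x y → simL x z → y < z

namespace SCExtension

variable {P : Type u} [PartialOrder P] (E : SCExtension P)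

/-- The extension is trivial: there is an incomparable pair, and all incomparable pairs have the
same type. -/
def IsTrivial : Prop :=
  (∃ x y : P, ¬ x ≤ y ∧ ¬ y ≤ x) ∧
    ((∀ x y : P, ¬ x ≤ y → ¬ y ≤ x → E.simU x y) ∨
      (∀ x y : P, ¬ x ≤ y → ¬ y ≤ x → E.simL x y))

/-- `b` is between the distinct points `a` and `c`. -/
def Between (a b c : P) : Prop :=
  (a < c ∧ ((a < b ∧ b < c) ∨ (E.simU a b ∧ E.simL b c))) ∨
  (c < a ∧ ((c < b ∧ b < a) ∨ (E.simU c b ∧ E.simL b a))) ∨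
  (E.simL a c ∧ ((E.simL a b ∧ b < c) ∨ (E.simL c b ∧ b < a))) ∨
  (E.simU a c ∧ ((E.simU a b ∧ c < b) ∨ (E.simU c b ∧ a < b)))

/-- The set `B_{a,b}`. -/
def betweenSet (a b : P) : Set P := {a, b} ∪ {x | E.Between a x b}

/-- The class of `x` in `B_{a,b}` under the relation `O_{a,b}`: `x` and `y` are related when
`B_{x,y}` is totally ordered by the original order. -/
def orientedClass (a b x : P) : Set P :=
  {y | y ∈ E.betweenSet a b ∧ IsChain (· ≤ ·) (E.betweenSet x y)}

/-- Every `B_{a,b}` consists of finitely many `O_{a,b}`-classes. -/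
def IsRectifiable : Prop :=
  ∀ a b : P, (E.orientedClass a b '' E.betweenSet a b).Finite

end SCExtension

/-- The order on the group `G` and the two relations of the extension are left-invariant. -/
def SCExtension.IsLeftInvariant {G : Type u} [Group G] [PartialOrder G] (E : SCExtension G) :
    Prop :=
  ∀ f g h : G, (g ≤ h → f * g ≤ f * h) ∧ (E.simU g h → E.simU (f * g) (f * h)) ∧
    (E.simL g h → E.simL (f * g) (f * h))

/-! ### Segments -/

/-- A linearly ordered subset of `T` with distinct least and greatest elements `ini` and `fin`.
The order is a relation on `T` that is supported on the subset. -/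
structure Seg (T : Type u) where
  carrier : Set T
  le : T → T → Prop
  ini : T
  fin : T
  mem_of_le : ∀ x y, le x y → x ∈ carrier ∧ y ∈ carrier
  le_refl : ∀ x ∈ carrier, le x x
  le_trans : ∀ x y z, le x y → le y z → le x z
  le_antisymm : ∀ x y, le x y → le y x → x = y
  le_total : ∀ x ∈ carrier, ∀ y ∈ carrier, le x y ∨ le y x
  ini_le : ∀ x ∈ carrier, le ini x
  le_fin : ∀ x ∈ carrier, le x fin
  ini_mem : ini ∈ carrier
  fin_mem : fin ∈ carrier
  ini_ne_fin : ini ≠ fin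

namespace Seg

variable {T : Type u}

/-- The same subset with the reverse order. -/
def neg (σ : Seg T) : Seg T where
  carrier := σ.carrier
  le x y := σ.le y x
  ini := σ.fin
  fin := σ.ini
  mem_of_le x y h := (σ.mem_of_le y x h).symm
  le_refl := σ.le_refl
  le_trans x y z h h' := σ.le_trans z y x h' h
  le_antisymm x y h h' := σ.le_antisymm x y h' h
  le_total x hx y hy := σ.le_total y hy x hx
  ini_le := σ.le_fin
  le_fin := σ.ini_le
  ini_mem := σ.fin_mem
  fin_mem := σ.ini_mem
  ini_ne_fin := σ.ini_ne_fin.symm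

/-- The closed nondegenerate subinterval `[a, b]` of a segment. -/
def sub (σ : Seg T) (a b : T) (hab : σ.le a b) (hne : a ≠ b) : Seg T where
  carrier := {x | σ.le a x ∧ σ.le x b}
  le x y := σ.le a x ∧ σ.le x y ∧ σ.le y b
  ini := a
  fin := b
  mem_of_le x y h := ⟨⟨h.1, σ.le_trans _ _ _ h.2.1 h.2.2⟩, ⟨σ.le_trans _ _ _ h.1 h.2.1, h.2.2⟩⟩
  le_refl x hx := ⟨hx.1, σ.le_refl x (σ.mem_of_le _ _ hx.2).1, hx.2⟩
  le_trans x y z h h' := ⟨h.1, σ.le_trans _ _ _ h.2.1 h'.2.1, h'.2.2⟩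
  le_antisymm x y h h' := σ.le_antisymm x y h.2.1 h'.2.1
  le_total x hx y hy := by
    rcases σ.le_total x (σ.mem_of_le _ _ hx.2).1 y (σ.mem_of_le _ _ hy.2).1 with h | h
    · exact Or.inl ⟨hx.1, h, hy.2⟩
    · exact Or.inr ⟨hy.1, h, hx.2⟩
  ini_le x hx := ⟨σ.le_refl a (σ.mem_of_le _ _ hab).1, hx.1, hx.2⟩
  le_fin x hx := ⟨hx.1, hx.2, σ.le_refl b (σ.mem_of_le _ _ hab).2⟩
  ini_mem := ⟨σ.le_refl a (σ.mem_of_le _ _ hab).1, hab⟩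
  fin_mem := ⟨hab, σ.le_refl b (σ.mem_of_le _ _ hab).2⟩
  ini_ne_fin := hne

/-- `σ ∪ τ` with the order of `σ` followed by the order of `τ`, for two segments that meet exactly
in the point `fin σ = ini τ`. -/
def concat (σ τ : Seg T) (h : σ.fin = τ.ini) (hcap : σ.carrier ∩ τ.carrier = {σ.fin}) : Seg T where
  carrier := σ.carrier ∪ τ.carrier
  le x y := σ.le x y ∨ τ.le x y ∨ (x ∈ σ.carrier ∧ y ∈ τ.carrier)
  ini := σ.ini
  fin := τ.fin
  mem_of_le x y hxy := by
    rcases hxy with h1 | h1 | h1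
    · exact ⟨Or.inl (σ.mem_of_le _ _ h1).1, Or.inl (σ.mem_of_le _ _ h1).2⟩
    · exact ⟨Or.inr (τ.mem_of_le _ _ h1).1, Or.inr (τ.mem_of_le _ _ h1).2⟩
    · exact ⟨Or.inl h1.1, Or.inr h1.2⟩
  le_refl x hx := hx.elim (fun hx => Or.inl (σ.le_refl x hx))
    (fun hx => Or.inr (Or.inl (τ.le_refl x hx)))
  le_trans x y z hxy hyz := by
    have key : ∀ w, w ∈ σ.carrier → w ∈ τ.carrier → w = σ.fin := fun w h1 h2 => by
      have : w ∈ σ.carrier ∩ τ.carrier := ⟨h1, h2⟩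
      rw [hcap] at this
      exact this
    rcases hxy with h1 | h1 | h1 <;> rcases hyz with h2 | h2 | h2
    · exact Or.inl (σ.le_trans _ _ _ h1 h2)
    · exact Or.inr (Or.inr ⟨(σ.mem_of_le _ _ h1).1, (τ.mem_of_le _ _ h2).2⟩)
    · exact Or.inr (Or.inr ⟨(σ.mem_of_le _ _ h1).1, h2.2⟩)
    · have hy := key y (σ.mem_of_le _ _ h2).1 (τ.mem_of_le _ _ h1).2
      have hx : x = y := τ.le_antisymm _ _ h1
        (by rw [hy, h]; exact τ.ini_le x (τ.mem_of_le _ _ h1).1)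
      rw [hx]
      exact Or.inl h2
    · exact Or.inr (Or.inl (τ.le_trans _ _ _ h1 h2))
    · have hy := key y h2.1 (τ.mem_of_le _ _ h1).2
      have hx : x = y := τ.le_antisymm _ _ h1
        (by rw [hy, h]; exact τ.ini_le x (τ.mem_of_le _ _ h1).1)
      rw [hx]
      exact Or.inr (Or.inr h2)
    · have hy := key y (σ.mem_of_le _ _ h2).1 h1.2
      have hz : z = y := σ.le_antisymm _ _
        (by rw [hy]; exact σ.le_fin z (σ.mem_of_le _ _ h2).2) h2
      rw [hz]
      exact Or.inr (Or.inr h1)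
    · exact Or.inr (Or.inr ⟨h1.1, (τ.mem_of_le _ _ h2).2⟩)
    · exact Or.inr (Or.inr ⟨h1.1, h2.2⟩)
  le_antisymm x y hxy hyx := by
    have key : ∀ w, w ∈ σ.carrier → w ∈ τ.carrier → w = σ.fin := fun w h1 h2 => by
      have : w ∈ σ.carrier ∩ τ.carrier := ⟨h1, h2⟩
      rw [hcap] at this
      exact this
    rcases hxy with h1 | h1 | h1 <;> rcases hyx with h2 | h2 | h2
    · exact σ.le_antisymm _ _ h1 h2
    · rw [key x (σ.mem_of_le _ _ h1).1 (τ.mem_of_le _ _ h2).2,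
        key y (σ.mem_of_le _ _ h1).2 (τ.mem_of_le _ _ h2).1]
    · refine σ.le_antisymm _ _ h1 ?_
      rw [key x (σ.mem_of_le _ _ h1).1 h2.2]
      exact σ.le_fin y h2.1
    · rw [key x (σ.mem_of_le _ _ h2).2 (τ.mem_of_le _ _ h1).1,
        key y (σ.mem_of_le _ _ h2).1 (τ.mem_of_le _ _ h1).2]
    · exact τ.le_antisymm _ _ h1 h2
    · refine τ.le_antisymm _ _ h1 ?_
      rw [key y h2.1 (τ.mem_of_le _ _ h1).2, h]
      exact τ.ini_le x h2.2
    · refine σ.le_antisymm _ _ ?_ h2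
      rw [key y (σ.mem_of_le _ _ h2).1 h1.2]
      exact σ.le_fin x h1.1
    · refine τ.le_antisymm _ _ ?_ h2
      rw [key x h1.1 (τ.mem_of_le _ _ h2).2, h]
      exact τ.ini_le y h1.2
    · rw [key x h1.1 h2.2, key y h2.1 h1.2]
  le_total x hx y hy := by
    rcases hx with hx | hx <;> rcases hy with hy | hy
    · exact (σ.le_total x hx y hy).imp Or.inl Or.inl
    · exact Or.inl (Or.inr (Or.inr ⟨hx, hy⟩))
    · exact Or.inr (Or.inr (Or.inr ⟨hy, hx⟩))
    · exact (τ.le_total x hx y hy).imp (fun h1 => Or.inr (Or.inl h1))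
        (fun h1 => Or.inr (Or.inl h1))
  ini_le x hx := hx.elim (fun hx => Or.inl (σ.ini_le x hx))
    (fun hx => Or.inr (Or.inr ⟨σ.ini_mem, hx⟩))
  le_fin x hx := hx.elim (fun hx => Or.inr (Or.inr ⟨hx, τ.fin_mem⟩))
    (fun hx => Or.inr (Or.inl (τ.le_fin x hx)))
  ini_mem := Or.inl σ.ini_mem
  fin_mem := Or.inr τ.fin_mem
  ini_ne_fin := by
    intro heq
    have h1 : σ.ini ∈ σ.carrier ∩ τ.carrier := ⟨σ.ini_mem, heq ▸ τ.fin_mem⟩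
    rw [hcap] at h1
    exact σ.ini_ne_fin h1

/-- The image of a segment under a bijection of `T`. -/
def map (e : Equiv.Perm T) (σ : Seg T) : Seg T where
  carrier := e '' σ.carrier
  le x y := σ.le (e.symm x) (e.symm y)
  ini := e σ.ini
  fin := e σ.fin
  mem_of_le x y h := ⟨⟨_, (σ.mem_of_le _ _ h).1, e.apply_symm_apply x⟩,
    ⟨_, (σ.mem_of_le _ _ h).2, e.apply_symm_apply y⟩⟩
  le_refl := by rintro _ ⟨x, hx, rfl⟩; simpa using σ.le_refl x hx
  le_trans x y z h h' := σ.le_trans _ _ _ h h'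
  le_antisymm x y h h' := e.symm.injective (σ.le_antisymm _ _ h h')
  le_total := by
    rintro _ ⟨x, hx, rfl⟩ _ ⟨y, hy, rfl⟩
    simpa using σ.le_total x hx y hy
  ini_le := by rintro _ ⟨x, hx, rfl⟩; simpa using σ.ini_le x hx
  le_fin := by rintro _ ⟨x, hx, rfl⟩; simpa using σ.le_fin x hx
  ini_mem := ⟨_, σ.ini_mem, rfl⟩
  fin_mem := ⟨_, σ.fin_mem, rfl⟩
  ini_ne_fin h := σ.ini_ne_fin (e.injective h)

/-- The order of the segment, on its underlying set. -/
@[reducible] def preorder (σ : Seg T) : Preorder σ.carrier where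
  le x y := σ.le x y
  le_refl x := σ.le_refl x x.2
  le_trans x y z h h' := σ.le_trans _ _ _ h h'

/-- `U ∩ σ` is open in the order topology of the segment `σ`. -/
def IsRelOpen (σ : Seg T) (U : Set T) : Prop :=
  @IsOpen σ.carrier (@Preorder.topology σ.carrier σ.preorder) (Subtype.val ⁻¹' U)

/-- `f` is an order isomorphism from the real interval `[0, 1]` onto the segment. -/
def IsParam (σ : Seg T) (f : Icc (0 : ℝ) 1 → T) : Prop :=
  range f = σ.carrier ∧ ∀ s t, s ≤ t ↔ σ.le (f s) (f t)

end Seg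

/-! ### Paths, cyclic words and order trees -/

variable {T : Type u}

/-- The list of segments is a path from `x` to `y` in the collection `S`. -/
def IsPath (S : Set (Seg T)) : T → T → List (Seg T) → Prop
  | x, y, [] => x = y
  | x, y, σ :: w => σ ∈ S ∧ σ.ini = x ∧ IsPath S σ.fin y w

/-- The set of points on a path that starts at `x`. -/
def pathSet (x : T) (w : List (Seg T)) : Set T := {x} ∪ {z | ∃ σ ∈ w, z ∈ σ.carrier}

/-- The list is a subdivision of the segment into finitely many consecutive closed subintervals. -/
inductive IsSubdivision : Seg T → List (Seg T) → Prop
  | single (σ : Seg T) : IsSubdivision σ [σ]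
  | split (σ : Seg T) (a : T) (h₁ : σ.le σ.ini a) (n₁ : σ.ini ≠ a) (h₂ : σ.le a σ.fin)
      (n₂ : a ≠ σ.fin) (L₁ L₂ : List (Seg T)) :
      IsSubdivision (σ.sub σ.ini a h₁ n₁) L₁ → IsSubdivision (σ.sub a σ.fin h₂ n₂) L₂ →
      IsSubdivision σ (L₁ ++ L₂)

/-- `v` arises from the word `w` by cancelling one adjacent pair `(ρ)(-ρ)`. -/
def Cancel (w v : List (Seg T)) : Prop :=
  ∃ (a b : List (Seg T)) (ρ : Seg T), w = a ++ ρ :: ρ.neg :: b ∧ v = a ++ b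

/-- `S` is the collection of segments of an `ℝ`-order tree structure on `T`, and `T` carries the
topology of the order tree: a set is open when its trace on each segment is open. -/
structure IsOrderTree (T : Type u) [TopologicalSpace T] (S : Set (Seg T)) : Prop where
  neg_mem : ∀ σ ∈ S, σ.neg ∈ S
  sub_mem : ∀ σ ∈ S, ∀ a b, ∀ (hab : σ.le a b) (hne : a ≠ b), σ.sub a b hab hne ∈ S
  joined : ∀ x y : T, ∃ w, IsPath S x y w
  cyclic : ∀ (x : T) (w : List (Seg T)), IsPath S x x w →
    ∃ parts : List (List (Seg T)), List.Forall₂ IsSubdivision w parts ∧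
      Relation.ReflTransGen Cancel parts.flatten []
  concat_mem : ∀ σ ∈ S, ∀ τ ∈ S, ∀ (h : σ.fin = τ.ini)
    (hcap : σ.carrier ∩ τ.carrier = {σ.fin}), σ.concat τ h hcap ∈ S
  real : ∀ σ ∈ S, ∃ f, σ.IsParam f
  countable_union : ∃ C : Set (Seg T), C ⊆ S ∧ C.Countable ∧ ⋃ σ ∈ C, σ.carrier = univ
  isOpen_iff : ∀ U : Set T, IsOpen U ↔ ∀ σ ∈ S, σ.IsRelOpen U

/-- `Sp` is an orientation of the order tree with segments `S`. -/
structure IsOrientation (S Sp : Set (Seg T)) : Prop where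
  subset : Sp ⊆ S
  neg_notMem : ∀ σ ∈ Sp, σ.neg ∉ Sp
  sub_mem : ∀ σ ∈ Sp, ∀ a b, ∀ (hab : σ.le a b) (hne : a ≠ b), σ.sub a b hab hne ∈ Sp
  joined : ∀ x y : T, ∃ w, IsPath (Sp ∪ {σ | σ.neg ∈ Sp}) x y w
  concat_mem : ∀ σ ∈ Sp, ∀ τ ∈ Sp, ∀ (h : σ.fin = τ.ini)
    (hcap : σ.carrier ∩ τ.carrier = {σ.fin}), σ.concat τ h hcap ∈ Sp

/-- Each element of `G` maps segments to segments and positive segments to positive segments. -/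
def PreservesOrientedTree (G : Type u) [Group G] [MulAction G T] (S Sp : Set (Seg T)) : Prop :=
  ∀ g : G, (∀ σ ∈ S, σ.map (MulAction.toPerm g) ∈ S) ∧
    (∀ σ ∈ Sp, σ.map (MulAction.toPerm g) ∈ Sp)

/-! ### Nontrivial actions and ends -/

/-- No point is a generalized fixed point of all elements of `G`; here `x` is a generalized fixed
point of `g` when `g • x` and `x` cannot be separated by disjoint neighbourhoods. -/
def IsNontrivialAction (G : Type u) [Group G] (X : Type u) [TopologicalSpace X] [MulAction G X] :
    Prop :=
  ¬ ∃ x : X, ∀ g : G, ¬ Disjoint (𝓝 (g • x)) (𝓝 x)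

/-- The geodesic spine from `x` to `y`: the intersection of all paths from `x` to `y`. -/
def spine (S : Set (Seg T)) (x y : T) : Set T :=
  {z | ∀ w, IsPath S x y w → z ∈ pathSet x w}

/-- An infinite ray: an increasing union of geodesic spines from a point `x` to the points of a
sequence that has no limit. -/
def IsInfiniteRay [TopologicalSpace T] (S : Set (Seg T)) (ρ : Set T) : Prop :=
  ∃ (x : T) (p : ℕ → T), (∀ i j, i < j → spine S x (p i) ⊆ spine S x (p j)) ∧
    ρ = ⋃ i, spine S x (p i) ∧ ¬ ∃ y, Filter.Tendsto p Filter.atTop (𝓝 y)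

/-- Two infinite rays define the same end. -/
def SameEnd [TopologicalSpace T] (S : Set (Seg T)) (ρ₁ ρ₂ : Set T) : Prop :=
  ∃ ρ, IsInfiniteRay S ρ ∧ ρ ⊆ ρ₁ ∩ ρ₂

/-- `ρ` is an infinite ray whose end is fixed by all of `G`. -/
def RepresentsFixedEnd (G : Type u) [Group G] [TopologicalSpace T] [MulAction G T]
    (S : Set (Seg T)) (ρ : Set T) : Prop :=
  IsInfiniteRay S ρ ∧ ∀ g : G, SameEnd S ((fun z => g • z) '' ρ) ρ

/-- Exactly one end is fixed by `G`. -/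
def FixesUniqueEnd (G : Type u) [Group G] [TopologicalSpace T] [MulAction G T]
    (S : Set (Seg T)) : Prop :=
  ∃ ρ, RepresentsFixedEnd G S ρ ∧ ∀ ρ', RepresentsFixedEnd G S ρ' → SameEnd S ρ' ρ

/-! ### Oriented 1-manifolds, not necessarily Hausdorff -/

/-- Two parametrizations of open sets by `ℝ` induce the same orientation where they overlap: the
change of parameter is locally strictly increasing. -/
def SameOrientation {M : Type u} (φ ψ : ℝ → M) : Prop :=
  ∀ s t, φ s = ψ t → ∃ U ∈ 𝓝 s, ∀ s₁ ∈ U, ∀ s₂ ∈ U, s₁ < s₂ →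
    ∀ t₁ t₂, φ s₁ = ψ t₁ → φ s₂ = ψ t₂ → t₁ < t₂

/-- An atlas that makes `M` an oriented topological 1-manifold (second countable, not necessarily
Hausdorff); the charts are given as parametrizations of open sets by `ℝ`. -/
structure OrientedAtlas (M : Type u) [TopologicalSpace M] where
  secondCountable : SecondCountableTopology M
  charts : Set (ℝ → M)
  isOpenEmbedding : ∀ φ ∈ charts, IsOpenEmbedding φ
  cover : ∀ x : M, ∃ φ ∈ charts, x ∈ range φ
  sameOrientation : ∀ φ ∈ charts, ∀ ψ ∈ charts, SameOrientation φ ψ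

namespace OrientedAtlas

variable {M : Type u} [TopologicalSpace M] (A : OrientedAtlas M)

/-- The set `x⁺`: the component of `M - {x}` that contains the points just above `x`. -/
def plus (x : M) : Set M :=
  {y | ∃ φ ∈ A.charts, ∃ s t, s < t ∧ φ s = x ∧ y ∈ connectedComponentIn {x}ᶜ (φ t)}

/-- The order on the points of an oriented simply connected 1-manifold. -/
def le (x y : M) : Prop := A.plus y ⊆ A.plus x

/-- Each element of `G` preserves the orientation. -/
def IsPreservedBy (G : Type u) [Group G] [MulAction G M] : Prop :=
  ∀ g : G, ∀ φ ∈ A.charts, ∀ ψ ∈ A.charts, SameOrientation (fun s => g • φ s) ψ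

end OrientedAtlas

/-- The segments of a 1-manifold: its embedded compact intervals, with either direction. -/
def arcs (M : Type u) [TopologicalSpace M] : Set (Seg M) :=
  {σ | ∃ f : Icc (0 : ℝ) 1 → M, IsEmbedding f ∧ σ.IsParam f}

end OrderTrees

/-!
The extension is the same thing as a notion of sides: say that `y` lies above `x` if `x < y` or
`x ∼_u y`, and below `x` otherwise. Acyclicity becomes the axiom of `IsTreeSide`, that of two
elements `x` and `y` at least one has the other one and `z` on the same side, and an element is
between two others exactly when it separates them (`SCExtension.between_iff_sep`). Conversely, sides
determine a local order, in which `x < y` if `y` is above `x` and above everything that has `x`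
above it. The group acts on every construction made from the sides alone.

The line is built in three steps. First the set is completed by virtual points, at the top of the
peaks and at the bottom of the valleys (`Fill`). Rectifiability bounds the number of turns between
two elements (`SCExtension.classCount_lt`), and by induction on this number any two points of the
completed set are joined by finitely many pairs that are comparable in the local order
(`Fill.joined_elt`). Then each point is replaced by a copy of `ℚ`, which leaves no branching at
points, and finally Dedekind cuts are added. Two comparable cuts lie in an interval isomorphic to
`ℝ`, so that the cuts form a `TreeLine`: a non-Hausdorff line, which branches only between its
points, and in which every point has exactly two sides.

A closed chain of comparable pairs in such a line contracts (`TreeLine.contracts_of_closed`). As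
long as it is not constant it can be shortened by subdividing it and cancelling a backtracking,
because a chain that cannot be shortened contains points that separate its two ends. This is both
the axiom on closed paths of an order tree (`TreeLine.isOrderTree`) and the simple connectedness of
the line as a manifold (`TreeLine.simplyConnectedSpace`). The upper side of a point is the component
above it (`TreeLine.plus_eq`), so that `x < y` in the order of the manifold means that `y` is above
`x` and `x` is below `y`, which is the order of the group on the orbit.

Distinct points of the orbit are separated by a point of the line, so that none of them is a
generalized fixed point. Any other generalized fixed point lies on the same kind of side of all
points of the orbit, and so does a fixed end, since a ray is eventually on one side of every point
(`TreeLine.IsRay.exists_endSide`). By the tree axiom all incomparable pairs then have the same type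
(`SCExtension.comparable_of_side`), so that there are none and the order is total. In that case the
line is totally ordered, the orbit is unbounded in both directions, which excludes the generalized
fixed point, and there are two ends, both of which are fixed.
-/

namespace OrderTrees

/-! ### Sides and betweenness -/

/-- A side function on `X`: `up x y` says that `y` lies above `x`, and every other `y ≠ x` lies
below `x`.  The axiom `tree` says that when `x` separates `y` from `z`, then `y` does not separate
`x` from `z`. -/
structure IsTreeSide {X : Type u} (up : X → X → Prop) : Prop where
  irrefl : ∀ x, ¬ up x x
  tree : ∀ x y z, x ≠ y → x ≠ z → y ≠ z → (up x y ↔ up x z) ∨ (up y x ↔ up y z)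

/-- `z` separates `x` from `y`. -/
def Sep {X : Type u} (up : X → X → Prop) (z x y : X) : Prop :=
  z ≠ x ∧ z ≠ y ∧ ¬ (up z x ↔ up z y)

/-- The points `x` and `y` and everything that separates them. -/
def Hull {X : Type u} (up : X → X → Prop) (x y : X) : Set X :=
  {z | z = x ∨ z = y ∨ Sep up z x y}

/-- The local order of a side function: `x < y` when `y` is above `x` and every point that has `x`
above it also has `y` above it. -/
def LocalLE {X : Type u} (up : X → X → Prop) (x y : X) : Prop :=
  (∀ z, up z x → up z y) ∧ (x = y ∨ up x y)

section Sides

variable {X : Type u} {up : X → X → Prop}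

theorem Sep.symm {z x y : X} (h : Sep up z x y) : Sep up z y x :=
  ⟨h.2.1, h.1, fun h' => h.2.2 h'.symm⟩

theorem hull_comm (x y : X) : Hull up x y = Hull up y x := by
  ext z
  constructor <;> rintro (h | h | h)
  · exact Or.inr (Or.inl h)
  · exact Or.inl h
  · exact Or.inr (Or.inr h.symm)
  · exact Or.inr (Or.inl h)
  · exact Or.inl h
  · exact Or.inr (Or.inr h.symm)

theorem left_mem_hull (x y : X) : x ∈ Hull up x y := Or.inl rfl

theorem right_mem_hull (x y : X) : y ∈ Hull up x y := Or.inr (Or.inl rfl)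

theorem hull_self (x : X) : Hull up x x = {x} := by
  ext z
  constructor
  · rintro (h | h | h)
    · exact h
    · exact h
    · exact absurd Iff.rfl h.2.2
  · intro h
    exact Or.inl h

theorem hull_subset_union (x y z : X) : Hull up x y ⊆ Hull up x z ∪ Hull up z y := by
  rintro w (hw | hw | hw)
  · exact Or.inl (Or.inl hw)
  · exact Or.inr (Or.inr (Or.inl hw))
  · by_cases hz : w = z
    · exact Or.inl (Or.inr (Or.inl hz))
    · by_cases h1 : up w x ↔ up w z
      · exact Or.inr (Or.inr (Or.inr ⟨hz, hw.2.1, fun h2 => hw.2.2 (h1.trans h2)⟩))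
      · exact Or.inl (Or.inr (Or.inr ⟨hw.1, hz, h1⟩))

theorem localLE_refl (x : X) : LocalLE up x x := ⟨fun _ hz => hz, Or.inl rfl⟩

theorem localLE_trans {x y z : X} (h1 : LocalLE up x y) (h2 : LocalLE up y z) :
    LocalLE up x z := by
  refine ⟨fun w hw => h2.1 w (h1.1 w hw), ?_⟩
  rcases h1.2 with rfl | h3
  · exact h2.2
  · exact Or.inr (h2.1 x h3)

namespace IsTreeSide

theorem not_sep_of_sep (h : IsTreeSide up) {x y z : X} (hs : Sep up x y z) :
    ¬ Sep up y x z := fun hs' =>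
  (h.tree x y z hs.1 hs.2.1 hs'.2.1).elim hs.2.2 hs'.2.2

theorem hull_subset_left (h : IsTreeSide up) {x y z : X} (hz : z ∈ Hull up x y) :
    Hull up x z ⊆ Hull up x y := by
  rcases hz with rfl | rfl | hz
  · rw [hull_self]
    rintro w rfl
    exact left_mem_hull _ _
  · exact Subset.rfl
  · rintro w (hw | hw | hw)
    · exact Or.inl hw
    · rw [hw]; exact Or.inr (Or.inr hz)
    · right; right
      have h1 : ¬ Sep up z w x := h.not_sep_of_sep hw.symm
      have h2 : Sep up z w y := by
        refine ⟨hw.2.1.symm, hz.2.1, fun h3 => h1 ⟨hw.2.1.symm, hz.1, fun h4 => ?_⟩⟩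
        exact hz.2.2 (h4.symm.trans h3)
      have h3 : ¬ Sep up w z y := h.not_sep_of_sep h2
      have h5 : w ≠ y := by
        rintro rfl
        exact h2.2.2 Iff.rfl
      refine ⟨hw.1, h5, fun h4 => h3 ⟨hw.2.1, h5, fun h6 => ?_⟩⟩
      exact hw.2.2 (h4.trans h6.symm)

theorem hull_subset_right (h : IsTreeSide up) {x y z : X} (hz : z ∈ Hull up x y) :
    Hull up z y ⊆ Hull up x y := by
  rw [hull_comm z y, hull_comm x y]
  rw [hull_comm x y] at hz
  exact h.hull_subset_left hz

/-- Points on nested hulls from a common start are ordered along the larger hull. -/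
theorem mem_hull_of_mem (h : IsTreeSide up) {y u v w : X} (hu : u ∈ Hull up y v)
    (hv : v ∈ Hull up y w) : v ∈ Hull up u w := by
  rcases hv with rfl | rfl | hv
  · rw [hull_self] at hu
    rw [show u = v from hu]
    exact left_mem_hull _ _
  · exact right_mem_hull _ _
  · rcases hu with rfl | rfl | hu
    · exact Or.inr (Or.inr hv)
    · exact left_mem_hull _ _
    · have h1 := h.not_sep_of_sep hu.symm
      refine Or.inr (Or.inr ⟨hu.2.1.symm, hv.2.1, fun h2 => ?_⟩)
      exact h1 ⟨hu.2.1.symm, hv.1, fun h3 => hv.2.2 (h3.symm.trans h2)⟩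

theorem localLE_antisymm (h : IsTreeSide up) {x y : X} (h1 : LocalLE up x y)
    (h2 : LocalLE up y x) : x = y := by
  rcases h1.2 with h3 | h3
  · exact h3
  · exact absurd (h2.1 x h3) (h.irrefl x)

/-- Only a point between `x` and `y` in the local order separates `x` from `y`. -/
theorem localLE_between (h : IsTreeSide up) {x y z : X} (hxy : LocalLE up x y) (hs : Sep up z x y) :
    (LocalLE up x z ∧ LocalLE up z y) := by
  have hne : x ≠ y := by
    rintro rfl
    exact hs.2.2 Iff.rfl
  have hup : up x y := hxy.2.resolve_left hne
  have hnyx : ¬ up y x := fun h1 => h.irrefl y (hxy.1 y h1)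
  have hzx : ¬ up z x := fun h1 => hs.2.2 ⟨fun _ => hxy.1 z h1, fun _ => h1⟩
  have hzy : up z y := by
    by_contra h1
    exact hs.2.2 ⟨fun h2 => absurd h2 hzx, fun h2 => absurd h2 h1⟩
  have hxz : up x z :=
    ((h.tree z x y hs.1 hs.2.1 hne).resolve_left hs.2.2).2 hup
  have hyz : ¬ up y z := fun h1 => hnyx
    (((h.tree z y x hs.2.1 hs.1 hne.symm).resolve_left (fun h2 => hs.2.2 h2.symm)).1 h1)
  have key : ∀ w, up w x → ¬ up w z → False := by
    intro w hwx hwz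
    have hwz' : w ≠ z := fun h1 => hzx (h1 ▸ hwx)
    have hwx' : w ≠ x := fun h1 => h.irrefl x (by rw [h1] at hwx; exact hwx)
    have hwy : up w y := hxy.1 w hwx
    have hwy' : w ≠ y := fun h1 => hnyx (h1 ▸ hwx)
    have h1 : up z w ↔ up z y :=
      (h.tree w z y hwz' hwy' hs.2.1).resolve_left (fun h2 => hwz (h2.2 hwy))
    have h2 : up z w ↔ up z x :=
      (h.tree w z x hwz' hwx' hs.1).resolve_left (fun h2 => hwz (h2.2 hwx))
    exact hzx (h2.1 (h1.2 hzy))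
  have key' : ∀ w, up w z → ¬ up w y → False := by
    intro w hwz hwy
    have hwy' : w ≠ y := fun h1 => hyz (h1 ▸ hwz)
    have hwz' : w ≠ z := fun h1 => h.irrefl z (by rw [h1] at hwz; exact hwz)
    have hwx' : w ≠ x := fun h1 => hwy (h1 ▸ hup)
    have hwx : ¬ up w x := fun h1 => hwy (hxy.1 w h1)
    have h1 : up z w ↔ up z y :=
      (h.tree w z y hwz' hwy' hs.2.1).resolve_left (fun h2 => hwy (h2.1 hwz))
    have h2 : up z w ↔ up z x :=
      (h.tree w z x hwz' hwx' hs.1).resolve_left (fun h2 => hwx (h2.1 hwz))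
    exact hzx (h2.1 (h1.2 hzy))
  exact ⟨⟨fun w hw => by_contra fun h1 => key w hw h1, Or.inr hxz⟩,
    ⟨fun w hw => by_contra fun h1 => key' w hw h1, Or.inr hzy⟩⟩

end IsTreeSide

end Sides

/-- A partially ordered set in which every point cuts the rest into an upper and a lower side, such
that the sides of `z` change along a comparable pair `x < y` only when `x < z < y`, and such that
any two points are joined by finitely many comparable pairs. -/
class SidePoset (X : Type u) extends PartialOrder X where
  up : X → X → Prop
  up_irrefl : ∀ x, ¬ up x x
  up_of_lt : ∀ x y : X, x < y → up x y
  not_up_of_lt : ∀ x y : X, x < y → ¬ up y x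
  up_iff_up : ∀ x y z : X, x < y → z ≠ x → z ≠ y → ¬ (x < z ∧ z < y) → (up z x ↔ up z y)
  conn : ∀ x y : X, Relation.ReflTransGen (fun a b => a ≤ b ∨ b ≤ a) x y

namespace SidePoset

variable {X : Type u} [SidePoset X]

theorem up_ne {x y : X} (h : up x y) : x ≠ y := by
  rintro rfl
  exact up_irrefl x h

/-- Intervals are totally ordered: if `x` and `y` in `[a, b]` were incomparable, `x` would have both
`a` and `b` on the side of `y`. -/
theorem le_or_le_of_mem_Icc {a b x y : X} (hx : x ∈ Icc a b) (hy : y ∈ Icc a b) :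
    x ≤ y ∨ y ≤ x := by
  by_contra hcon
  push Not at hcon
  have hxa : x ≠ a := fun h => hcon.1 (h ▸ hy.1)
  have hya : y ≠ a := fun h => hcon.2 (h ▸ hx.1)
  have hxb : x ≠ b := fun h => hcon.2 (h ▸ hy.2)
  have hyb : y ≠ b := fun h => hcon.1 (h ▸ hx.2)
  have hax : a < x := lt_of_le_of_ne hx.1 hxa.symm
  have hxb' : x < b := lt_of_le_of_ne hx.2 hxb
  have hay : a < y := lt_of_le_of_ne hy.1 hya.symm
  have hyb' : y < b := lt_of_le_of_ne hy.2 hyb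
  have hxy : x ≠ y := fun h => hcon.1 h.le
  have h1 : up x a ↔ up x y := up_iff_up a y x hay hxa hxy (fun h => hcon.1 h.2.le)
  have h2 : up x y ↔ up x b := up_iff_up y b x hyb' hxy hxb (fun h => hcon.2 h.1.le)
  exact not_up_of_lt a x hax (h1.2 (h2.2 (up_of_lt x b hxb')))

/-- `x` and `y` are distinct and comparable. -/
def Adj (x y : X) : Prop := x < y ∨ y < x

/-- `z` lies strictly between the comparable points `x` and `y`. -/
def Btw (x z y : X) : Prop := (x < z ∧ z < y) ∨ (y < z ∧ z < x)

theorem Adj.symm {x y : X} (h : Adj x y) : Adj y x := Or.symm h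

theorem Adj.ne {x y : X} (h : Adj x y) : x ≠ y := h.elim ne_of_lt ne_of_gt

theorem Btw.symm {x z y : X} (h : Btw x z y) : Btw y z x := Or.symm h

theorem Btw.adj_left {x z y : X} (h : Btw x z y) : Adj x z :=
  h.imp And.left And.right

theorem Btw.adj_right {x z y : X} (h : Btw x z y) : Adj z y :=
  h.imp And.right And.left

theorem Btw.adj {x z y : X} (h : Btw x z y) : Adj x y :=
  h.imp (fun h => h.1.trans h.2) (fun h => h.1.trans h.2)

theorem up_iff_of_adj {x y z : X} (h : Adj x y) (hx : z ≠ x) (hy : z ≠ y) (hb : ¬ Btw x z y) :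
    up z x ↔ up z y := by
  rcases h with h | h
  · exact up_iff_up x y z h hx hy (fun h' => hb (Or.inl h'))
  · exact (up_iff_up y x z h hy hx (fun h' => hb (Or.inr h'))).symm

theorem sep_of_btw {x y z : X} (h : Btw x z y) : Sep up z x y := by
  refine ⟨h.adj_left.ne.symm, h.adj_right.ne, ?_⟩
  rcases h with h | h
  · exact fun h' => not_up_of_lt _ _ h.1 (h'.2 (up_of_lt _ _ h.2))
  · exact fun h' => not_up_of_lt _ _ h.1 (h'.1 (up_of_lt _ _ h.2))

/-- The tree axiom holds: a chain of comparable pairs from `x` to `z` can be followed back from `z`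
to the first pair that meets `x` or `y`. -/
theorem isTreeSide : IsTreeSide (up : X → X → Prop) where
  irrefl := up_irrefl
  tree x y z hxy hxz hyz := by
    have key : ∀ w : X, w = x ∨ w = y ∨ ((up x y ↔ up x w) ∨ (up y x ↔ up y w)) := by
      intro w
      induction conn x w with
      | refl => exact Or.inl rfl
      | @tail u v _ huv ih =>
        rcases eq_or_ne v x with hvx | hvx
        · exact Or.inl hvx
        rcases eq_or_ne v y with hvy | hvy
        · exact Or.inr (Or.inl hvy)
        rcases eq_or_ne u v with rfl | huv'
        · exact ih
        have hadj : Adj u v := huv.imp (fun h => lt_of_le_of_ne h huv')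
          (fun h => lt_of_le_of_ne h huv'.symm)
        right; right
        by_cases hx : x = u ∨ Btw u x v
        · have hxv : Adj x v := by
            rcases hx with rfl | hx
            · exact hadj
            · exact hx.adj_right
          by_cases hb : Btw x y v
          · left
            refine up_iff_of_adj hb.adj_right hxy hvx.symm ?_
            rintro (h1 | h1) <;> rcases hb with h2 | h2
            · exact lt_asymm h1.1 h2.1
            · exact lt_asymm (h2.1.trans h2.2) h1.2
            · exact lt_asymm (h2.1.trans h2.2) h1.1
            · exact lt_asymm h1.2 h2.2
          · right
            exact up_iff_of_adj hxv hxy.symm hvy.symm hb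
        · push Not at hx
          by_cases hy : y = u ∨ Btw u y v
          · left
            have hyv : Adj y v := by
              rcases hy with rfl | hy
              · exact hadj
              · exact hy.adj_right
            refine up_iff_of_adj hyv hxy hvx.symm (fun hb => hx.2 ?_)
            rcases hy with rfl | hy
            · exact hb
            · rcases hb with h1 | h1 <;> rcases hy with h2 | h2
              · exact Or.inl ⟨h2.1.trans h1.1, h1.2⟩
              · exact absurd (h1.1.trans h1.2) (lt_asymm h2.1)
              · exact absurd (h1.1.trans h1.2) (lt_asymm h2.2)
              · exact Or.inr ⟨h1.1, h1.2.trans h2.2⟩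
          · push Not at hy
            rcases ih with h1 | h1 | h1 | h1
            · exact absurd h1.symm hx.1
            · exact absurd h1.symm hy.1
            · exact Or.inl (h1.trans (up_iff_of_adj hadj hx.1 hvx.symm hx.2))
            · exact Or.inr (h1.trans (up_iff_of_adj hadj hy.1 hvy.symm hy.2))
    exact ((key z).resolve_left hxz.symm).resolve_left hyz.symm

/-- The upper side of the larger of two comparable points is contained in the upper side of the
smaller one. -/
theorem up_of_up {x y z : X} (hxy : x < y) (hz : up y z) : up x z := by
  have hyx := not_up_of_lt x y hxy
  have hzx : x ≠ z := by
    rintro rfl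
    exact hyx hz
  rcases isTreeSide.tree x y z hxy.ne hzx (up_ne hz) with h | h
  · exact h.1 (up_of_lt x y hxy)
  · exact absurd (h.2 hz) hyx

end SidePoset
/-! ### The side function of a simply connected extension -/

namespace SCExtension

variable {P : Type u} [PartialOrder P] (E : SCExtension P)

/-- The side function of the extension: `y` lies above `x` when `x < y` or `x ∼_u y`. -/
def up (x y : P) : Prop := x < y ∨ E.simU x y

theorem trichotomy (x y : P) (h : x ≠ y) : x < y ∨ y < x ∨ E.simU x y ∨ E.simL x y := by
  by_cases h1 : x ≤ y
  · exact Or.inl (lt_of_le_of_ne h1 h)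
  by_cases h2 : y ≤ x
  · exact Or.inr (Or.inl (lt_of_le_of_ne h2 h.symm))
  exact Or.inr (Or.inr (E.simU_or_simL x y h1 h2))

theorem not_simU_of_le {x y z : P} (hx : z ≤ x) (hy : z ≤ y) : ¬ E.simU x y := fun h =>
  E.not_simU_and_simL x y ⟨h, E.simL_of_bound x y z (E.not_comparable_of_simU x y h).1
    (E.not_comparable_of_simU x y h).2 hx hy⟩

theorem not_simL_of_le {x y z : P} (hx : x ≤ z) (hy : y ≤ z) : ¬ E.simL x y := fun h =>
  E.not_simU_and_simL x y ⟨E.simU_of_bound x y z (E.not_comparable_of_simL x y h).1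
    (E.not_comparable_of_simL x y h).2 hx hy, h⟩

theorem up_irrefl (x : P) : ¬ E.up x x := by
  rintro (h | h)
  · exact lt_irrefl x h
  · exact (E.not_comparable_of_simU x x h).1 le_rfl

theorem up_ne {x y : P} (h : E.up x y) : x ≠ y := by
  rintro rfl
  exact E.up_irrefl x h

theorem not_up_of_lt {x y : P} (h : x < y) : ¬ E.up y x := by
  rintro (h' | h')
  · exact lt_asymm h h'
  · exact (E.not_comparable_of_simU y x h').2 h.le

theorem lt_iff_up {x y : P} : x < y ↔ E.up x y ∧ ¬ E.up y x := by
  constructor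
  · exact fun h => ⟨Or.inl h, E.not_up_of_lt h⟩
  · rintro ⟨h1 | h1, h2⟩
    · exact h1
    · exact absurd (Or.inr (E.simU_symm _ _ h1)) h2

theorem simU_iff_up {x y : P} : E.simU x y ↔ E.up x y ∧ E.up y x := by
  constructor
  · exact fun h => ⟨Or.inr h, Or.inr (E.simU_symm _ _ h)⟩
  · rintro ⟨h1 | h1, h2⟩
    · exact absurd h2 (E.not_up_of_lt h1)
    · exact h1

theorem simL_iff_up {x y : P} : E.simL x y ↔ x ≠ y ∧ ¬ E.up x y ∧ ¬ E.up y x := by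
  constructor
  · intro h
    have h1 := E.not_comparable_of_simL x y h
    have h2 := E.not_simU_and_simL x y
    have h3 := E.not_simU_and_simL y x
    refine ⟨fun h4 => h1.1 h4.le, ?_, ?_⟩
    · rintro (h4 | h4)
      · exact h1.1 h4.le
      · exact h2 ⟨h4, h⟩
    · rintro (h4 | h4)
      · exact h1.2 h4.le
      · exact h3 ⟨h4, E.simL_symm _ _ h⟩
  · rintro ⟨h1, h2, h3⟩
    rcases E.trichotomy x y h1 with h | h | h | h
    · exact absurd (Or.inl h) h2
    · exact absurd (Or.inl h) h3
    · exact absurd (Or.inr h) h2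
    · exact h

theorem not_comparable_of_up {x y : P} (hxy : x ≠ y) (h : E.up x y ↔ E.up y x) :
    ¬ x ≤ y ∧ ¬ y ≤ x := by
  constructor
  · intro h1
    have := E.lt_iff_up.1 (lt_of_le_of_ne h1 hxy)
    exact this.2 (h.1 this.1)
  · intro h1
    have := E.lt_iff_up.1 (lt_of_le_of_ne h1 hxy.symm)
    exact this.2 (h.2 this.1)

/-- The acyclicity axiom of the extension, together with the types forced by common bounds, is the
tree axiom of the sides. -/
theorem isTreeSide : IsTreeSide E.up where
  irrefl := E.up_irrefl
  tree x y z hxy hxz hyz := by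
    have hU := E.simU_symm
    have hL := E.simL_symm
    have hA := E.acyclic
    have e1 := @lt_iff_up P _ E
    have hUL := E.not_simU_and_simL
    have b1 : ∀ a b c : P, c < a → c < b → ¬ E.simU a b :=
      fun a b c h h' => E.not_simU_of_le h.le h'.le
    have b2 : ∀ a b c : P, a < c → b < c → ¬ E.simL a b :=
      fun a b c h h' => E.not_simL_of_le h.le h'.le
    have u1 : ∀ a b : P, E.up a b ↔ a < b ∨ E.simU a b := fun _ _ => Iff.rfl
    have asym : ∀ a b : P, a < b → ¬ b < a := fun a b h => lt_asymm h
    have ncU : ∀ a b : P, E.simU a b → ¬ a < b := fun a b h h' =>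
      (E.not_comparable_of_simU a b h).1 h'.le
    have ncL : ∀ a b : P, E.simL a b → ¬ a < b := fun a b h h' =>
      (E.not_comparable_of_simL a b h).1 h'.le
    have tr : ∀ a b c : P, a < b → b < c → a < c := fun a b c h h' => h.trans h'
    simp only [u1]
    clear u1 e1
    -- Each of the three pairs has one of four types, which leaves 64 combinations.
    rcases E.trichotomy x y hxy with h1 | h1 | h1 | h1 <;>
    rcases E.trichotomy x z hxz with h2 | h2 | h2 | h2 <;>
    rcases E.trichotomy y z hyz with h3 | h3 | h3 | h3 <;> grind

/-- Betweenness in the extension is separation by sides. -/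
theorem between_iff_sep {a b c : P} : E.Between a b c ↔ Sep E.up b a c := by
  have T := E.isTreeSide
  have hU := @simU_iff_up P _ E
  have hL := @simL_iff_up P _ E
  have hlt := @lt_iff_up P _ E
  have hirr := E.up_irrefl
  unfold Between Sep
  simp only [hU, hL, hlt]
  constructor
  · intro h
    have t1 := T.tree b a c
    have t2 := T.tree a b c
    have t3 := T.tree c b a
    grind
  · rintro ⟨h1, h2, h3⟩
    have hac : a ≠ c := by
      rintro rfl
      exact h3 Iff.rfl
    have t1 := T.tree b a c h1 h2 hac
    have t2 := T.tree b c a h2 h1 hac.symm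
    grind

theorem betweenSet_eq_hull (a b : P) : E.betweenSet a b = Hull E.up a b := by
  ext x
  unfold betweenSet Hull
  simp only [mem_union, mem_insert_iff, mem_singleton_iff, mem_ofPred_eq, between_iff_sep, or_assoc]

/-- The number of classes in `B_{a,b}`. -/
noncomputable def classCount (a b : P) : ℕ :=
  (E.orientedClass a b '' E.betweenSet a b).ncard

theorem classCount_comm (a b : P) : E.classCount a b = E.classCount b a := by
  unfold classCount orientedClass
  rw [betweenSet_eq_hull, betweenSet_eq_hull, hull_comm]

/-- Cutting off a final piece of `B_{a,b}` that contains an incomparable pair loses at least the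
class of `b`. -/
theorem classCount_lt (hrect : E.IsRectifiable) {a b c u v : P} (hc : c ∈ Hull E.up a b)
    (hu : u ∈ Hull E.up c b) (hv : v ∈ Hull E.up c b) (huv : ¬ u ≤ v ∧ ¬ v ≤ u) :
    E.classCount a c < E.classCount a b := by
  have T := E.isTreeSide
  have hsub : E.betweenSet a c ⊆ E.betweenSet a b := by
    rw [betweenSet_eq_hull, betweenSet_eq_hull]
    exact T.hull_subset_left hc
  have hfin : (E.orientedClass a b '' E.betweenSet a c).Finite :=
    (hrect a b).subset (image_mono hsub)
  -- The classes of `B_{a,c}` are traces of classes of `B_{a,b}`.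
  have himg : E.orientedClass a c '' E.betweenSet a c =
      (fun K => K ∩ E.betweenSet a c) '' (E.orientedClass a b '' E.betweenSet a c) := by
    rw [image_image]
    refine image_congr fun w _ => ?_
    ext y
    constructor
    · rintro ⟨h1, h2⟩
      exact ⟨⟨hsub h1, h2⟩, h1⟩
    · rintro ⟨⟨_, h2⟩, h1⟩
      exact ⟨h1, h2⟩
  have hb : E.orientedClass a b b ∈ E.orientedClass a b '' E.betweenSet a b :=
    mem_image_of_mem _ (by rw [betweenSet_eq_hull]; exact right_mem_hull _ _)
  -- No `w` in `B_{a,c}` is related to `b`, as `B_{w,b}` contains the incomparable `u` and `v`.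
  have hb' : E.orientedClass a b b ∉ E.orientedClass a b '' E.betweenSet a c := by
    rintro ⟨w, hw, hwb⟩
    have hbb : b ∈ E.orientedClass a b b := by
      refine ⟨by rw [betweenSet_eq_hull]; exact right_mem_hull _ _, ?_⟩
      rw [betweenSet_eq_hull, hull_self]
      exact IsChain.singleton
    rw [← hwb] at hbb
    have hch := hbb.2
    rw [betweenSet_eq_hull] at hw hch
    have hcw : c ∈ Hull E.up w b := T.mem_hull_of_mem hw hc
    have hsub' := T.hull_subset_right hcw
    have hne : u ≠ v := fun h => huv.1 h.le
    exact (hch (hsub' hu) (hsub' hv) hne).elim huv.1 huv.2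
  calc E.classCount a c ≤ (E.orientedClass a b '' E.betweenSet a c).ncard := by
        unfold classCount
        rw [himg]
        exact ncard_image_le hfin
    _ < E.classCount a b := ncard_lt_ncard ⟨image_mono hsub, fun h => hb' (h hb)⟩ (hrect a b)

end SCExtension
/-! ### Filling in the branch cuts -/

/-- A tree-like set in which any two points are separated by finitely many turns: `rank a b` drops
when a final piece of the hull that contains an incomparable pair is cut off. -/
class TurnTree (P : Type u) where
  side : P → P → Prop
  isTreeSide : IsTreeSide side
  rank : P → P → ℕ
  rank_comm : ∀ a b, rank a b = rank b a
  rank_lt : ∀ {a b c u v : P}, c ∈ Hull side a b → u ∈ Hull side c b → v ∈ Hull side c b →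
    u ≠ v → (side u v ↔ side v u) → rank a c < rank a b

namespace TurnTree

variable {P : Type u} [TurnTree P]

theorem irrefl (x : P) : ¬ side x x := isTreeSide.irrefl x

theorem side_ne {x y : P} (h : side x y) : x ≠ y := by
  rintro rfl
  exact irrefl x h

/-- A virtual point of the tree, encoded by the set `L` of all points that have it on their upper
side: of any two points, one has the other one and the virtual point on the same side. -/
def IsCut (L : Set P) : Prop :=
  ∀ z w : P, z ≠ w → (z ∈ L ↔ side z w) ∨ (w ∈ L ↔ side w z)

/-- The virtual point at the peak of a way that leads up from `x` and then down to `y`: it is above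
`z` when `z` is `x` or `y`, or has `x` or `y` on its upper side. -/
def peakSet (x y : P) : Set P := {z | z = x ∨ side z x ∨ z = y ∨ side z y}

/-- The virtual point at the bottom of a way that leads down from `x` and then up to `y`: it is
above `z` when `z` has both `x` and `y` on its upper side. -/
def valleySet (x y : P) : Set P := {z | side z x ∧ side z y}

/-- The cuts that are added: those at the top of a peak or at the bottom of a valley. -/
def IsBranchCut (L : Set P) : Prop :=
  IsCut L ∧ ∃ x y, L = peakSet x y ∨ L = valleySet x y

/-- `z` is smaller than the cut `L` in the local order. -/
def Below (L : Set P) (z : P) : Prop := z ∈ L ∧ ∀ w, w ∉ L → ¬ side w z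

/-- `z` is larger than the cut `L` in the local order. -/
def Above (L : Set P) (z : P) : Prop := z ∉ L ∧ ∀ w ∈ L, side w z

/-- `x` is `w`, or lies on the same side of `w` as the cut `L`. -/
def CutSide (L : Set P) (w x : P) : Prop :=
  (w ∈ L → x = w ∨ side w x) ∧ (w ∉ L → ¬ side w x)

/-- Seen from the cut `L`, the point `z` lies in a direction that starts upwards or in one that
starts downwards. -/
def HasDirection (L : Set P) (z : P) : Prop :=
  (∃ a, Above L a ∧ (z = a ∨ side a z)) ∨ (∃ a, Below L a ∧ ¬ side a z)

theorem IsCut.side_iff {L : Set P} (hL : IsCut L) {w z : P} (hwz : w ≠ z)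
    (h : ¬ (side w z ↔ w ∈ L)) : z ∈ L ↔ side z w :=
  (hL w z hwz).resolve_left fun h' => h h'.symm

/-- When `w` separates `z` from the cut, the two points lie in the same direction from the cut. -/
theorem IsCut.hasDirection_of_sep {L : Set P} (hL : IsCut L) {w z : P} (hwz : w ≠ z)
    (h : ¬ (side w z ↔ w ∈ L)) (hw : HasDirection L w) : HasDirection L z := by
  have T := isTreeSide (P := P)
  rcases hw with ⟨a, ha, haw⟩ | ⟨a, ha, haw⟩
  · refine Or.inl ⟨a, ha, ?_⟩
    rcases haw with rfl | haw
    · right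
      by_contra h'
      exact h ⟨fun h1 => absurd h1 h', fun h1 => absurd h1 ha.1⟩
    · by_cases hza : z = a
      · exact Or.inl hza
      right
      have h1 : w ∈ L ↔ side w a :=
        (hL a w (side_ne haw)).resolve_left fun h' => ha.1 (h'.2 haw)
      have h2 := T.tree w a z (side_ne haw).symm hwz (Ne.symm hza)
      rcases h2 with h2 | h2
      · exact absurd (h2.symm.trans h1.symm) h
      · exact h2.1 haw
  · refine Or.inr ⟨a, ha, fun haz => ?_⟩
    rcases eq_or_ne w a with rfl | hwa
    · exact h ⟨fun _ => ha.1, fun _ => haz⟩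
    · have h1 : w ∈ L ↔ side w a :=
        (hL a w hwa.symm).resolve_left fun h' => haw (h'.1 ha.1)
      rcases T.tree w a z hwa hwz (side_ne haz) with h2 | h2
      · exact h (h2.symm.trans h1.symm)
      · exact haw (h2.2 haz)

/-- The point `z` has a direction at the cut if `z` and all points between `z` and the cut have some
point `x` on the same side as the cut, because there are only finitely many turns between `x` and
`z`. -/
theorem IsCut.hasDirection_aux {L : Set P} (hL : IsCut L) (x : P) : ∀ (n : ℕ) (z : P),
    rank x z = n → (∀ w, (w = z ∨ (w ≠ z ∧ ¬ (side w z ↔ w ∈ L))) → CutSide L w x) →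
    HasDirection L z := by
  have T := isTreeSide (P := P)
  intro n
  induction n using Nat.strong_induction_on with
  | _ n ih =>
  intro z hn hz
  -- A turn from `z` to a point `w` on the way to the cut lowers the rank.
  have step : ∀ w, w ≠ z → ¬ (side w z ↔ w ∈ L) → (side w z ↔ side z w) → HasDirection L z := by
    intro w hwz hs hinc
    have hcw := hz w (Or.inr ⟨hwz, hs⟩)
    have hw : w ∈ Hull side x z := by
      by_cases hwx : w = x
      · exact Or.inl hwx
      refine Or.inr (Or.inr ⟨hwx, hwz, fun h' => hs ?_⟩)
      constructor
      · intro h1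
        by_contra h2
        exact hcw.2 h2 (h'.2 h1)
      · intro h1
        exact h'.1 ((hcw.1 h1).resolve_left (Ne.symm hwx))
    have hlt : rank x w < n :=
      hn ▸ rank_lt hw (left_mem_hull w z) (right_mem_hull w z) hwz hinc
    refine hL.hasDirection_of_sep hwz hs (ih _ hlt w rfl ?_)
    rintro w' (rfl | ⟨h1, h2⟩)
    · exact hcw
    · by_cases hwz' : w' = z
      · exact hz w' (Or.inl hwz')
      refine hz w' (Or.inr ⟨hwz', fun h3 => ?_⟩)
      have h4 : w ∈ L ↔ side w w' := hL.side_iff h1 h2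
      rcases T.tree w w' z h1.symm hwz hwz' with h5 | h5
      · exact hs (h5.symm.trans h4.symm)
      · exact h2 (h5.trans h3)
  by_cases hzL : z ∈ L
  · by_cases hex : ∃ w, w ∉ L ∧ side w z
    · obtain ⟨w, hw, hwz⟩ := hex
      have hs : ¬ (side w z ↔ w ∈ L) := fun h => hw (h.1 hwz)
      refine step w (side_ne hwz) hs ?_
      have := (hL.side_iff (side_ne hwz) hs).1 hzL
      exact ⟨fun _ => this, fun _ => hwz⟩
    · push Not at hex
      exact Or.inr ⟨z, ⟨hzL, hex⟩, irrefl z⟩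
  · by_cases hex : ∃ w, w ∈ L ∧ ¬ side w z
    · obtain ⟨w, hw, hwz⟩ := hex
      have hs : ¬ (side w z ↔ w ∈ L) := fun h => hwz (h.2 hw)
      have hne : w ≠ z := fun h => hzL (h ▸ hw)
      refine step w hne hs ?_
      have : ¬ side z w := fun h => hzL ((hL.side_iff hne hs).2 h)
      exact ⟨fun h => absurd h hwz, fun h => absurd h this⟩
    · push Not at hex
      exact Or.inl ⟨z, ⟨hzL, hex⟩, Or.inl rfl⟩

/-- Every point `z` has a direction at the cut at a peak or valley of `x` and `y`: the number of
turns is measured from `x`, or else from `y` for a point between `z` and the cut. -/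
theorem IsBranchCut.hasDirection {L : Set P} (hL : IsBranchCut L) (z : P) : HasDirection L z := by
  have T := isTreeSide (P := P)
  obtain ⟨hL, x, y, hxy⟩ := hL
  -- Each point sees `x` or `y` on the side of the cut.
  have hW : ∀ w, CutSide L w x ∨ CutSide L w y := by
    intro w
    rcases hxy with rfl | rfl
    · by_cases hw : w ∈ peakSet x y
      · rcases hw with h | h | h | h
        · exact Or.inl ⟨fun _ => Or.inl h.symm, fun h' => absurd (Or.inl h) h'⟩
        · exact Or.inl ⟨fun _ => Or.inr h, fun h' => absurd (Or.inr (Or.inl h)) h'⟩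
        · exact Or.inr ⟨fun _ => Or.inl h.symm, fun h' => absurd (Or.inr (Or.inr (Or.inl h))) h'⟩
        · exact Or.inr ⟨fun _ => Or.inr h, fun h' => absurd (Or.inr (Or.inr (Or.inr h))) h'⟩
      · exact Or.inl ⟨fun h => absurd h hw, fun _ h => hw (Or.inr (Or.inl h))⟩
    · by_cases hw : w ∈ valleySet x y
      · exact Or.inl ⟨fun _ => Or.inr hw.1, fun h => absurd hw h⟩
      · by_cases hwx : side w x
        · exact Or.inr ⟨fun h => absurd h hw, fun _ h => hw ⟨hwx, h⟩⟩
        · exact Or.inl ⟨fun h => absurd h hw, fun _ => hwx⟩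
  by_cases hx : ∀ w, (w = z ∨ (w ≠ z ∧ ¬ (side w z ↔ w ∈ L))) → CutSide L w x
  · exact hL.hasDirection_aux x _ z rfl hx
  simp only [not_forall] at hx
  obtain ⟨w₀, hw₀, hnot⟩ := hx
  have hdir : HasDirection L w₀ := by
    refine hL.hasDirection_aux y _ w₀ rfl ?_
    rintro w (rfl | ⟨hne, hs⟩)
    · exact (hW w).resolve_left hnot
    · refine (hW w).resolve_left fun hwx => hnot ?_
      have h1 : w₀ ∈ L ↔ side w₀ w := hL.side_iff hne hs
      have h2 : side w₀ x ↔ w₀ ∈ L := by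
        rcases eq_or_ne x w with rfl | hxw
        · exact h1.symm
        have h3 : side w x ↔ w ∈ L := by
          constructor
          · intro h4
            by_contra h5
            exact hwx.2 h5 h4
          · exact fun h4 => (hwx.1 h4).resolve_left hxw
        have h4 : w₀ ≠ x := by
          rintro rfl
          exact hs h3
        rcases T.tree w w₀ x hne hxw.symm h4 with h5 | h5
        · exact absurd (h5.trans h3) hs
        · exact h5.symm.trans h1.symm
      exact ⟨fun h => Or.inr (h2.2 h), fun h h' => h (h2.1 h')⟩
  rcases hw₀ with rfl | ⟨hne, hs⟩
  · exact hdir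
  · exact hL.hasDirection_of_sep hne hs hdir

theorem Below.peak (x y : P) : Below (peakSet x y) x :=
  ⟨Or.inl rfl, fun _ hw h => hw (Or.inr (Or.inl h))⟩

theorem peakSet_comm (x y : P) : peakSet x y = peakSet y x := by
  ext z
  constructor <;> rintro (h | h | h | h)
  · exact Or.inr (Or.inr (Or.inl h))
  · exact Or.inr (Or.inr (Or.inr h))
  · exact Or.inl h
  · exact Or.inr (Or.inl h)
  · exact Or.inr (Or.inr (Or.inl h))
  · exact Or.inr (Or.inr (Or.inr h))
  · exact Or.inl h
  · exact Or.inr (Or.inl h)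

theorem Above.valley (x y : P) : Above (valleySet x y) x :=
  ⟨fun h => irrefl x h.1, fun _ hw => hw.1⟩

theorem valleySet_comm (x y : P) : valleySet x y = valleySet y x := by
  ext z
  exact and_comm

end TurnTree

open TurnTree

/-- The set `P` together with its branch cuts. -/
inductive Fill (P : Type u) [TurnTree P] : Type u
  | elt (x : P) : Fill P
  | cut (L : Set P) (h : IsBranchCut L) : Fill P

namespace Fill

variable {P : Type u} [TurnTree P]

/-- The side function of an element of `P`, extended to the cuts. -/
def eltUp (x : P) : Fill P → Prop
  | elt y => side x y
  | cut L _ => x ∈ L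

/-- The side function of the filled set: a point is above a cut if it lies in a direction that
starts upwards from the cut. -/
def up : Fill P → Fill P → Prop
  | elt x, β => eltUp x β
  | cut L _, β => ∃ z, Above L z ∧ (β = elt z ∨ eltUp z β)

theorem eltUp_ne {x : P} {β : Fill P} (h : eltUp x β) : elt x ≠ β := by
  rintro rfl
  exact irrefl x h

theorem up_irrefl (α : Fill P) : ¬ up α α := by
  cases α with
  | elt x => exact irrefl x
  | cut L h =>
    rintro ⟨z, hz, h1 | h1⟩
    · cases h1
    · exact hz.1 h1

theorem tree_elt (x y : P) (hxy : x ≠ y) (γ : Fill P) (hx : elt x ≠ γ) (hy : elt y ≠ γ) :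
    (side x y ↔ eltUp x γ) ∨ (side y x ↔ eltUp y γ) := by
  cases γ with
  | elt z => exact isTreeSide.tree x y z hxy (fun h => hx (h ▸ rfl)) (fun h => hy (h ▸ rfl))
  | cut L h => exact (h.1 x y hxy).imp Iff.symm Iff.symm

theorem eltUp_of_above_below {L : Set P} {a b : P} (ha : Above L a) (hb : Below L b)
    {β : Fill P} (h : β = elt a ∨ eltUp a β) : eltUp b β := by
  have hba : side b a := ha.2 b hb.1
  have hab : ¬ side a b := hb.2 a ha.1
  rcases h with rfl | h
  · exact hba
  · have hne : elt b ≠ β := by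
      rintro rfl
      exact hab h
    rcases tree_elt b a (side_ne hba) β hne (eltUp_ne h) with h1 | h1
    · exact h1.1 hba
    · exact absurd (h1.2 h) hab

/-- A point that is not above a cut lies in a direction that starts downwards from the cut. -/
theorem exists_below_of_not_up {L : Set P} {hL : IsBranchCut L} {β : Fill P}
    (hne : β ≠ cut L hL) (h : ¬ up (cut L hL) β) : ∃ z, Below L z ∧ ¬ eltUp z β := by
  cases β with
  | elt b =>
    rcases hL.hasDirection b with ⟨a, ha, h1⟩ | h1
    · exact absurd ⟨a, ha, h1.imp (fun h2 => congrArg elt h2) id⟩ h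
    · exact h1
  | cut L' hL' =>
    have hLL : L ≠ L' := by
      rintro rfl
      exact hne rfl
    obtain ⟨b, hb⟩ : ∃ b, ¬ (b ∈ L ↔ b ∈ L') := by
      by_contra hcon
      push Not at hcon
      exact hLL (Set.ext hcon)
    rcases hL.hasDirection b with ⟨a, ha, h1⟩ | ⟨a, ha, h1⟩
    · refine absurd ⟨a, ha, Or.inr ?_⟩ h
      change a ∈ L'
      rcases h1 with rfl | h1
      · by_contra h2
        exact hb ⟨fun h3 => absurd h3 ha.1, fun h3 => absurd h3 h2⟩
      · by_contra h2
        have h3 := (hL.1 a b (side_ne h1)).resolve_left fun h4 => ha.1 (h4.2 h1)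
        have h4 := (hL'.1 a b (side_ne h1)).resolve_left fun h4 => h2 (h4.2 h1)
        exact hb (h3.trans h4.symm)
    · refine ⟨a, ha, fun h2 => ?_⟩
      change a ∈ L' at h2
      rcases eq_or_ne a b with rfl | hab
      · exact hb ⟨fun _ => h2, fun _ => ha.1⟩
      · have h3 := (hL.1 a b hab).resolve_left fun h4 => h1 (h4.1 ha.1)
        have h4 := (hL'.1 a b hab).resolve_left fun h4 => h1 (h4.1 h2)
        exact hb (h3.trans h4.symm)

theorem tree_elt_cut (x : P) (L : Set P) (hL : IsBranchCut L) (γ : Fill P) (hx : elt x ≠ γ)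
    (hγ : γ ≠ cut L hL) :
    (x ∈ L ↔ eltUp x γ) ∨ (up (cut L hL) (elt x) ↔ up (cut L hL) γ) := by
  by_contra hcon
  obtain ⟨h1, h2⟩ := not_or.1 hcon
  apply h1
  by_cases hvx : up (cut L hL) (elt x)
  · have hvγ : ¬ up (cut L hL) γ := fun h => h2 ⟨fun _ => h, fun _ => hvx⟩
    obtain ⟨b, hb, hbγ⟩ := exists_below_of_not_up hγ hvγ
    obtain ⟨a, ha, hax⟩ := hvx
    have hnot : ¬ (γ = elt a ∨ eltUp a γ) := fun h => hbγ (eltUp_of_above_below ha hb h)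
    push Not at hnot
    rcases hax with hax | hax
    · cases hax
      exact ⟨fun h => absurd h ha.1, fun h => absurd h hnot.2⟩
    · have hax : side a x := hax
      have h3 := (hL.1 a x (side_ne hax)).resolve_left fun h4 => ha.1 (h4.2 hax)
      have h4 := (tree_elt a x (side_ne hax) γ hnot.1.symm hx).resolve_left
        fun h4 => hnot.2 (h4.1 hax)
      exact h3.trans h4
  · have hvγ : up (cut L hL) γ := by
      by_contra h
      exact h2 ⟨fun h' => absurd h' hvx, fun h' => absurd h' h⟩
    obtain ⟨b, hb, hbx⟩ := exists_below_of_not_up (by simp) hvx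
    obtain ⟨a, ha, haγ⟩ := hvγ
    have hbγ := eltUp_of_above_below ha hb haγ
    have hbx : ¬ side b x := hbx
    rcases eq_or_ne b x with rfl | hne
    · exact ⟨fun _ => hbγ, fun _ => hb.1⟩
    · have h3 := (hL.1 b x hne).resolve_left fun h4 => hbx (h4.1 hb.1)
      have h4 := (tree_elt b x hne γ (eltUp_ne hbγ) hx).resolve_left fun h4 => hbx (h4.2 hbγ)
      exact h3.trans h4

theorem isTreeSide_up : IsTreeSide (up : Fill P → Fill P → Prop) where
  irrefl := up_irrefl
  tree := by
    intro α β γ hαβ hαγ hβγ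
    cases α with
    | elt x =>
      cases β with
      | elt y => exact tree_elt x y (fun h => hαβ (h ▸ rfl)) γ hαγ hβγ
      | cut L hL => exact tree_elt_cut x L hL γ hαγ hβγ.symm
    | cut L hL =>
      cases β with
      | elt y => exact (tree_elt_cut y L hL γ hβγ hαγ.symm).symm
      | cut L' hL' =>
        have key : ∀ z : P, elt z ≠ γ → ¬ (z ∈ L' ↔ eltUp z γ) → ¬ (z ∈ L' ↔ z ∈ L) →
            (up (cut L' hL') (cut L hL) ↔ up (cut L' hL') γ) := by
          intro z hz h1 h2
          have h3 := (tree_elt_cut z L' hL' γ hz hβγ.symm).resolve_left h1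
          have h4 := (tree_elt_cut z L' hL' (cut L hL) (by simp) hαβ).resolve_left h2
          exact h4.symm.trans h3
        by_contra hcon
        obtain ⟨h1, h2⟩ := not_or.1 hcon
        apply h2
        by_cases hv : up (cut L hL) (cut L' hL')
        · have hvγ : ¬ up (cut L hL) γ := fun h => h1 ⟨fun _ => h, fun _ => hv⟩
          obtain ⟨b, hb, hbγ⟩ := exists_below_of_not_up hαγ.symm hvγ
          obtain ⟨a, ha, haβ⟩ := hv
          have haβ : a ∈ L' := haβ.resolve_left (by simp)
          have hnot : ¬ (γ = elt a ∨ eltUp a γ) := fun h => hbγ (eltUp_of_above_below ha hb h)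
          push Not at hnot
          exact key a hnot.1.symm (fun h => hnot.2 (h.1 haβ)) (fun h => ha.1 (h.1 haβ))
        · have hvγ : up (cut L hL) γ := by
            by_contra h
            exact h1 ⟨fun h' => absurd h' hv, fun h' => absurd h' h⟩
          obtain ⟨b, hb, hbβ⟩ := exists_below_of_not_up hαβ.symm hv
          obtain ⟨a, ha, haγ⟩ := hvγ
          have hbγ := eltUp_of_above_below ha hb haγ
          exact key b (eltUp_ne hbγ) (fun h => hbβ (h.2 hbγ)) (fun h => hbβ (h.2 hb.1))

/-- The filled set carries the local order of its sides, not an order of `P`. -/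
instance : PartialOrder (Fill P) where
  le := LocalLE up
  le_refl := localLE_refl
  le_trans _ _ _ := localLE_trans
  le_antisymm _ _ := isTreeSide_up.localLE_antisymm

/-- In the local order it suffices to compare the sides of elements of `P`. -/
theorem lt_iff {α β : Fill P} : α < β ↔ up α β ∧ ∀ z : P, eltUp z α → eltUp z β := by
  constructor
  · intro h
    exact ⟨h.le.2.resolve_left h.ne, fun z => h.le.1 (elt z)⟩
  · rintro ⟨h1, h2⟩
    refine lt_of_le_of_ne ⟨fun γ hγ => ?_, Or.inr h1⟩ ?_
    · cases γ with
      | elt z => exact h2 z hγ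
      | cut L hL =>
        obtain ⟨z, hz, rfl | hzα⟩ := hγ
        · exact ⟨z, hz, Or.inr h1⟩
        · exact ⟨z, hz, Or.inr (h2 z hzα)⟩
    · rintro rfl
      exact up_irrefl α h1

theorem elt_lt_cut {L : Set P} {hL : IsBranchCut L} {x : P} (hx : Below L x) :
    elt x < cut L hL :=
  lt_iff.2 ⟨hx.1, fun z hz => by_contra fun h => hx.2 z h hz⟩

theorem cut_lt_elt {L : Set P} {hL : IsBranchCut L} {x : P} (hx : Above L x) :
    cut L hL < elt x :=
  lt_iff.2 ⟨⟨x, hx, Or.inl rfl⟩, hx.2⟩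

end Fill
end OrderTrees

namespace OrderTrees
open TurnTree
namespace TurnTree

variable {P : Type u} [TurnTree P]

theorem side_of_side_of_not_side {z w c : P} (h1 : ¬ side z w) (h2 : side w z)
    (h3 : c = z ∨ side z c) : side w c := by
  rcases h3 with rfl | h3
  · exact h2
  · have hwc : w ≠ c := by
      rintro rfl
      exact h1 h3
    rcases isTreeSide.tree z w c (side_ne h2).symm (side_ne h3) hwc with h | h
    · exact absurd (h.2 h3) h1
    · exact h.1 h2

theorem side_or_side {z w : P} (c : P) (h1 : side z w) (h2 : side w z) : side z c ∨ side w c := by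
  rcases eq_or_ne z c with rfl | hz
  · exact Or.inr h2
  rcases eq_or_ne w c with rfl | hw
  · exact Or.inl h1
  exact (isTreeSide.tree z w c (side_ne h1) hz hw).imp (fun h => h.1 h1) (fun h => h.1 h2)

theorem not_above_both {z w c : P} (hzw : z ≠ w) (h1 : ¬ side z w) (h2 : ¬ side w z)
    (h3 : c = z ∨ side z c) : ¬ (c = w ∨ side w c) := by
  rintro (rfl | h4)
  · exact h3.elim (fun h => hzw h.symm) h1
  · rcases h3 with rfl | h3
    · exact h2 h4
    · rcases isTreeSide.tree z w c hzw (side_ne h3) (side_ne h4) with h | h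
      · exact h1 (h.2 h3)
      · exact h2 (h.2 h4)

theorem mem_peakSet {x y z : P} :
    z ∈ peakSet x y ↔ (x = z ∨ side z x) ∨ (y = z ∨ side z y) := by
  unfold peakSet
  simp only [mem_ofPred_eq, or_assoc, eq_comm]

/-- The peak set of `a` and `b` is a cut as soon as it contains no two points of which neither lies
above the other. -/
theorem isCut_peakSet {a b : P} (h : ∀ z ∈ peakSet a b, ∀ w ∈ peakSet a b, z ≠ w → ¬ side z w →
    side w z) : IsCut (peakSet a b) := by
  intro z w hzw
  by_contra hcon
  obtain ⟨h1, h2⟩ := not_or.1 hcon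
  by_cases hz : z ∈ peakSet a b
  · have hzw' : ¬ side z w := fun h => h1 ⟨fun _ => h, fun _ => hz⟩
    by_cases hw : w ∈ peakSet a b
    · exact h2 ⟨fun _ => h z hz w hw hzw hzw', fun _ => hw⟩
    · have hwz : side w z := by
        by_contra h
        exact h2 ⟨fun h' => absurd h' hw, fun h' => absurd h' h⟩
      exact absurd (mem_peakSet.2 ((mem_peakSet.1 hz).imp
        (fun h => Or.inr (side_of_side_of_not_side hzw' hwz h))
        (fun h => Or.inr (side_of_side_of_not_side hzw' hwz h)))) hw
  · have hzw' : side z w := by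
      by_contra h
      exact h1 ⟨fun h' => absurd h' hz, fun h' => absurd h' h⟩
    by_cases hw : w ∈ peakSet a b
    · have hwz : ¬ side w z := fun h => h2 ⟨fun _ => h, fun _ => hw⟩
      exact absurd (mem_peakSet.2 ((mem_peakSet.1 hw).imp
        (fun h => Or.inr (side_of_side_of_not_side hwz hzw' h))
        (fun h => Or.inr (side_of_side_of_not_side hwz hzw' h)))) hz
    · have hwz : side w z := by
        by_contra h
        exact h2 ⟨fun h' => absurd h' hw, fun h' => absurd h' h⟩
      rcases side_or_side a hzw' hwz with h | h
      · exact absurd (mem_peakSet.2 (Or.inl (Or.inr h))) hz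
      · exact absurd (mem_peakSet.2 (Or.inl (Or.inr h))) hw

/-- The valley set of `a` and `b` is a cut as soon as no two points outside it lie above each other.
-/
theorem isCut_valleySet {a b : P} (h : ∀ z ∉ valleySet a b, ∀ w ∉ valleySet a b, side z w →
    ¬ side w z) : IsCut (valleySet a b) := by
  intro z w hzw
  by_contra hcon
  obtain ⟨h1, h2⟩ := not_or.1 hcon
  by_cases hz : z ∈ valleySet a b
  · have hzw' : ¬ side z w := fun h => h1 ⟨fun _ => h, fun _ => hz⟩
    by_cases hw : w ∈ valleySet a b
    · have hwz : ¬ side w z := fun h => h2 ⟨fun _ => h, fun _ => hw⟩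
      exact absurd (Or.inr hw.1) (not_above_both hzw hzw' hwz (Or.inr hz.1))
    · have hwz : side w z := by
        by_contra h
        exact h2 ⟨fun h' => absurd h' hw, fun h' => absurd h' h⟩
      exact absurd ⟨side_of_side_of_not_side hzw' hwz (Or.inr hz.1),
        side_of_side_of_not_side hzw' hwz (Or.inr hz.2)⟩ hw
  · have hzw' : side z w := by
      by_contra h
      exact h1 ⟨fun h' => absurd h' hz, fun h' => absurd h' h⟩
    by_cases hw : w ∈ valleySet a b
    · have hwz : ¬ side w z := fun h => h2 ⟨fun _ => h, fun _ => hw⟩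
      exact absurd ⟨side_of_side_of_not_side hwz hzw' (Or.inr hw.1),
        side_of_side_of_not_side hwz hzw' (Or.inr hw.2)⟩ hz
    · exact h2 ⟨fun h' => absurd h' hw, fun h' => absurd h' (h z hz w hw hzw')⟩

end TurnTree

namespace Fill

variable {P : Type u} [TurnTree P]

/-! ### Connectedness of the filled set -/

/-- Two points of the filled set are joined by finitely many comparable pairs. -/
def Joined (α β : Fill P) : Prop := Relation.ReflTransGen (fun a b => a ≤ b ∨ b ≤ a) α β

theorem Joined.symm {α β : Fill P} (h : Joined α β) : Joined β α := by
  induction h with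
  | refl => exact Relation.ReflTransGen.refl
  | tail _ h ih => exact Relation.ReflTransGen.head h.symm ih

theorem Joined.trans {α β γ : Fill P} (h : Joined α β) (h' : Joined β γ) : Joined α γ :=
  Relation.ReflTransGen.trans h h'

theorem Joined.of_le {α β : Fill P} (h : α ≤ β) : Joined α β :=
  Relation.ReflTransGen.single (Or.inl h)

theorem Joined.of_ge {α β : Fill P} (h : β ≤ α) : Joined α β :=
  Relation.ReflTransGen.single (Or.inr h)

/-- Suppose that `a` and `b` lie above each other and that there is no peak cut between them.  Then
the hull from `a` to `b` can be divided at a point `z` so that both pieces have lower rank. -/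
theorem exists_split_of_not_isCut_peakSet {a b : P} (hab : side a b) (hba : side b a)
    (hcut : ¬ IsCut (peakSet a b)) :
    ∃ z w, z ∈ Hull side a b ∧ w ∈ Hull side z b ∧ z ≠ w ∧ (side z w ↔ side w z) ∧
      a ≠ z ∧ (side a z ↔ side z a) := by
  have main : ∀ z w : P, z ≠ w → ¬ side z w → ¬ side w z → (a = z ∨ side z a) →
      (b = w ∨ side w b) → ∃ z w, z ∈ Hull side a b ∧ w ∈ Hull side z b ∧ z ≠ w ∧
      (side z w ↔ side w z) ∧ a ≠ z ∧ (side a z ↔ side z a) := by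
    intro z w hzw hzw' hwz ha hb
    have hwa := not_above_both hzw hzw' hwz ha
    have hzb := not_above_both hzw.symm hwz hzw' hb
    rw [not_or] at hwa hzb
    have hza : a ≠ z := by
      rintro rfl
      rcases hb with rfl | hb
      · exact hzb.2 hab
      · rcases isTreeSide.tree w a b (Ne.symm hwa.1) (side_ne hb) (side_ne hab) with h | h
        · exact hwa.2 (h.2 hb)
        · exact hzw' (h.2 hab)
    have ha' := ha.resolve_left hza
    have hwb' : b ≠ w := by
      rintro rfl
      rcases isTreeSide.tree z a b (Ne.symm hza) (Ne.symm hzb.1) (side_ne hab) with h | h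
      · exact hzb.2 (h.1 ha')
      · have := isTreeSide.tree z b a (Ne.symm hzb.1) (Ne.symm hza) (side_ne hba)
        exact this.elim (fun h => hzb.2 (h.2 ha')) (fun h => hwz (h.2 hba))
    have hb' := hb.resolve_left hwb'
    refine ⟨z, w, Or.inr (Or.inr ⟨hza.symm, Ne.symm hzb.1, fun h => hzb.2 (h.1 ha')⟩),
      Or.inr (Or.inr ⟨hzw.symm, hwb'.symm, fun h => hwz (h.2 hb')⟩), hzw,
      ⟨fun h => absurd h hzw', fun h => absurd h hwz⟩, hza, ⟨fun _ => ha', fun _ => ?_⟩⟩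
    exact ((isTreeSide.tree z a b hza.symm (Ne.symm hzb.1) (side_ne hab)).resolve_left
      fun h => hzb.2 (h.1 ha')).2 hab
  by_contra hno
  refine hcut (isCut_peakSet fun z hz w hw hzw hzw' => by_contra fun hwz => hno ?_)
  rcases mem_peakSet.1 hz with h3 | h3 <;> rcases mem_peakSet.1 hw with h4 | h4
  · exact absurd h4 (not_above_both hzw hzw' hwz h3)
  · exact main z w hzw hzw' hwz h3 h4
  · exact main w z hzw.symm hwz hzw' h4 h3
  · exact absurd h4 (not_above_both hzw hzw' hwz h3)

/-- The dual statement for valley cuts. -/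
theorem exists_split_of_not_isCut_valleySet {a b : P} (hne : a ≠ b) (hab : ¬ side a b)
    (hba : ¬ side b a) (hcut : ¬ IsCut (valleySet a b)) :
    ∃ z w, z ∈ Hull side a b ∧ w ∈ Hull side z b ∧ z ≠ w ∧ (side z w ↔ side w z) ∧
      a ≠ z ∧ (side a z ↔ side z a) := by
  have main : ∀ z w : P, side z w → side w z → ¬ side z a → ¬ side w b →
      ∃ z w, z ∈ Hull side a b ∧ w ∈ Hull side z b ∧ z ≠ w ∧
      (side z w ↔ side w z) ∧ a ≠ z ∧ (side a z ↔ side z a) := by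
    intro z w hzw hwz ha hb
    have hwa : side w a := (side_or_side a hzw hwz).resolve_left ha
    have hzb : side z b := (side_or_side b hzw hwz).resolve_right hb
    have hza : a ≠ z := by
      rintro rfl
      exact hab hzb
    have hwb : b ≠ w := by
      rintro rfl
      exact hba hwa
    refine ⟨z, w, Or.inr (Or.inr ⟨hza.symm, side_ne hzb, fun h => ha (h.2 hzb)⟩),
      Or.inr (Or.inr ⟨side_ne hwz, hwb.symm, fun h => hb (h.1 hwz)⟩), side_ne hzw,
      ⟨fun _ => hwz, fun _ => hzw⟩, hza, ⟨fun h => ?_, fun h => absurd h ha⟩⟩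
    exact absurd (((isTreeSide.tree z a b hza.symm (side_ne hzb) hne).resolve_left
      fun h => ha (h.2 hzb)).1 h) hab
  by_contra hno
  refine hcut (isCut_valleySet fun z hz w hw hzw' hwz => hno ?_)
  have hz' : ¬ side z a ∨ ¬ side z b := not_and_or.1 hz
  have hw' : ¬ side w a ∨ ¬ side w b := not_and_or.1 hw
  rcases hz' with h3 | h3 <;> rcases hw' with h4 | h4
  · exact ((side_or_side a hzw' hwz).elim h3 h4).elim
  · exact main z w hzw' hwz h3 h4
  · exact main w z hwz hzw' h4 h3
  · exact ((side_or_side b hzw' hwz).elim h3 h4).elim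

/-- By induction on the number of turns between `a` and `b`: the two are comparable, or joined
through the peak or valley cut between them, or separated by a point that lowers the number of
turns. -/
theorem joined_elt (a b : P) : Joined (elt a) (elt b) := by
  have T := (isTreeSide (P := P)).tree
  induction hn : rank a b using Nat.strong_induction_on generalizing a b with
  | _ n ih =>
  have split : ∀ a b : P, rank a b = n → (∃ z w, z ∈ Hull side a b ∧ w ∈ Hull side z b ∧ z ≠ w ∧
      (side z w ↔ side w z) ∧ a ≠ z ∧ (side a z ↔ side z a)) → Joined (elt a) (elt b) := by
    rintro a b hn ⟨z, w, hz, hw, hzw, h1, haz, h2⟩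
    have r1 : rank a z < n := hn ▸ rank_lt hz (left_mem_hull _ _) hw hzw h1
    have r2 : rank z b < n := by
      rw [rank_comm, ← hn, rank_comm a b]
      rw [hull_comm] at hz
      exact rank_lt hz (right_mem_hull _ _) (left_mem_hull _ _) haz h2
    exact (ih _ r1 a z rfl).trans (ih _ r2 z b rfl)
  have ord : ∀ a b : P, rank a b = n → side a b → ¬ side b a → Joined (elt a) (elt b) := by
    intro a b hn hab hba
    by_cases hz : ∀ z, side z a → side z b
    · exact Joined.of_le (lt_iff.2 ⟨show up (elt a) (elt b) from hab, hz⟩).le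
    · simp only [not_forall] at hz
      obtain ⟨z, hza, hzb⟩ := hz
      refine split a b hn ⟨z, b, ?_, right_mem_hull _ _, ?_⟩
      · refine Or.inr (Or.inr ⟨side_ne hza, ?_, fun h => hzb (h.1 hza)⟩)
        rintro rfl
        exact hba hza
      · have t1 := T z a b
        have t2 := T z b a
        have h3 := side_ne hza
        have h4 := side_ne hab
        have hzb' : z ≠ b := by
          rintro rfl
          exact hba hza
        have h5 := t1 h3 hzb' h4
        have h6 := t2 hzb' h3 h4.symm
        exact ⟨hzb', by tauto, h3.symm, by tauto⟩
  by_cases hab : side a b <;> by_cases hba : side b a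
  · by_cases hcut : IsCut (peakSet a b)
    · have hL : IsBranchCut (peakSet a b) := ⟨hcut, a, b, Or.inl rfl⟩
      have h1 : elt a < cut _ hL := elt_lt_cut (Below.peak a b)
      have h2 : elt b < cut _ hL := elt_lt_cut (by rw [peakSet_comm]; exact Below.peak b a)
      exact (Joined.of_le h1.le).trans (Joined.of_ge h2.le)
    · exact split a b hn (exists_split_of_not_isCut_peakSet hab hba hcut)
  · exact ord a b hn hab hba
  · exact (ord b a (rank_comm a b ▸ hn) hba hab).symm
  · by_cases hne : a = b
    · rw [hne]; exact Joined.of_le le_rfl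
    by_cases hcut : IsCut (valleySet a b)
    · have hL : IsBranchCut (valleySet a b) := ⟨hcut, a, b, Or.inr rfl⟩
      have h1 : cut _ hL < elt a := cut_lt_elt (Above.valley a b)
      have h2 : cut _ hL < elt b := cut_lt_elt (by rw [valleySet_comm]; exact Above.valley b a)
      exact (Joined.of_ge h1.le).trans (Joined.of_le h2.le)
    · exact split a b hn (exists_split_of_not_isCut_valleySet hne hab hba hcut)

theorem exists_joined_elt (α : Fill P) : ∃ a, Joined α (elt a) := by
  cases α with
  | elt a => exact ⟨a, Joined.of_le le_rfl⟩
  | cut L hL =>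
    obtain ⟨x, y, rfl | rfl⟩ := hL.2
    · exact ⟨x, Joined.of_ge (elt_lt_cut (Below.peak x y)).le⟩
    · exact ⟨x, Joined.of_le (cut_lt_elt (Above.valley x y)).le⟩

instance : SidePoset (Fill P) where
  up := up
  up_irrefl := up_irrefl
  up_of_lt x y h := (lt_iff.1 h).1
  not_up_of_lt x y h h' := up_irrefl y (h.le.1 y h')
  up_iff_up x y z h hx hy hb := by
    by_contra hcon
    obtain ⟨h1, h2⟩ := isTreeSide_up.localLE_between h.le ⟨hx, hy, hcon⟩
    exact hb ⟨lt_of_le_of_ne h1 hx.symm, lt_of_le_of_ne h2 hy⟩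
  conn x y := by
    obtain ⟨a, ha⟩ := exists_joined_elt x
    obtain ⟨b, hb⟩ := exists_joined_elt y
    exact ha.trans ((joined_elt a b).trans hb.symm)

end Fill
end OrderTrees

namespace OrderTrees
open TurnTree
namespace Fill

variable {P : Type u} [TurnTree P]

/-! ### Bounds and symmetries of the filled set -/

/-- A point of a bounded incomparable pair can be replaced by an element of `P` without changing
the common upper bounds. -/
theorem exists_elt_ge {α β γ : Fill P} (h1 : ¬ α ≤ β) (h2 : ¬ β ≤ α) (hα : α ≤ γ) (hβ : β ≤ γ) :
    ∃ z : P, α ≤ elt z ∧ ¬ elt z ≤ β ∧ ¬ β ≤ elt z ∧ ∀ δ, α ≤ δ → β ≤ δ → elt z ≤ δ := by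
  cases α with
  | elt x => exact ⟨x, le_rfl, h1, h2, fun δ h _ => h⟩
  | cut L hL =>
    have hne : cut L hL ≠ β := fun h => h1 h.le
    have hα' : cut L hL < γ := lt_of_le_of_ne hα (fun h => h2 (h ▸ hβ))
    have hβ' : β < γ := lt_of_le_of_ne hβ (fun h => h1 (h ▸ hα))
    have hup : SidePoset.up (cut L hL) β :=
      (SidePoset.up_iff_up β γ _ hβ' hne hα'.ne (fun h => h2 h.1.le)).2
        (SidePoset.up_of_lt _ _ hα')
    obtain ⟨z, hz, hzβ⟩ := hup
    have hz' : cut L hL < elt z := cut_lt_elt hz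
    have hzβ : SidePoset.up (elt z) β := hzβ.resolve_left fun h => h1 (h ▸ hz'.le)
    have hnβ : ¬ β ≤ elt z := by
      intro h
      rcases h.lt_or_eq with h | h
      · exact SidePoset.not_up_of_lt _ _ h hzβ
      · exact h1 (h ▸ hz'.le)
    refine ⟨z, hz'.le, fun h => h1 (hz'.le.trans h), hnβ, fun δ hδ hδ' => ?_⟩
    by_contra hcon
    have hne1 : elt z ≠ δ := fun h => hcon h.le
    have hlt1 : cut L hL < δ := lt_of_le_of_ne hδ (fun h => h2 (h ▸ hδ'))
    have hlt2 : β < δ := lt_of_le_of_ne hδ' (fun h => h1 (h ▸ hδ))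
    have h3 : SidePoset.up (elt z) δ :=
      (SidePoset.up_iff_up β δ _ hlt2 (fun h => hnβ h.symm.le) hne1 (fun h => hnβ h.1.le)).1 hzβ
    have h4 := (SidePoset.up_iff_up _ δ (elt z) hlt1 hz'.ne' hne1 (fun h => hcon h.2.le)).2 h3
    exact SidePoset.not_up_of_lt _ _ hz' h4

/-- The dual statement for common lower bounds. -/
theorem exists_elt_le {α β γ : Fill P} (h1 : ¬ α ≤ β) (h2 : ¬ β ≤ α) (hα : γ ≤ α) (hβ : γ ≤ β) :
    ∃ z : P, elt z ≤ α ∧ ¬ elt z ≤ β ∧ ¬ β ≤ elt z ∧ ∀ δ, δ ≤ α → δ ≤ β → δ ≤ elt z := by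
  cases α with
  | elt x => exact ⟨x, le_rfl, h1, h2, fun δ h _ => h⟩
  | cut L hL =>
    have hne : cut L hL ≠ β := fun h => h1 h.le
    have hα' : γ < cut L hL := lt_of_le_of_ne hα (fun h => h1 (h ▸ hβ))
    have hβ' : γ < β := lt_of_le_of_ne hβ (fun h => h2 (h ▸ hα))
    have hup : ¬ SidePoset.up (cut L hL) β := fun h =>
      SidePoset.not_up_of_lt _ _ hα'
        ((SidePoset.up_iff_up γ β _ hβ' hα'.ne' hne (fun h => h1 h.2.le)).2 h)
    obtain ⟨z, hz, hzβ⟩ := exists_below_of_not_up hne.symm hup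
    have hz' : elt z < cut L hL := elt_lt_cut hz
    have hzβ : ¬ SidePoset.up (elt z) β := hzβ
    have hnβ' : ¬ β ≤ elt z := fun h => h2 (h.trans hz'.le)
    have hnβ : ¬ elt z ≤ β := by
      intro h
      rcases h.lt_or_eq with h | h
      · exact hzβ (SidePoset.up_of_lt _ _ h)
      · exact hnβ' h.symm.le
    refine ⟨z, hz'.le, hnβ, hnβ', fun δ hδ hδ' => ?_⟩
    by_contra hcon
    have hne1 : elt z ≠ δ := fun h => hcon h.symm.le
    have hlt1 : δ < cut L hL := lt_of_le_of_ne hδ (fun h => h1 (h ▸ hδ'))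
    have hlt2 : δ < β := lt_of_le_of_ne hδ' (fun h => h2 (h ▸ hδ))
    have h3 : ¬ SidePoset.up (elt z) δ := fun h => hzβ
      ((SidePoset.up_iff_up δ β _ hlt2 hne1 (fun h => hnβ h.le) (fun h => hnβ h.2.le)).1 h)
    exact h3 ((SidePoset.up_iff_up δ _ (elt z) hlt1 hne1 hz'.ne (fun h => hcon h.1.le)).2
      (SidePoset.up_of_lt _ _ hz'))

theorem eltUp_of_mem_peakSet {x y z : P} {γ : Fill P} (hx : elt x < γ) (hy : elt y < γ)
    (hz : z ∈ peakSet x y) : eltUp z γ := by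
  rcases mem_peakSet.1 hz with (rfl | h) | (rfl | h)
  · exact (lt_iff.1 hx).1
  · exact (lt_iff.1 hx).2 z h
  · exact (lt_iff.1 hy).1
  · exact (lt_iff.1 hy).2 z h

/-- Two incomparable points with a common upper bound have a least common upper bound, which is a
cut. -/
theorem exists_sup {α β γ : Fill P} (h1 : ¬ α ≤ β) (h2 : ¬ β ≤ α) (hα : α ≤ γ) (hβ : β ≤ γ) :
    ∃ L hL, α ≤ cut L hL ∧ β ≤ cut L hL ∧ ∀ δ, α ≤ δ → β ≤ δ → cut L hL ≤ δ := by
  obtain ⟨x, hx, h1, h2, hx'⟩ := exists_elt_ge h1 h2 hα hβ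
  obtain ⟨y, hy, h2, h1, hy'⟩ := exists_elt_ge h2 h1 hβ (hx' γ hα hβ)
  have hxγ : elt x < γ := lt_of_le_of_ne (hx' γ hα hβ)
    (fun h => h2 (h ▸ hy' γ hβ (hx' γ hα hβ)))
  have hyγ : elt y < γ := lt_of_le_of_ne (hy' γ hβ hxγ.le) (fun h => h1 (h ▸ hxγ.le))
  have hcut : IsCut (peakSet x y) := by
    refine isCut_peakSet fun z hz w hw hzw hzw' => ?_
    have hz' := eltUp_of_mem_peakSet hxγ hyγ hz
    have hw' := eltUp_of_mem_peakSet hxγ hyγ hw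
    rcases tree_elt z w hzw γ (eltUp_ne hz') (eltUp_ne hw') with h | h
    · exact absurd (h.2 hz') hzw'
    · exact h.2 hw'
  have hL : IsBranchCut (peakSet x y) := ⟨hcut, x, y, Or.inl rfl⟩
  have hxL : elt x < cut _ hL := elt_lt_cut (Below.peak x y)
  have hyL : elt y < cut _ hL := elt_lt_cut (by rw [peakSet_comm]; exact Below.peak y x)
  refine ⟨_, hL, hx.trans hxL.le, hy.trans hyL.le, fun δ hδ hδ' => ?_⟩
  have hxδ : elt x < δ := lt_of_le_of_ne (hx' δ hδ hδ')
    (fun h => h2 (h ▸ hy' δ hδ' (hx' δ hδ hδ')))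
  have hyδ : elt y < δ := lt_of_le_of_ne (hy' δ hδ' hxδ.le) (fun h => h1 (h ▸ hxδ.le))
  have elt_case : ∀ w : P, elt x < elt w → elt y < elt w → cut _ hL < elt w := by
    intro w hxw hyw
    refine cut_lt_elt ⟨fun hw => ?_, fun z hz => eltUp_of_mem_peakSet hxw hyw hz⟩
    exact irrefl w (eltUp_of_mem_peakSet hxw hyw hw)
  cases δ with
  | elt w => exact (elt_case w hxδ hyδ).le
  | cut L' hL' =>
    have hsub : peakSet x y ⊆ L' := fun z hz => eltUp_of_mem_peakSet hxδ hyδ hz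
    by_cases heq : L' ⊆ peakSet x y
    · obtain rfl : peakSet x y = L' := Subset.antisymm hsub heq
      exact le_rfl
    · obtain ⟨w, hw, hw'⟩ := not_subset.1 heq
      have key : ∀ x' : P, elt x' < cut L' hL' → x' ∈ peakSet x y → ¬ side w x' →
          elt x' < elt w ∧ elt w < cut L' hL' := by
        intro x' hx' hmem hside
        have hne : elt w ≠ elt x' := by
          intro h
          cases h
          exact hw' hmem
        by_contra hcon
        exact hside ((SidePoset.up_iff_up _ _ (elt w) hx' hne (by simp)
          (fun h => hcon ⟨h.1, h.2⟩)).2 hw)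
      have kx := key x hxδ (Or.inl rfl) (fun h => hw' (Or.inr (Or.inl h)))
      have ky := key y hyδ (Or.inr (Or.inr (Or.inl rfl)))
        (fun h => hw' (Or.inr (Or.inr (Or.inr h))))
      exact (elt_case w kx.1 ky.1).le.trans kx.2.le

theorem not_eltUp_of_notMem_valleySet {x y z : P} {γ : Fill P} (hx : γ < elt x) (hy : γ < elt y)
    (hz : z ∉ valleySet x y) : ¬ eltUp z γ := fun h =>
  hz ⟨(lt_iff.1 hx).2 z h, (lt_iff.1 hy).2 z h⟩

/-- Two incomparable points with a common lower bound have a greatest common lower bound, which is a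
cut. -/
theorem exists_inf {α β γ : Fill P} (h1 : ¬ α ≤ β) (h2 : ¬ β ≤ α) (hα : γ ≤ α) (hβ : γ ≤ β) :
    ∃ L hL, cut L hL ≤ α ∧ cut L hL ≤ β ∧ ∀ δ, δ ≤ α → δ ≤ β → δ ≤ cut L hL := by
  obtain ⟨x, hx, h1, h2, hx'⟩ := exists_elt_le h1 h2 hα hβ
  obtain ⟨y, hy, h2, h1, hy'⟩ := exists_elt_le h2 h1 hβ (hx' γ hα hβ)
  have hxγ : γ < elt x := lt_of_le_of_ne (hx' γ hα hβ)
    (fun h => h1 (h ▸ hy' γ hβ (hx' γ hα hβ)))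
  have hyγ : γ < elt y := lt_of_le_of_ne (hy' γ hβ hxγ.le) (fun h => h2 (h ▸ hxγ.le))
  have hne : ∀ {δ : Fill P}, δ < elt x → δ < elt y → ∀ {z}, z ∉ valleySet x y → elt z ≠ δ := by
    rintro δ hδx hδy z hz rfl
    exact hz ⟨(lt_iff.1 hδx).1, (lt_iff.1 hδy).1⟩
  have hcut : IsCut (valleySet x y) := by
    refine isCut_valleySet fun z hz w hw hzw hwz => ?_
    have hz' := not_eltUp_of_notMem_valleySet hxγ hyγ hz
    have hw' := not_eltUp_of_notMem_valleySet hxγ hyγ hw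
    rcases tree_elt z w (side_ne hzw) γ (hne hxγ hyγ hz) (hne hxγ hyγ hw) with h | h
    · exact hz' (h.1 hzw)
    · exact hw' (h.1 hwz)
  have hL : IsBranchCut (valleySet x y) := ⟨hcut, x, y, Or.inr rfl⟩
  have hxL : cut _ hL < elt x := cut_lt_elt (Above.valley x y)
  have hyL : cut _ hL < elt y := cut_lt_elt (by rw [valleySet_comm]; exact Above.valley y x)
  refine ⟨_, hL, hxL.le.trans hx, hyL.le.trans hy, fun δ hδ hδ' => ?_⟩
  have hxδ : δ < elt x := lt_of_le_of_ne (hx' δ hδ hδ')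
    (fun h => h1 (h ▸ hy' δ hδ' (hx' δ hδ hδ')))
  have hyδ : δ < elt y := lt_of_le_of_ne (hy' δ hδ' hxδ.le) (fun h => h2 (h ▸ hxδ.le))
  have elt_case : ∀ w : P, elt w < elt x → elt w < elt y → elt w < cut _ hL := by
    intro w hxw hyw
    refine elt_lt_cut ⟨?_, fun z hz => not_eltUp_of_notMem_valleySet hxw hyw hz⟩
    exact ⟨(lt_iff.1 hxw).1, (lt_iff.1 hyw).1⟩
  cases δ with
  | elt w => exact (elt_case w hxδ hyδ).le
  | cut L' hL' =>
    have hsub : L' ⊆ valleySet x y := fun z hz => by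
      by_contra h
      exact not_eltUp_of_notMem_valleySet hxδ hyδ h hz
    by_cases heq : valleySet x y ⊆ L'
    · obtain rfl : valleySet x y = L' := Subset.antisymm heq hsub
      exact le_rfl
    · obtain ⟨w, hw, hw'⟩ := not_subset.1 heq
      have key : ∀ x' : P, cut L' hL' < elt x' → side w x' →
          cut L' hL' < elt w ∧ elt w < elt x' := by
        intro x' hx' hside
        have hne : elt w ≠ elt x' := by
          intro h
          cases h
          exact irrefl _ hside
        by_contra hcon
        exact hw' ((SidePoset.up_iff_up _ _ (elt w) hx' (by simp) hne
          (fun h => hcon ⟨h.1, h.2⟩)).2 hside)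
      have kx := key x hxδ hw.1
      have ky := key y hyδ hw.2
      exact kx.1.le.trans (elt_case w kx.2 ky.2).le

/-- Two comparable cuts are separated by an element of `P`. -/
theorem exists_elt_between {L L' : Set P} {hL : IsBranchCut L} {hL' : IsBranchCut L'}
    (h : cut L hL < cut L' hL') : ∃ z : P, cut L hL < elt z ∧ elt z < cut L' hL' := by
  have hne : L ≠ L' := by
    rintro rfl
    exact lt_irrefl _ h
  by_contra hcon
  push Not at hcon
  refine hne (Set.ext fun z => ?_)
  exact SidePoset.up_iff_up _ _ (elt z) h (by simp) (by simp) (fun h' => hcon z h'.1 h'.2)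

instance [Countable P] : Countable (Fill P) := by
  have hc : {L : Set P | IsBranchCut L}.Countable := by
    refine ((countable_range fun p : P × P => peakSet p.1 p.2).union
      (countable_range fun p : P × P => valleySet p.1 p.2)).mono ?_
    rintro L ⟨-, x, y, rfl | rfl⟩
    · exact Or.inl ⟨(x, y), rfl⟩
    · exact Or.inr ⟨(x, y), rfl⟩
  have := hc.to_subtype
  let f : Fill P → P ⊕ {L : Set P | IsBranchCut L} := fun α => match α with
    | elt x => Sum.inl x
    | cut L hL => Sum.inr ⟨L, hL⟩
  refine Function.Injective.countable (f := f) ?_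
  intro α β h
  cases α <;> cases β <;> simp [f] at h <;> subst h <;> rfl

end Fill

/-- A group action that preserves the sides. -/
class TurnAction (G P : Type u) [Group G] [TurnTree P] extends MulAction G P where
  side_smul : ∀ (g : G) (x y : P), side (g • x) (g • y) ↔ side x y

namespace Fill

variable {G P : Type u} [Group G] [TurnTree P] [TurnAction G P]

theorem side_inv_smul (g : G) (x y : P) : side (g⁻¹ • x) y ↔ side x (g • y) := by
  rw [← TurnAction.side_smul g (g⁻¹ • x) y, smul_inv_smul]

theorem isBranchCut_translate {L : Set P} (hL : IsBranchCut L) (g : G) :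
    IsBranchCut {z | g⁻¹ • z ∈ L} := by
  refine ⟨fun z w hzw => ?_, ?_⟩
  · have := hL.1 (g⁻¹ • z) (g⁻¹ • w) (fun h => hzw (MulAction.injective g⁻¹ h))
    rwa [TurnAction.side_smul, TurnAction.side_smul] at this
  · obtain ⟨-, x, y, rfl | rfl⟩ := hL
    · refine ⟨g • x, g • y, Or.inl ?_⟩
      ext z
      simp only [peakSet, mem_ofPred_eq, side_inv_smul, inv_smul_eq_iff]
    · refine ⟨g • x, g • y, Or.inr ?_⟩
      ext z
      simp only [valleySet, mem_ofPred_eq, side_inv_smul]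

instance : MulAction G (Fill P) where
  smul g α := match α with
    | elt x => elt (g • x)
    | cut L hL => cut {z | g⁻¹ • z ∈ L} (isBranchCut_translate hL g)
  one_smul α := by
    cases α with
    | elt x => exact congrArg elt (one_smul G x)
    | cut L hL =>
      change cut {z | (1 : G)⁻¹ • z ∈ L} _ = cut L hL
      simp
  mul_smul g h α := by
    cases α with
    | elt x => exact congrArg elt (mul_smul g h x)
    | cut L hL =>
      change cut {z | (g * h)⁻¹ • z ∈ L} _ = cut {z | h⁻¹ • g⁻¹ • z ∈ L} _
      simp [mul_smul]

theorem smul_elt (g : G) (x : P) : g • (elt x : Fill P) = elt (g • x) := rfl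

theorem eltUp_smul (g : G) (x : P) (β : Fill P) : eltUp (g • x) (g • β) ↔ eltUp x β := by
  cases β with
  | elt y => exact TurnAction.side_smul g x y
  | cut L hL =>
    change g⁻¹ • g • x ∈ L ↔ x ∈ L
    rw [inv_smul_smul]

theorem up_smul_of_up (g : G) {α β : Fill P} (h : Fill.up α β) : Fill.up (g • α) (g • β) := by
  cases α with
  | elt x => exact (eltUp_smul g x β).2 h
  | cut L hL =>
    obtain ⟨z, hz, h1⟩ := h
    refine ⟨g • z, ⟨?_, fun w hw => ?_⟩, ?_⟩
    · change ¬ (g⁻¹ • g • z ∈ L)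
      rw [inv_smul_smul]
      exact hz.1
    · rw [← side_inv_smul]
      exact hz.2 _ hw
    · refine h1.imp (fun h => ?_) (fun h => (eltUp_smul g z β).2 h)
      rw [h, smul_elt]

theorem smul_le_smul (g : G) {α β : Fill P} (h : α ≤ β) : g • α ≤ g • β := by
  refine ⟨fun γ hγ => ?_, h.2.imp (fun h' => congrArg (g • ·) h') (up_smul_of_up g)⟩
  have h1 := up_smul_of_up g⁻¹ hγ
  rw [inv_smul_smul] at h1
  have h2 := up_smul_of_up g (h.1 _ h1)
  rwa [smul_inv_smul] at h2

end Fill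
/-! ### Thickening every point to a copy of the rationals -/

theorem SidePoset.up_trans_le {X : Type u} [SidePoset X] {x y z : X} (h : up x y) (hyz : y ≤ z) :
    up x z := by
  rcases hyz.lt_or_eq with hlt | rfl
  · have hzx : x ≠ z := by
      rintro rfl
      exact not_up_of_lt _ _ hlt h
    exact (up_iff_up y z x hlt (up_ne h) hzx (fun h' => not_up_of_lt _ _ h'.1 h)).1 h
  · exact h

namespace Thick

open SidePoset

variable {X : Type u} [SidePoset X]

theorem lt_iff {a b : X ×ₗ ℚ} :
    a < b ↔ (ofLex a).1 < (ofLex b).1 ∨ (ofLex a).1 = (ofLex b).1 ∧ (ofLex a).2 < (ofLex b).2 :=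
  Prod.Lex.lt_iff

/-- The side function of the lexicographic product. -/
def Up (a b : X ×ₗ ℚ) : Prop :=
  up (ofLex a).1 (ofLex b).1 ∨ (ofLex a).1 = (ofLex b).1 ∧ (ofLex a).2 < (ofLex b).2

theorem ext {X : Type u} {a b : X ×ₗ ℚ} (h : (ofLex a).1 = (ofLex b).1)
    (h' : (ofLex a).2 = (ofLex b).2) : a = b := ofLex.injective (Prod.ext h h')

theorem up_iff_up_of_lt (x y z : X ×ₗ ℚ) (hxy : x < y) (hzx : z ≠ x) (hzy : z ≠ y)
    (hb : ¬ (x < z ∧ z < y)) : Up z x ↔ Up z y := by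
  rcases lt_iff.1 hxy with h | ⟨h, h'⟩
  · by_cases h1 : (ofLex z).1 = (ofLex x).1
    · have h2 : (ofLex z).2 < (ofLex x).2 := by
        by_contra h3
        rcases (not_lt.1 h3).lt_or_eq with h4 | h4
        · exact hb ⟨lt_iff.2 (Or.inr ⟨h1.symm, h4⟩), lt_iff.2 (Or.inl (h1 ▸ h))⟩
        · exact hzx (ext h1 h4.symm)
      exact ⟨fun _ => Or.inl (h1 ▸ up_of_lt _ _ h), fun _ => Or.inr ⟨h1, h2⟩⟩
    by_cases h2 : (ofLex z).1 = (ofLex y).1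
    · have h3 : (ofLex y).2 < (ofLex z).2 := by
        by_contra h3
        rcases (not_lt.1 h3).lt_or_eq with h4 | h4
        · exact hb ⟨lt_iff.2 (Or.inl (h2 ▸ h)), lt_iff.2 (Or.inr ⟨h2, h4⟩)⟩
        · exact hzy (ext h2 h4)
      constructor
      · rintro (h4 | h4)
        · exact absurd (h2 ▸ h4) (not_up_of_lt _ _ h)
        · exact absurd h4.1 h1
      · rintro (h4 | h4)
        · exact absurd (h2 ▸ h4) (up_irrefl _)
        · exact absurd h4.2 (lt_asymm h3)
    · have h3 := up_iff_up _ _ (ofLex z).1 h h1 h2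
        (fun h3 => hb ⟨lt_iff.2 (Or.inl h3.1), lt_iff.2 (Or.inl h3.2)⟩)
      exact ⟨fun h4 => Or.inl (h3.1 (h4.resolve_right fun h5 => h1 h5.1)),
        fun h4 => Or.inl (h3.2 (h4.resolve_right fun h5 => h2 h5.1))⟩
  · by_cases h1 : (ofLex z).1 = (ofLex x).1
    · have h2 : (ofLex z).2 < (ofLex x).2 ↔ (ofLex z).2 < (ofLex y).2 := by
        refine ⟨fun h2 => h2.trans h', fun h2 => ?_⟩
        by_contra h3
        rcases (not_lt.1 h3).lt_or_eq with h4 | h4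
        · exact hb ⟨lt_iff.2 (Or.inr ⟨h1.symm, h4⟩), lt_iff.2 (Or.inr ⟨h1.trans h, h2⟩)⟩
        · exact hzx (ext h1 h4.symm)
      simp only [Up, h2, h]
    · simp only [Up, ← h, h1, false_and]

instance : SidePoset (X ×ₗ ℚ) where
  up := Up
  up_irrefl x h := h.elim (up_irrefl _) (fun h => lt_irrefl _ h.2)
  up_of_lt x y h := (lt_iff.1 h).imp (up_of_lt _ _) id
  not_up_of_lt x y h := by
    rintro (h' | h') <;> rcases lt_iff.1 h with h1 | h1
    · exact not_up_of_lt _ _ h1 h'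
    · exact up_irrefl _ (h1.1 ▸ h')
    · exact h1.ne h'.1.symm
    · exact lt_asymm h1.2 h'.2
  up_iff_up := up_iff_up_of_lt
  conn x y := by
    have h1 : ∀ x : X ×ₗ ℚ, (toLex ((ofLex x).1, (0 : ℚ)) : X ×ₗ ℚ) ≤ x ∨
        x ≤ (toLex ((ofLex x).1, (0 : ℚ)) : X ×ₗ ℚ) := by
      intro x
      rcases le_total 0 (ofLex x).2 with h | h
      · exact Or.inl (Prod.Lex.le_iff.2 (Or.inr ⟨rfl, h⟩))
      · exact Or.inr (Prod.Lex.le_iff.2 (Or.inr ⟨rfl, h⟩))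
    refine Relation.ReflTransGen.trans (.single (h1 x).symm) (.tail ?_ (h1 y))
    have h2 : ∀ a b : X, a ≤ b → (toLex (a, (0 : ℚ)) : X ×ₗ ℚ) ≤ toLex (b, (0 : ℚ)) := by
      intro a b h
      rcases h.lt_or_eq with h | h
      · exact Prod.Lex.le_iff.2 (Or.inl h)
      · exact Prod.Lex.le_iff.2 (Or.inr ⟨h, le_rfl⟩)
    exact Relation.ReflTransGen.lift (fun p : X => (toLex (p, (0 : ℚ)) : X ×ₗ ℚ))
      (fun a b (h : a ≤ b ∨ b ≤ a) => h.imp (h2 a b) (h2 b a)) _ _ (conn (ofLex x).1 (ofLex y).1)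

/-- Below every point there are points over the same element of `X` that exceed a given smaller
point. -/
theorem exists_lt_same {a q : X ×ₗ ℚ} (h : a < q) :
    ∃ s < (ofLex q).2, ∀ t, s ≤ t → a < toLex ((ofLex q).1, t) := by
  rcases lt_iff.1 h with h | h
  · exact ⟨(ofLex q).2 - 1, by linarith, fun t _ => lt_iff.2 (Or.inl h)⟩
  · obtain ⟨s, h1, h2⟩ := exists_between h.2
    exact ⟨s, h2, fun t ht => lt_iff.2 (Or.inr ⟨h.1, h1.trans_le ht⟩)⟩

theorem exists_gt_same {a q : X ×ₗ ℚ} (h : q < a) :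
    ∃ s > (ofLex q).2, ∀ t, t ≤ s → toLex ((ofLex q).1, t) < a := by
  rcases lt_iff.1 h with h | h
  · exact ⟨(ofLex q).2 + 1, by linarith, fun t _ => lt_iff.2 (Or.inl h)⟩
  · obtain ⟨s, h1, h2⟩ := exists_between h.2
    exact ⟨s, h1, fun t ht => lt_iff.2 (Or.inr ⟨h.1, ht.trans_lt h2⟩)⟩

end Thick

/-! ### Cuts -/

/-- A Dedekind cut of a partially ordered set.  The lower part is directed and the upper part
codirected, both without extreme element, and the cut is located in every interval from the lower
to the upper part.  Both parts are recorded, since a lower part can be continued in several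
directions at a branching. -/
@[ext] structure DCut (Q : Type u) [PartialOrder Q] where
  lower : Set Q
  upper : Set Q
  lower_nonempty : lower.Nonempty
  upper_nonempty : upper.Nonempty
  lower_down : ∀ a b, a < b → b ∈ lower → a ∈ lower
  upper_up : ∀ a b, a < b → a ∈ upper → b ∈ upper
  directed : ∀ a ∈ lower, ∀ b ∈ lower, ∃ c ∈ lower, a < c ∧ b < c
  codirected : ∀ a ∈ upper, ∀ b ∈ upper, ∃ c ∈ upper, c < a ∧ c < b
  lt : ∀ a ∈ lower, ∀ b ∈ upper, a < b
  located : ∀ a ∈ lower, ∀ b ∈ upper, ∀ c c', a ≤ c → c < c' → c' ≤ b → c ∈ lower ∨ c' ∈ upper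

namespace DCut

variable {Q : Type u} [PartialOrder Q]

/-- The line branches at the cut in the upward direction: some `p` above the lower part does not
lie on the branch of the upper part. -/
def OutBranch (m : DCut Q) : Prop :=
  ∃ p, (∀ a ∈ m.lower, a < p) ∧ p ∉ m.upper ∧ ∃ b ∈ m.upper, ¬ p < b

/-- The line branches at the cut in the downward direction: some `p` below the upper part does not
lie on the branch of the lower part. -/
def InBranch (m : DCut Q) : Prop :=
  ∃ p, (∀ b ∈ m.upper, p < b) ∧ p ∉ m.lower ∧ ∃ a ∈ m.lower, ¬ a < p

theorem lower_of_le {m : DCut Q} {a b : Q} (h : a ≤ b) (hb : b ∈ m.lower) : a ∈ m.lower := by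
  rcases h.lt_or_eq with h | rfl
  · exact m.lower_down a b h hb
  · exact hb

theorem upper_of_le {m : DCut Q} {a b : Q} (h : a ≤ b) (ha : a ∈ m.upper) : b ∈ m.upper := by
  rcases h.lt_or_eq with h | rfl
  · exact m.upper_up a b h ha
  · exact ha

theorem exists_gt_lower {m : DCut Q} {a : Q} (h : a ∈ m.lower) : ∃ b ∈ m.lower, a < b := by
  obtain ⟨c, hc, h1, _⟩ := m.directed a h a h
  exact ⟨c, hc, h1⟩

theorem exists_lt_upper {m : DCut Q} {a : Q} (h : a ∈ m.upper) : ∃ b ∈ m.upper, b < a := by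
  obtain ⟨c, hc, h1, _⟩ := m.codirected a h a h
  exact ⟨c, hc, h1⟩

instance : PartialOrder (DCut Q) where
  le m n := m.lower ⊆ n.lower ∧ n.upper ⊆ m.upper
  le_refl m := ⟨Subset.rfl, Subset.rfl⟩
  le_trans a b c h h' := ⟨h.1.trans h'.1, h'.2.trans h.2⟩
  le_antisymm a b h h' := DCut.ext (h.1.antisymm h'.1) (h'.2.antisymm h.2)

theorem lt_iff {m n : DCut Q} : m < n ↔ ∃ q, q ∈ m.upper ∧ q ∈ n.lower := by
  constructor
  · intro h
    by_contra hcon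
    refine h.not_ge ⟨fun a ha => ?_, fun b hb => ?_⟩
    · obtain ⟨a₀, ha₀⟩ := m.lower_nonempty
      obtain ⟨b₀, hb₀⟩ := n.upper_nonempty
      obtain ⟨c, hc, hac, hac'⟩ := n.directed a ha a₀ (h.le.1 ha₀)
      obtain ⟨c', hc', hcc'⟩ := exists_gt_lower hc
      rcases m.located a₀ ha₀ b₀ (h.le.2 hb₀) c c' hac'.le hcc' (n.lt _ hc' _ hb₀).le with h1 | h1
      · exact m.lower_down _ _ hac h1
      · exact absurd ⟨c', h1, hc'⟩ hcon
    · obtain ⟨a₀, ha₀⟩ := m.lower_nonempty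
      obtain ⟨b₀, hb₀⟩ := n.upper_nonempty
      obtain ⟨c', hc', hbc, hbc'⟩ := m.codirected b hb b₀ (h.le.2 hb₀)
      obtain ⟨c, hc, hcc'⟩ := exists_lt_upper hc'
      rcases n.located a₀ (h.le.1 ha₀) b₀ hb₀ c c' (m.lt _ ha₀ _ hc).le hcc' hbc'.le with h1 | h1
      · exact absurd ⟨c, hc, h1⟩ hcon
      · exact n.upper_up _ _ hbc h1
  · rintro ⟨q, hq, hq'⟩
    refine lt_of_le_of_ne ⟨fun a ha => n.lower_down _ _ (m.lt _ ha _ hq) hq',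
      fun b hb => m.upper_up _ _ (n.lt _ hq' _ hb) hq⟩ ?_
    rintro rfl
    exact (m.lt _ hq' _ hq).false

/-- Cuts are maximal among pairs of a lower and an upper part. -/
theorem eq_of_subset {m n : DCut Q} (h : m.lower ⊆ n.lower) (h' : m.upper ⊆ n.upper) : m = n := by
  refine DCut.ext (h.antisymm fun a ha => ?_) (h'.antisymm fun b hb => ?_)
  · obtain ⟨a₀, ha₀⟩ := m.lower_nonempty
    obtain ⟨b₀, hb₀⟩ := m.upper_nonempty
    obtain ⟨c, hc, hac, hac'⟩ := n.directed a ha a₀ (h ha₀)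
    obtain ⟨c', hc', hcc'⟩ := exists_gt_lower hc
    rcases m.located a₀ ha₀ b₀ hb₀ c c' hac'.le hcc' (n.lt _ hc' _ (h' hb₀)).le with h1 | h1
    · exact m.lower_down _ _ hac h1
    · exact absurd (n.lt _ hc' _ (h' h1)) (lt_irrefl _)
  · obtain ⟨a₀, ha₀⟩ := m.lower_nonempty
    obtain ⟨b₀, hb₀⟩ := m.upper_nonempty
    obtain ⟨c', hc', hbc, hbc'⟩ := n.codirected b hb b₀ (h' hb₀)
    obtain ⟨c, hc, hcc'⟩ := exists_lt_upper hc'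
    rcases m.located a₀ ha₀ b₀ hb₀ c c' (n.lt _ (h ha₀) _ hc).le hcc' hbc'.le with h1 | h1
    · exact absurd (n.lt _ (h h1) _ hc) (lt_irrefl _)
    · exact m.upper_up _ _ hbc h1

end DCut

/-- A countable set with sides whose cuts form a one-dimensional space: there are no end points and
no branching at its own points (`directed_lt`, `directed_gt`), points on different sides have
disjoint neighbourhoods (`up_thick`, `down_thick`), and no cut is a branch point in both
directions. -/
class CutBase (Q : Type u) extends SidePoset Q where
  countable : Countable Q
  exists_lt : ∀ q : Q, ∃ a, a < q
  exists_gt : ∀ q : Q, ∃ a, q < a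
  directed_lt : ∀ a b q : Q, a < q → b < q → ∃ c < q, a < c ∧ b < c
  directed_gt : ∀ a b q : Q, q < a → q < b → ∃ c > q, c < a ∧ c < b
  up_thick : ∀ p q : Q, up p q → ∃ b > p, ∃ a < q, a = b ∨ up b a
  down_thick : ∀ p q : Q, p ≠ q → ¬ up p q → ∃ a < p, ∃ b > q, ¬ up a b
  unbranched : ∀ m : DCut Q, m.OutBranch → ¬ m.InBranch

namespace DCut

open SidePoset

section Thick

variable {P : Type u} [TurnTree P]

/-- A cut that branches upwards lies just above the copy of `ℚ` over a branch cut, namely the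
greatest lower bound of two points on different branches. -/
theorem mem_lower_of_outBranch {m : DCut (Fill P ×ₗ ℚ)} (h : m.OutBranch) :
    ∃ L hL, (∀ r, toLex (Fill.cut L hL, r) ∈ m.lower) ∧
      ∀ a ∈ m.lower, (ofLex a).1 ≤ Fill.cut L hL := by
  obtain ⟨p, hp, hpu, b, hb, hpb⟩ := h
  obtain ⟨a₀, ha₀⟩ := m.lower_nonempty
  have hne : p ≠ b := by
    rintro rfl
    exact hpu hb
  have hbp : ¬ b < p := fun h => hpu (m.upper_up _ _ h hb)
  have h1 : ¬ (ofLex p).1 ≤ (ofLex b).1 := by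
    intro h
    rcases h.lt_or_eq with h | h
    · exact hpb (Thick.lt_iff.2 (Or.inl h))
    · rcases lt_trichotomy (ofLex p).2 (ofLex b).2 with h' | h' | h'
      · exact hpb (Thick.lt_iff.2 (Or.inr ⟨h, h'⟩))
      · exact hne (Thick.ext h h')
      · exact hbp (Thick.lt_iff.2 (Or.inr ⟨h.symm, h'⟩))
  have h2 : ¬ (ofLex b).1 ≤ (ofLex p).1 := by
    intro h
    rcases h.lt_or_eq with h | h
    · exact hbp (Thick.lt_iff.2 (Or.inl h))
    · exact h1 h.symm.le
  have hle : ∀ {a c : Fill P ×ₗ ℚ}, a < c → (ofLex a).1 ≤ (ofLex c).1 := fun h =>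
    (Thick.lt_iff.1 h).elim le_of_lt fun h => h.1.le
  obtain ⟨L, hL, hLp, hLb, hmax⟩ := Fill.exists_inf h1 h2 (hle (hp _ ha₀)) (hle (m.lt _ ha₀ _ hb))
  have hLp' : Fill.cut L hL < (ofLex p).1 := lt_of_le_of_ne hLp fun h => h1 (h ▸ hLb)
  have hLb' : Fill.cut L hL < (ofLex b).1 := lt_of_le_of_ne hLb fun h => h2 (h ▸ hLp)
  have hbd : ∀ a ∈ m.lower, (ofLex a).1 ≤ Fill.cut L hL := fun a ha =>
    hmax _ (hle (hp _ ha)) (hle (m.lt _ ha _ hb))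
  refine ⟨L, hL, fun r => ?_, hbd⟩
  have hcase : ∀ r, a₀ ≤ toLex (Fill.cut L hL, r) ∨ toLex (Fill.cut L hL, r) ≤ a₀ := by
    intro r
    rcases (hbd _ ha₀).lt_or_eq with h3 | h3
    · exact Or.inl (Prod.Lex.le_iff.2 (Or.inl h3))
    · exact (le_total (ofLex a₀).2 r).imp (fun h4 => Prod.Lex.le_iff.2 (Or.inr ⟨h3, h4⟩))
        (fun h4 => Prod.Lex.le_iff.2 (Or.inr ⟨h3.symm, h4⟩))
  rcases hcase r with h3 | h3
  · rcases m.located _ ha₀ _ hb _ (toLex (Fill.cut L hL, r + 1)) h3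
      (Thick.lt_iff.2 (Or.inr ⟨rfl, lt_add_one r⟩)) (Thick.lt_iff.2 (Or.inl hLb')).le with h4 | h4
    · exact h4
    · exact absurd (m.upper_up (toLex (Fill.cut L hL, r + 1)) p
        (Thick.lt_iff.2 (Or.inl hLp')) h4) hpu
  · exact lower_of_le h3 ha₀

/-- A cut that branches downwards lies just below the copy of `ℚ` over a branch cut. -/
theorem mem_upper_of_inBranch {m : DCut (Fill P ×ₗ ℚ)} (h : m.InBranch) :
    ∃ L hL, (∀ r, toLex (Fill.cut L hL, r) ∈ m.upper) ∧
      ∀ b ∈ m.upper, Fill.cut L hL ≤ (ofLex b).1 := by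
  obtain ⟨p, hp, hpu, a, ha, hpa⟩ := h
  obtain ⟨b₀, hb₀⟩ := m.upper_nonempty
  have hne : a ≠ p := by
    rintro rfl
    exact hpu ha
  have hbp : ¬ p < a := fun h => hpu (m.lower_down _ _ h ha)
  have h1 : ¬ (ofLex a).1 ≤ (ofLex p).1 := by
    intro h
    rcases h.lt_or_eq with h | h
    · exact hpa (Thick.lt_iff.2 (Or.inl h))
    · rcases lt_trichotomy (ofLex a).2 (ofLex p).2 with h' | h' | h'
      · exact hpa (Thick.lt_iff.2 (Or.inr ⟨h, h'⟩))
      · exact hne (Thick.ext h h')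
      · exact hbp (Thick.lt_iff.2 (Or.inr ⟨h.symm, h'⟩))
  have h2 : ¬ (ofLex p).1 ≤ (ofLex a).1 := by
    intro h
    rcases h.lt_or_eq with h | h
    · exact hbp (Thick.lt_iff.2 (Or.inl h))
    · exact h1 h.symm.le
  have hle : ∀ {a c : Fill P ×ₗ ℚ}, a < c → (ofLex a).1 ≤ (ofLex c).1 := fun h =>
    (Thick.lt_iff.1 h).elim le_of_lt fun h => h.1.le
  obtain ⟨L, hL, hLa, hLp, hmax⟩ := Fill.exists_sup h1 h2 (hle (m.lt _ ha _ hb₀)) (hle (hp _ hb₀))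
  have hLp' : (ofLex p).1 < Fill.cut L hL := lt_of_le_of_ne hLp fun h => h1 (h ▸ hLa)
  have hLa' : (ofLex a).1 < Fill.cut L hL := lt_of_le_of_ne hLa fun h => h2 (h ▸ hLp)
  have hbd : ∀ b ∈ m.upper, Fill.cut L hL ≤ (ofLex b).1 := fun b hb =>
    hmax _ (hle (m.lt _ ha _ hb)) (hle (hp _ hb))
  refine ⟨L, hL, fun r => ?_, hbd⟩
  have hcase : ∀ r, toLex (Fill.cut L hL, r) ≤ b₀ ∨ b₀ ≤ toLex (Fill.cut L hL, r) := by
    intro r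
    rcases (hbd _ hb₀).lt_or_eq with h3 | h3
    · exact Or.inl (Prod.Lex.le_iff.2 (Or.inl h3))
    · exact (le_total r (ofLex b₀).2).imp (fun h4 => Prod.Lex.le_iff.2 (Or.inr ⟨h3, h4⟩))
        (fun h4 => Prod.Lex.le_iff.2 (Or.inr ⟨h3.symm, h4⟩))
  rcases hcase r with h3 | h3
  · rcases m.located _ ha _ hb₀ (toLex (Fill.cut L hL, r - 1))
      (toLex (Fill.cut L hL, r))
      (Thick.lt_iff.2 (Or.inl hLa')).le
      (Thick.lt_iff.2 (Or.inr ⟨rfl, sub_one_lt r⟩)) h3 with h4 | h4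
    · exact absurd (m.lower_down p (toLex (Fill.cut L hL, r - 1))
        (Thick.lt_iff.2 (Or.inl hLp')) h4) hpu
    · exact h4
  · exact upper_of_le h3 hb₀

/-- A cut that branches upwards lies just above a branch cut of `P`, one that branches downwards
lies just below one; between two branch cuts there is an element of `P`, and the cut would have to
be both above and below its copy of the rationals. -/
theorem not_outBranch_and_inBranch (m : DCut (Fill P ×ₗ ℚ)) (ho : m.OutBranch) :
    ¬ m.InBranch := by
  intro hi
  obtain ⟨L, hL, h1, h2⟩ := mem_lower_of_outBranch ho
  obtain ⟨L', hL', h3, h4⟩ := mem_upper_of_inBranch hi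
  have hle : Fill.cut L hL ≤ Fill.cut L' hL' := h2 _ (lower_of_le (le_refl _) (h1 0)) |>.trans (by
    exact (Thick.lt_iff.1 (m.lt _ (h1 0) _ (h3 0))).elim le_of_lt fun h => h.1.le)
  rcases hle.lt_or_eq with hlt | heq
  · obtain ⟨z, hz1, hz2⟩ := Fill.exists_elt_between hlt
    rcases m.located _ (h1 0) _ (h3 0) (toLex (Fill.elt z, 0)) (toLex (Fill.elt z, 1))
      (Thick.lt_iff.2 (Or.inl hz1)).le (Thick.lt_iff.2 (Or.inr ⟨rfl, zero_lt_one⟩))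
      (Thick.lt_iff.2 (Or.inl hz2)).le with h5 | h5
    · exact hz1.not_ge (h2 _ h5)
    · exact hz2.not_ge (h4 _ h5)
  · have h5 := m.lt _ (h1 0) _ (h3 0)
    rcases Thick.lt_iff.1 h5 with h6 | h6
    · exact h6.ne heq
    · exact lt_irrefl _ h6.2

/-- The copies of `ℚ` provide the room below and above each point; that cuts do not branch in both
directions comes from the branch cuts. -/
instance [Countable P] : CutBase (Fill P ×ₗ ℚ) where
  countable := inferInstanceAs (Countable (Fill P × ℚ))
  exists_lt q := ⟨toLex ((ofLex q).1, (ofLex q).2 - 1),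
    Thick.lt_iff.2 (Or.inr ⟨rfl, sub_one_lt _⟩)⟩
  exists_gt q := ⟨toLex ((ofLex q).1, (ofLex q).2 + 1),
    Thick.lt_iff.2 (Or.inr ⟨rfl, lt_add_one _⟩)⟩
  directed_lt a b q ha hb := by
    obtain ⟨s, hs, h1⟩ := Thick.exists_lt_same ha
    obtain ⟨t, ht, h2⟩ := Thick.exists_lt_same hb
    exact ⟨toLex ((ofLex q).1, max s t), Thick.lt_iff.2 (Or.inr ⟨rfl, max_lt hs ht⟩),
      h1 _ (le_max_left _ _), h2 _ (le_max_right _ _)⟩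
  directed_gt a b q ha hb := by
    obtain ⟨s, hs, h1⟩ := Thick.exists_gt_same ha
    obtain ⟨t, ht, h2⟩ := Thick.exists_gt_same hb
    exact ⟨toLex ((ofLex q).1, min s t), Thick.lt_iff.2 (Or.inr ⟨rfl, lt_min hs ht⟩),
      h1 _ (min_le_left _ _), h2 _ (min_le_right _ _)⟩
  up_thick p q h := by
    rcases h with h | h
    · exact ⟨toLex ((ofLex p).1, (ofLex p).2 + 1), Thick.lt_iff.2 (Or.inr ⟨rfl, lt_add_one _⟩),
        toLex ((ofLex q).1, (ofLex q).2 - 1), Thick.lt_iff.2 (Or.inr ⟨rfl, sub_one_lt _⟩),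
        Or.inr (Or.inl h)⟩
    · obtain ⟨s, h1, h2⟩ := exists_between h.2
      exact ⟨toLex ((ofLex p).1, s), Thick.lt_iff.2 (Or.inr ⟨rfl, h1⟩),
        toLex ((ofLex p).1, s), Thick.lt_iff.2 (Or.inr ⟨h.1, h2⟩), Or.inl rfl⟩
  down_thick p q hne h := by
    have h := not_or.1 h
    by_cases hpt : (ofLex p).1 = (ofLex q).1
    · have h1 : (ofLex q).2 < (ofLex p).2 := by
        by_contra h3
        rcases (not_lt.1 h3).lt_or_eq with h4 | h4
        · exact h.2 ⟨hpt, h4⟩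
        · exact hne (Thick.ext hpt h4)
      obtain ⟨s, h2, h3⟩ := exists_between h1
      exact ⟨toLex ((ofLex p).1, s), Thick.lt_iff.2 (Or.inr ⟨rfl, h3⟩),
        toLex ((ofLex p).1, s), Thick.lt_iff.2 (Or.inr ⟨hpt.symm, h2⟩), up_irrefl _⟩
    · exact ⟨toLex ((ofLex p).1, (ofLex p).2 - 1), Thick.lt_iff.2 (Or.inr ⟨rfl, sub_one_lt _⟩),
        toLex ((ofLex q).1, (ofLex q).2 + 1), Thick.lt_iff.2 (Or.inr ⟨rfl, lt_add_one _⟩),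
        fun h' => h'.elim h.1 fun h' => hpt h'.1⟩
  unbranched := not_outBranch_and_inBranch

end Thick

section Sides

variable {Q : Type u} [CutBase Q]

/-- `n` lies above a point of the upper part of `m`. -/
def AboveUpper (m n : DCut Q) : Prop := ∃ b ∈ m.upper, ∃ a ∈ n.lower, a = b ∨ up b a

/-- `n` lies below a point of the lower part of `m`. -/
def BelowLower (m n : DCut Q) : Prop := ∃ a ∈ m.lower, ∃ b ∈ n.upper, ¬ up a b

/-- The side function on cuts.  At an upward branching only the branch through the cut counts as
the upper side; otherwise everything that is not below counts as above. -/
def Up (m n : DCut Q) : Prop :=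
  (m.OutBranch ∧ AboveUpper m n) ∨ (¬ m.OutBranch ∧ n ≠ m ∧ ¬ BelowLower m n)

theorem Up.irrefl (m : DCut Q) : ¬ Up m m := by
  rintro (⟨-, b, hb, a, ha, h⟩ | h)
  · have hab := m.lt _ ha _ hb
    rcases h with rfl | h
    · exact lt_irrefl _ hab
    · exact not_up_of_lt _ _ hab h
  · exact h.2.1 rfl

theorem aboveUpper_of_lt {m n : DCut Q} (h : m < n) : AboveUpper m n := by
  obtain ⟨q, hq, hq'⟩ := lt_iff.1 h
  exact ⟨q, hq, q, hq', Or.inl rfl⟩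

theorem belowLower_of_lt {m n : DCut Q} (h : m < n) : BelowLower n m := by
  obtain ⟨q, hq, hq'⟩ := lt_iff.1 h
  exact ⟨q, hq', q, hq, up_irrefl q⟩

theorem not_belowLower_of_lt {m n : DCut Q} (h : m < n) : ¬ BelowLower m n := by
  obtain ⟨q, hq, hq'⟩ := lt_iff.1 h
  rintro ⟨a, ha, b, hb, h⟩
  exact h (up_of_lt _ _ ((m.lt _ ha _ hq).trans (n.lt _ hq' _ hb)))

theorem not_aboveUpper_of_lt {m n : DCut Q} (h : m < n) : ¬ AboveUpper n m := by
  obtain ⟨q, hq, hq'⟩ := lt_iff.1 h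
  rintro ⟨b, hb, a, ha, h⟩
  have hab : a < b := (m.lt _ ha _ hq).trans (n.lt _ hq' _ hb)
  rcases h with rfl | h
  · exact lt_irrefl _ hab
  · exact not_up_of_lt _ _ hab h

theorem Up.of_lt {m n : DCut Q} (h : m < n) : Up m n := by
  by_cases ho : m.OutBranch
  · exact Or.inl ⟨ho, aboveUpper_of_lt h⟩
  · exact Or.inr ⟨ho, h.ne', not_belowLower_of_lt h⟩

theorem Up.not_of_lt {m n : DCut Q} (h : m < n) : ¬ Up n m := by
  rintro (h' | h')
  · exact not_aboveUpper_of_lt h h'.2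
  · exact h'.2.2 (belowLower_of_lt h)

/-- The lower side of `m` does not change along `n < n'` unless `m` lies between. -/
theorem belowLower_of_belowLower {m n n' : DCut Q} (ho : ¬ m.OutBranch) (hn : n < n')
    (hne : m ≠ n') (hb : ¬ (n < m ∧ m < n')) (h : BelowLower m n) : BelowLower m n' := by
  by_contra hcon
  have hcon' : ∀ a ∈ m.lower, ∀ b ∈ n'.upper, up a b := fun a ha b hb =>
    by_contra fun h' => hcon ⟨a, ha, b, hb, h'⟩
  obtain ⟨a₀, ha₀, b, hbn, h⟩ := h
  obtain ⟨q, hq, hq'⟩ := lt_iff.1 hn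
  obtain ⟨b₁, hb₁, hb₁b, hb₁q⟩ := n.codirected b hbn q hq
  have h1 : ¬ up a₀ b₁ := fun h' => h (up_trans_le h' hb₁b.le)
  have h2 : ∀ b' ∈ n'.upper, b₁ ≤ a₀ ∧ a₀ < b' := by
    intro b' hb'
    have hlt : b₁ < b' := hb₁q.trans (n'.lt _ hq' _ hb')
    have h3 := hcon' a₀ ha₀ b' hb'
    rcases eq_or_ne a₀ b₁ with rfl | h4
    · exact ⟨le_rfl, hlt⟩
    · by_contra h5
      exact h1 ((up_iff_up _ _ a₀ hlt h4 (up_ne h3) fun h6 => h5 ⟨h6.1.le, h6.2⟩).2 h3)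
  obtain ⟨b₀, hb₀⟩ := n'.upper_nonempty
  have hba : b₁ ≤ a₀ := (h2 b₀ hb₀).1
  have h3 : ∀ a ∈ m.lower, ∀ b' ∈ n'.upper, a < b' := by
    intro a ha b' hb'
    obtain ⟨c, hc, hac, hac'⟩ := m.directed a ha a₀ ha₀
    refine hac.trans (lt_of_le_of_ne ?_ (up_ne (hcon' c hc b' hb')))
    by_contra h5
    have hlt : b₁ < b' := hb₁q.trans (n'.lt _ hq' _ hb')
    have h6 := (up_iff_up _ _ c hlt (hba.trans_lt hac').ne' (fun h => h5 h.le)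
      (fun h => h5 h.2.le)).2 (hcon' c hc b' hb')
    exact not_up_of_lt _ _ (hba.trans_lt hac') h6
  have h4 : n'.upper ⊆ m.upper := by
    intro b' hb'
    by_contra h5
    have h6 : ∀ b ∈ m.upper, b' < b := by
      intro b hb
      by_contra h7
      exact ho ⟨b', fun a ha => h3 a ha b' hb', h5, b, hb, h7⟩
    obtain ⟨b'', hb'', hlt⟩ := exists_lt_upper hb'
    obtain ⟨b, hb⟩ := m.upper_nonempty
    rcases m.located _ ha₀ _ hb b'' b' (h2 _ hb'').2.le hlt (h6 b hb).le with h7 | h7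
    · exact lt_irrefl _ (h3 _ h7 _ hb'')
    · exact h5 h7
  have h5 : m.lower ⊆ n'.lower := by
    intro a ha
    obtain ⟨c, hc, hac, hac'⟩ := m.directed a ha a₀ ha₀
    have hqb := n'.lt _ hq' _ hb₀
    rcases le_or_le_of_mem_Icc (a := b₁) (b := b₀) (x := c) (y := q)
      ⟨(hba.trans_lt hac').le, (h3 _ hc _ hb₀).le⟩ ⟨hb₁q.le, hqb.le⟩ with h6 | h6
    · exact n'.lower_down _ _ hac (lower_of_le h6 hq')
    · obtain ⟨d, hd, hcd⟩ := exists_gt_lower hc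
      rcases n'.located _ hq' _ hb₀ c d h6 hcd (h3 _ hd _ hb₀).le with h7 | h7
      · exact n'.lower_down _ _ hac h7
      · exact absurd (h3 _ hd _ h7) (lt_irrefl _)
  exact hb ⟨lt_iff.2 ⟨a₀, upper_of_le hba hb₁, ha₀⟩, lt_of_le_of_ne ⟨h5, h4⟩ hne⟩

/-- The upper side of `m` does not change along `n < n'` unless `m` lies between. -/
theorem aboveUpper_of_aboveUpper {m n n' : DCut Q} (ho : ¬ m.InBranch) (hn : n < n')
    (hne : m ≠ n) (hb : ¬ (n < m ∧ m < n')) (h : AboveUpper m n') : AboveUpper m n := by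
  by_contra hcon
  have hcon' : ∀ b ∈ m.upper, ∀ a ∈ n.lower, a ≠ b ∧ ¬ up b a := fun b hb a ha =>
    not_or.1 fun h' => hcon ⟨b, hb, a, ha, h'⟩
  obtain ⟨b₀, hb₀, a, han, h⟩ := h
  obtain ⟨q, hq, hq'⟩ := lt_iff.1 hn
  obtain ⟨a₁, ha₁, ha₁a, ha₁q⟩ := n'.directed a han q hq'
  have h1 : up b₀ a₁ := by
    rcases h with rfl | h
    · exact up_of_lt _ _ ha₁a
    · exact up_trans_le h ha₁a.le
  have h2 : ∀ a' ∈ n.lower, a' < b₀ ∧ b₀ < a₁ := by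
    intro a' ha'
    have hlt : a' < a₁ := (n.lt _ ha' _ hq).trans ha₁q
    have h3 := hcon' b₀ hb₀ a' ha'
    by_contra h5
    exact h3.2 ((up_iff_up _ _ b₀ hlt h3.1.symm (up_ne h1) h5).2 h1)
  obtain ⟨a₀, ha₀⟩ := n.lower_nonempty
  have hba : b₀ < a₁ := (h2 a₀ ha₀).2
  have h3 : ∀ b ∈ m.upper, ∀ a' ∈ n.lower, a' < b := by
    intro b hb a' ha'
    obtain ⟨c, hc, hcb, hcb'⟩ := m.codirected b hb b₀ hb₀
    refine lt_of_lt_of_le ?_ hcb.le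
    by_contra h5
    have hlt : a' < a₁ := (n.lt _ ha' _ hq).trans ha₁q
    have h6 := hcon' c hc a' ha'
    exact h6.2 ((up_iff_up _ _ c hlt h6.1.symm (hcb'.trans hba).ne (fun h => h5 h.1)).2
      (up_of_lt _ _ (hcb'.trans hba)))
  have h4 : n.lower ⊆ m.lower := by
    intro a' ha'
    by_contra h5
    have h6 : ∀ a ∈ m.lower, a < a' := by
      intro a ha
      by_contra h7
      exact ho ⟨a', fun b hb => h3 b hb a' ha', h5, a, ha, h7⟩
    obtain ⟨a'', ha'', hlt⟩ := exists_gt_lower ha'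
    obtain ⟨a, ha⟩ := m.lower_nonempty
    rcases m.located _ ha _ hb₀ a' a'' (h6 a ha).le hlt (h2 _ ha'').1.le with h7 | h7
    · exact h5 h7
    · exact lt_irrefl _ (h3 _ h7 _ ha'')
  have h5 : m.upper ⊆ n.upper := by
    intro b hb
    obtain ⟨c, hc, hcb, hcb'⟩ := m.codirected b hb b₀ hb₀
    rcases le_or_le_of_mem_Icc (a := a₀) (b := a₁) (x := q) (y := c)
      ⟨(n.lt _ ha₀ _ hq).le, ha₁q.le⟩ ⟨(h3 _ hc _ ha₀).le, (hcb'.trans hba).le⟩ with h6 | h6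
    · exact n.upper_up _ _ hcb (upper_of_le h6 hq)
    · obtain ⟨d, hd, hdc⟩ := exists_lt_upper hc
      rcases n.located _ ha₀ _ hq d c (h3 _ hd _ ha₀).le hdc h6 with h7 | h7
      · exact absurd (h3 _ hd _ h7) (lt_irrefl _)
      · exact n.upper_up _ _ hcb h7
  exact hb ⟨lt_of_le_of_ne ⟨h4, h5⟩ hne.symm, lt_iff.2 ⟨b₀, hb₀, n'.lower_down _ _ hba ha₁⟩⟩

/-- A point of the base, as a cut. -/
def of (q : Q) : DCut Q where
  lower := Iio q
  upper := Ioi q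
  lower_nonempty := CutBase.exists_lt q
  upper_nonempty := CutBase.exists_gt q
  lower_down _ _ h h' := h.trans h'
  upper_up _ _ h h' := h'.trans h
  directed a ha b hb := CutBase.directed_lt a b q ha hb
  codirected a ha b hb := CutBase.directed_gt a b q ha hb
  lt _ ha _ hb := lt_trans ha hb
  located a ha b hb c c' hac hcc' hcb := by
    rcases le_or_le_of_mem_Icc (a := a) (b := b) (x := c) (y := q) ⟨hac, hcc'.le.trans hcb⟩
      ⟨le_of_lt ha, le_of_lt hb⟩ with h | h
    · rcases h.lt_or_eq with h | h
      · exact Or.inl h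
      · exact Or.inr (h ▸ hcc')
    · exact Or.inr (h.trans_lt hcc')

theorem of_lt_iff {q : Q} {m : DCut Q} : of q < m ↔ q ∈ m.lower := by
  rw [lt_iff]
  constructor
  · rintro ⟨r, hr, hr'⟩
    exact m.lower_down _ _ hr hr'
  · intro h
    obtain ⟨r, hr, hr'⟩ := exists_gt_lower h
    exact ⟨r, hr', hr⟩

theorem lt_of_iff {q : Q} {m : DCut Q} : m < of q ↔ q ∈ m.upper := by
  rw [lt_iff]
  constructor
  · rintro ⟨r, hr, hr'⟩
    exact m.upper_up _ _ hr' hr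
  · intro h
    obtain ⟨r, hr, hr'⟩ := exists_lt_upper h
    exact ⟨r, hr, hr'⟩

theorem of_lt_of {p q : Q} : of p < of q ↔ p < q := of_lt_iff

theorem of_injective : Function.Injective (of : Q → DCut Q) := by
  intro p q h
  by_contra hne
  have h1 : ∀ a, a < p ↔ a < q := fun a => by rw [← of_lt_of, h, of_lt_of]
  have h2 : ∀ a, p < a ↔ q < a := fun a => by rw [← of_lt_of, h, of_lt_of]
  obtain ⟨a, ha⟩ := CutBase.exists_lt p
  obtain ⟨b, hb⟩ := CutBase.exists_gt p
  rcases le_or_le_of_mem_Icc (a := a) (b := b) (x := p) (y := q) ⟨ha.le, hb.le⟩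
    ⟨((h1 a).1 ha).le, ((h2 b).1 hb).le⟩ with h3 | h3
  · exact lt_irrefl _ ((h1 p).2 (lt_of_le_of_ne h3 hne))
  · exact lt_irrefl _ ((h1 q).1 (lt_of_le_of_ne h3 (Ne.symm hne)))

theorem of_le_of {p q : Q} (h : p ≤ q) : of p ≤ of q := by
  rcases h.lt_or_eq with h | rfl
  · exact (of_lt_of.2 h).le
  · exact le_rfl

instance : SidePoset (DCut Q) where
  up := Up
  up_irrefl := Up.irrefl
  up_of_lt _ _ := Up.of_lt
  not_up_of_lt _ _ := Up.not_of_lt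
  up_iff_up n n' m hn hne hne' hb := by
    by_cases ho : m.OutBranch
    · have hi := CutBase.unbranched m ho
      have h1 : AboveUpper m n ↔ AboveUpper m n' := by
        refine ⟨fun h => ?_, aboveUpper_of_aboveUpper hi hn hne hb⟩
        obtain ⟨b, hb, a, ha, h⟩ := h
        exact ⟨b, hb, a, hn.le.1 ha, h⟩
      simp only [Up, ho, h1, not_true, false_and]
    · have h1 : BelowLower m n ↔ BelowLower m n' := by
        refine ⟨belowLower_of_belowLower ho hn hne' hb, fun h => ?_⟩
        obtain ⟨a, ha, b, hb, h⟩ := h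
        exact ⟨a, ha, b, hn.le.2 hb, h⟩
      simp only [Up, ho, h1, hne.symm, hne'.symm, false_and, not_false_eq_true, ne_eq]
  conn m n := by
    obtain ⟨p, hp⟩ := m.lower_nonempty
    obtain ⟨q, hq⟩ := n.lower_nonempty
    refine .head (Or.inr (of_lt_iff.2 hp).le) (.tail ?_ (Or.inl (of_lt_iff.2 hq).le))
    exact Relation.ReflTransGen.lift of
      (fun a b (h : a ≤ b ∨ b ≤ a) => h.imp of_le_of of_le_of) _ _ (conn p q)

theorem up_of_iff {p q : Q} : up (of p) (of q) ↔ up p q := by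
  have hU : AboveUpper (of p) (of q) ↔ up p q := by
    constructor
    · rintro ⟨b, hb, a, ha, rfl | h⟩
      · exact up_of_lt _ _ (lt_trans hb ha)
      · exact up_trans_le (up_of_up hb h) (le_of_lt ha)
    · exact CutBase.up_thick p q
  have hD : of q ≠ of p ∧ ¬ BelowLower (of p) (of q) ↔ up p q := by
    constructor
    · rintro ⟨hne, h⟩
      by_contra h'
      exact h (CutBase.down_thick p q (fun h => hne (h ▸ rfl)) h')
    · intro h
      refine ⟨fun h' => up_ne h (of_injective h').symm, ?_⟩
      rintro ⟨a, ha, b, hb, h'⟩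
      exact h' (up_trans_le (up_of_up ha h) (le_of_lt hb))
  change Up _ _ ↔ _
  by_cases ho : (of p).OutBranch
  · simp only [Up, ho, hU, true_and, not_true, false_and, or_false]
  · simp only [Up, ho, hD, not_false_eq_true, true_and, false_and, false_or]

end Sides

end DCut
/-- A partially ordered space with sides that is locally a line: it is directed at every point in
both directions, has a countable order dense subset, every comparable pair lies in an open interval
isomorphic to `ℝ`, and the open intervals generate the topology. -/
class TreeLine (M : Type u) extends SidePoset M, TopologicalSpace M where
  directed_lt : ∀ a b m : M, a < m → b < m → ∃ c < m, a < c ∧ b < c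
  directed_gt : ∀ a b m : M, m < a → m < b → ∃ c > m, c < a ∧ c < b
  chart : ∀ x y : M, x ≤ y → ∃ (φ : ℝ ↪o M) (a b : M), range φ = Ioo a b ∧ x ∈ Ioo a b ∧ y ∈ Ioo a b
  countable_dense : ∃ D : Set M, D.Countable ∧ ∀ a b, a < b → ∃ d ∈ D, a < d ∧ d < b
  isOpen_iff : ∀ U : Set M, IsOpen U ↔ ∀ m ∈ U, ∃ a b, a < m ∧ m < b ∧ Ioo a b ⊆ U

/-! ### The cuts form a line -/

namespace DCut

open SidePoset

variable {Q : Type u} [CutBase Q]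

/-- Intervals of the base are countable, dense and without end points, so that Cantor's theorem
applies. -/
theorem exists_orderIso_rat {p p' : Q} (h : p < p') : Nonempty (Ioo p p' ≃o ℚ) := by
  classical
  have : Countable Q := CutBase.countable
  have hd : ∀ a b : Q, a < b → ∃ c, a < c ∧ c < b := fun a b hab => by
    obtain ⟨c, hc, h1, _⟩ := CutBase.directed_lt a a b hab hab
    exact ⟨c, h1, hc⟩
  let : LinearOrder (Ioo p p') :=
    { (inferInstance : PartialOrder (Ioo p p')) with
      le_total := fun a b => le_or_le_of_mem_Icc (Ioo_subset_Icc_self a.2)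
        (Ioo_subset_Icc_self b.2)
      toDecidableLE := Classical.decRel _ }
  have : DenselyOrdered (Ioo p p') := ⟨fun a b hab => by
    obtain ⟨c, h1, h2⟩ := hd a b hab
    exact ⟨⟨c, a.2.1.trans h1, h2.trans b.2.2⟩, h1, h2⟩⟩
  have : NoMinOrder (Ioo p p') := ⟨fun a => by
    obtain ⟨c, h1, h2⟩ := hd p a a.2.1
    exact ⟨⟨c, h1, h2.trans a.2.2⟩, h2⟩⟩
  have : NoMaxOrder (Ioo p p') := ⟨fun a => by
    obtain ⟨c, h1, h2⟩ := hd a p' a.2.2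
    exact ⟨⟨c, a.2.1.trans h1, h2⟩, h1⟩⟩
  have : Nonempty (Ioo p p') := by
    obtain ⟨c, h1, h2⟩ := hd p p' h
    exact ⟨⟨c, h1, h2⟩⟩
  exact Order.iso_of_countable_dense _ _

/-- The cut at a real number in an interval of the base that is identified with `ℚ`. -/
def ofReal {p p' : Q} (e : Ioo p p' ≃o ℚ) (r : ℝ) : DCut Q where
  lower := {q | ∃ s : Ioo p p', q ≤ s ∧ (e s : ℝ) < r}
  upper := {q | ∃ s : Ioo p p', s ≤ q ∧ r < (e s : ℝ)}
  lower_nonempty := by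
    obtain ⟨t, ht⟩ := exists_rat_lt r
    exact ⟨e.symm t, e.symm t, le_rfl, by simpa using ht⟩
  upper_nonempty := by
    obtain ⟨t, ht⟩ := exists_rat_gt r
    exact ⟨e.symm t, e.symm t, le_rfl, by simpa using ht⟩
  lower_down := by
    rintro a b hab ⟨s, h1, h2⟩
    exact ⟨s, hab.le.trans h1, h2⟩
  upper_up := by
    rintro a b hab ⟨s, h1, h2⟩
    exact ⟨s, h1.trans hab.le, h2⟩
  directed := by
    rintro a ⟨s, h1, h2⟩ b ⟨t, h3, h4⟩
    obtain ⟨v, hv, hv'⟩ := exists_rat_btwn (max_lt h2 h4)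
    have hs : s < e.symm v := by
      rw [← e.lt_iff_lt, e.apply_symm_apply]
      exact_mod_cast (le_max_left _ _).trans_lt hv
    have ht : t < e.symm v := by
      rw [← e.lt_iff_lt, e.apply_symm_apply]
      exact_mod_cast (le_max_right _ _).trans_lt hv
    exact ⟨e.symm v, ⟨e.symm v, le_rfl, by simpa using hv'⟩, lt_of_le_of_lt h1 hs,
      lt_of_le_of_lt h3 ht⟩
  codirected := by
    rintro a ⟨s, h1, h2⟩ b ⟨t, h3, h4⟩
    obtain ⟨v, hv, hv'⟩ := exists_rat_btwn (lt_min h2 h4)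
    have hs : e.symm v < s := by
      rw [← e.lt_iff_lt, e.apply_symm_apply]
      exact_mod_cast hv'.trans_le (min_le_left _ _)
    have ht : e.symm v < t := by
      rw [← e.lt_iff_lt, e.apply_symm_apply]
      exact_mod_cast hv'.trans_le (min_le_right _ _)
    exact ⟨e.symm v, ⟨e.symm v, le_rfl, by simpa using hv⟩, lt_of_lt_of_le hs h1,
      lt_of_lt_of_le ht h3⟩
  lt := by
    rintro a ⟨s, h1, h2⟩ b ⟨t, h3, h4⟩
    have hst : s < t := by
      rw [← e.lt_iff_lt]
      exact_mod_cast h2.trans h4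
    exact h1.trans_lt (lt_of_lt_of_le hst h3)
  located := by
    rintro a ⟨s, h1, h2⟩ b ⟨t, h3, h4⟩ c c' hac hcc' hcb
    have hst : s < t := by
      rw [← e.lt_iff_lt]
      exact_mod_cast h2.trans h4
    have hst' : (s : Q) < t := hst
    have hs : (s : Q) ∈ Icc a b := ⟨h1, hst'.le.trans h3⟩
    have ht : (t : Q) ∈ Icc a b := ⟨h1.trans hst'.le, h3⟩
    rcases le_or_le_of_mem_Icc ⟨hac, hcc'.le.trans hcb⟩ hs with h5 | h5
    · exact Or.inl ⟨s, h5, h2⟩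
    rcases le_or_le_of_mem_Icc ⟨hac.trans hcc'.le, hcb⟩ ht with h6 | h6
    · have hc : p < c := s.2.1.trans_le h5
      have hc' : c' < p' := h6.trans_lt t.2.2
      rcases lt_or_ge (e ⟨c, hc, hcc'.trans hc'⟩ : ℝ) r with h7 | h7
      · exact Or.inl ⟨⟨c, hc, hcc'.trans hc'⟩, le_rfl, h7⟩
      · refine Or.inr ⟨⟨c', hc.trans hcc', hc'⟩, le_rfl, h7.trans_lt ?_⟩
        exact_mod_cast e.lt_iff_lt.2 (show (⟨c, hc, hcc'.trans hc'⟩ : Ioo p p') <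
          (⟨c', hc.trans hcc', hc'⟩ : Ioo p p') from hcc')
    · exact Or.inr ⟨t, h6, h4⟩

theorem ofReal_strictMono {p p' : Q} (e : Ioo p p' ≃o ℚ) : StrictMono (ofReal e) := by
  intro r r' h
  obtain ⟨v, hv, hv'⟩ := exists_rat_btwn h
  exact lt_iff.2 ⟨e.symm v, ⟨e.symm v, le_rfl, by simpa using hv⟩,
    ⟨e.symm v, le_rfl, by simpa using hv'⟩⟩

/-- Every cut between `p` and `p'` is given by the supremum of the numbers in its lower part. -/
theorem range_ofReal {p p' : Q} (e : Ioo p p' ≃o ℚ) : range (ofReal e) = Ioo (of p) (of p') := by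
  apply Subset.antisymm
  · rintro _ ⟨r, rfl⟩
    obtain ⟨t, ht⟩ := exists_rat_lt r
    obtain ⟨t', ht'⟩ := exists_rat_gt r
    exact ⟨of_lt_iff.2 ⟨e.symm t, (e.symm t).2.1.le, by simpa using ht⟩,
      lt_of_iff.2 ⟨e.symm t', (e.symm t').2.2.le, by simpa using ht'⟩⟩
  · rintro m ⟨hm, hm'⟩
    rw [of_lt_iff] at hm
    rw [lt_of_iff] at hm'
    let A : Set ℝ := {x | ∃ s : Ioo p p', (s : Q) ∈ m.lower ∧ x = e s}
    have hA : A.Nonempty := by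
      obtain ⟨q, hq, hpq⟩ := exists_gt_lower hm
      exact ⟨_, ⟨q, hpq, m.lt _ hq _ hm'⟩, hq, rfl⟩
    have hub : ∀ t : Ioo p p', (t : Q) ∈ m.upper → (e t : ℝ) ∈ upperBounds A := by
      rintro t ht _ ⟨s, hs, rfl⟩
      exact_mod_cast (e.lt_iff_lt.2 (show s < t from m.lt _ hs _ ht)).le
    have hbdd : BddAbove A := by
      obtain ⟨q, hq, hpq⟩ := exists_lt_upper hm'
      exact ⟨_, hub ⟨q, m.lt _ hm _ hq, hpq⟩ hq⟩
    refine ⟨sSup A, eq_of_subset ?_ ?_⟩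
    · rintro q ⟨s, hqs, hs⟩
      obtain ⟨_, ⟨t, ht, rfl⟩, hst⟩ := exists_lt_of_lt_csSup hA hs
      have : s < t := by
        rw [← e.lt_iff_lt]
        exact_mod_cast hst
      exact lower_of_le (hqs.trans this.le) ht
    · rintro q ⟨s, hqs, hs⟩
      obtain ⟨v, hv, hv'⟩ := exists_rat_btwn hs
      have h1 : e.symm v < s := by
        rw [← e.lt_iff_lt, e.apply_symm_apply]
        exact_mod_cast hv'
      rcases m.located _ hm _ hm' (e.symm v) s (e.symm v).2.1.le h1 s.2.2.le with h2 | h2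
      · exact absurd (le_csSup hbdd ⟨e.symm v, h2, by simp⟩) (not_le.2 hv)
      · exact upper_of_le hqs h2

theorem exists_lt_lt {m a b : DCut Q} (ha : a < m) (hb : b < m) : ∃ c < m, a < c ∧ b < c := by
  obtain ⟨q, hq, hq'⟩ := lt_iff.1 ha
  obtain ⟨r, hr, hr'⟩ := lt_iff.1 hb
  obtain ⟨s, hs, h1, h2⟩ := m.directed _ hq' _ hr'
  exact ⟨of s, of_lt_iff.2 hs, lt_iff.2 ⟨q, hq, h1⟩, lt_iff.2 ⟨r, hr, h2⟩⟩

theorem exists_gt_gt {m a b : DCut Q} (ha : m < a) (hb : m < b) : ∃ c > m, c < a ∧ c < b := by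
  obtain ⟨q, hq', hq⟩ := lt_iff.1 ha
  obtain ⟨r, hr', hr⟩ := lt_iff.1 hb
  obtain ⟨s, hs, h1, h2⟩ := m.codirected _ hq' _ hr'
  exact ⟨of s, lt_of_iff.2 hs, lt_iff.2 ⟨q, h1, hq⟩, lt_iff.2 ⟨r, h2, hr⟩⟩

/-- The open intervals generate a topology because every point is directed from both sides. -/
instance : TopologicalSpace (DCut Q) where
  IsOpen U := ∀ m ∈ U, ∃ a b, a < m ∧ m < b ∧ Ioo a b ⊆ U
  isOpen_univ m _ := by
    obtain ⟨p, hp⟩ := m.lower_nonempty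
    obtain ⟨q, hq⟩ := m.upper_nonempty
    exact ⟨of p, of q, of_lt_iff.2 hp, lt_of_iff.2 hq, subset_univ _⟩
  isOpen_inter U V hU hV m hm := by
    obtain ⟨a, b, h1, h2, h3⟩ := hU m hm.1
    obtain ⟨a', b', h1', h2', h3'⟩ := hV m hm.2
    obtain ⟨c, hc, hac, hac'⟩ := exists_lt_lt h1 h1'
    obtain ⟨d, hd, hdb, hdb'⟩ := exists_gt_gt h2 h2'
    exact ⟨c, d, hc, hd, fun x hx => ⟨h3 ⟨hac.trans hx.1, hx.2.trans hdb⟩,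
      h3' ⟨hac'.trans hx.1, hx.2.trans hdb'⟩⟩⟩
  isOpen_sUnion S hS m := by
    rintro ⟨U, hU, hm⟩
    obtain ⟨a, b, h1, h2, h3⟩ := hS U hU m hm
    exact ⟨a, b, h1, h2, h3.trans (subset_sUnion_of_mem hU)⟩

instance : TreeLine (DCut Q) where
  directed_lt _ _ _ := exists_lt_lt
  directed_gt _ _ _ := exists_gt_gt
  chart x y hxy := by
    obtain ⟨p, hp⟩ := x.lower_nonempty
    obtain ⟨q, hq⟩ := y.upper_nonempty
    obtain ⟨e⟩ := exists_orderIso_rat (y.lt _ (hxy.1 hp) _ hq)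
    refine ⟨OrderEmbedding.ofStrictMono (ofReal e) (ofReal_strictMono e), of p, of q,
      range_ofReal e, ⟨of_lt_iff.2 hp, lt_of_iff.2 (hxy.2 hq)⟩,
      ⟨of_lt_iff.2 (hxy.1 hp), lt_of_iff.2 hq⟩⟩
  countable_dense := by
    have : Countable Q := CutBase.countable
    refine ⟨range of, countable_range _, fun a b h => ?_⟩
    obtain ⟨q, hq, hq'⟩ := lt_iff.1 h
    exact ⟨of q, mem_range_self q, lt_of_iff.2 hq, of_lt_iff.2 hq'⟩
  isOpen_iff _ := Iff.rfl

end DCut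

/-! ### Actions -/

/-- A group action by order automorphisms. -/
class MonoAction (G Q : Type u) [Group G] [PartialOrder Q] extends MulAction G Q where
  smul_mono : ∀ (g : G) (a b : Q), a ≤ b → g • a ≤ g • b

namespace MonoAction

variable {G Q : Type u} [Group G] [PartialOrder Q] [MonoAction G Q]

theorem smul_le_smul_iff (g : G) {a b : Q} : g • a ≤ g • b ↔ a ≤ b := by
  refine ⟨fun h => ?_, smul_mono g a b⟩
  have := smul_mono g⁻¹ _ _ h
  rwa [inv_smul_smul, inv_smul_smul] at this

theorem smul_lt_smul_iff (g : G) {a b : Q} : g • a < g • b ↔ a < b := by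
  rw [lt_iff_le_not_ge, lt_iff_le_not_ge, smul_le_smul_iff, smul_le_smul_iff]

theorem inv_smul_lt_iff (g : G) {a b : Q} : g⁻¹ • a < b ↔ a < g • b := by
  rw [← smul_lt_smul_iff g (a := g⁻¹ • a), smul_inv_smul]

instance {P : Type u} [TurnTree P] [TurnAction G P] : MonoAction G (Fill P) where
  smul_mono g _ _ := Fill.smul_le_smul g

instance : MonoAction G (Q ×ₗ ℚ) where
  smul g q := toLex (g • (ofLex q).1, (ofLex q).2)
  one_smul q := by
    change toLex ((1 : G) • (ofLex q).1, (ofLex q).2) = q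
    rw [one_smul]
    rfl
  mul_smul g h q := by
    change toLex ((g * h) • (ofLex q).1, (ofLex q).2) = toLex (g • h • (ofLex q).1, (ofLex q).2)
    rw [mul_smul]
  smul_mono g a b h := by
    refine Prod.Lex.le_iff.2 ((Prod.Lex.le_iff.1 h).imp (smul_lt_smul_iff g).2 ?_)
    exact fun h => ⟨congrArg (g • ·) h.1, h.2⟩

theorem smul_toLex (g : G) (q : Q) (r : ℚ) :
    g • (toLex (q, r) : Q ×ₗ ℚ) = toLex (g • q, r) := rfl

/-- The translate of a cut. -/
def smulCut (g : G) (m : DCut Q) : DCut Q where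
  lower := {q | g⁻¹ • q ∈ m.lower}
  upper := {q | g⁻¹ • q ∈ m.upper}
  lower_nonempty := m.lower_nonempty.imp' (g • ·) fun q hq => by
    rwa [mem_ofPred_eq, inv_smul_smul]
  upper_nonempty := m.upper_nonempty.imp' (g • ·) fun q hq => by
    rwa [mem_ofPred_eq, inv_smul_smul]
  lower_down a b h := m.lower_down _ _ ((smul_lt_smul_iff g⁻¹).2 h)
  upper_up a b h := m.upper_up _ _ ((smul_lt_smul_iff g⁻¹).2 h)
  directed a ha b hb := by
    obtain ⟨c, hc, h1, h2⟩ := m.directed _ ha _ hb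
    exact ⟨g • c, by rwa [mem_ofPred_eq, inv_smul_smul], (inv_smul_lt_iff g).1 h1,
      (inv_smul_lt_iff g).1 h2⟩
  codirected a ha b hb := by
    obtain ⟨c, hc, h1, h2⟩ := m.codirected _ ha _ hb
    refine ⟨g • c, by rwa [mem_ofPred_eq, inv_smul_smul], ?_, ?_⟩
    · rwa [← smul_lt_smul_iff g⁻¹, inv_smul_smul]
    · rwa [← smul_lt_smul_iff g⁻¹, inv_smul_smul]
  lt a ha b hb := (smul_lt_smul_iff g⁻¹).1 (m.lt _ ha _ hb)
  located a ha b hb c c' h1 h2 h3 := m.located _ ha _ hb _ _ (smul_mono _ _ _ h1)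
    ((smul_lt_smul_iff g⁻¹).2 h2) (smul_mono _ _ _ h3)

instance : MonoAction G (DCut Q) where
  smul := smulCut
  one_smul m := by
    ext q
    · change (1 : G)⁻¹ • q ∈ m.lower ↔ _
      rw [inv_one, one_smul]
    · change (1 : G)⁻¹ • q ∈ m.upper ↔ _
      rw [inv_one, one_smul]
  mul_smul g h m := by
    ext q
    · change (g * h)⁻¹ • q ∈ m.lower ↔ h⁻¹ • g⁻¹ • q ∈ m.lower
      rw [mul_inv_rev, mul_smul]
    · change (g * h)⁻¹ • q ∈ m.upper ↔ h⁻¹ • g⁻¹ • q ∈ m.upper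
      rw [mul_inv_rev, mul_smul]
  smul_mono g a b h := ⟨fun _ hq => h.1 hq, fun _ hq => h.2 hq⟩

end MonoAction

theorem DCut.smul_of {G Q : Type u} [Group G] [CutBase Q] [MonoAction G Q] (g : G) (q : Q) :
    g • DCut.of q = DCut.of (g • q) := by
  ext r
  · exact MonoAction.inv_smul_lt_iff g
  · change q < g⁻¹ • r ↔ g • q < r
    rw [← MonoAction.smul_lt_smul_iff g, smul_inv_smul]

/-! ### The order topology of a segment -/

namespace Seg

variable {T : Type u}

@[ext] theorem ext_of_le {σ τ : Seg T} (hc : ∀ x, x ∈ σ.carrier ↔ x ∈ τ.carrier)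
    (hle : ∀ x y, σ.le x y ↔ τ.le x y) (hi : σ.ini = τ.ini) (hf : σ.fin = τ.fin) : σ = τ := by
  cases σ
  cases τ
  have h1 := Set.ext hc
  have h2 := funext fun x => funext fun y => propext (hle x y)
  dsimp only at h1 h2 hi hf
  subst h1 h2 hi hf
  rfl

/-- The linear order of a segment. -/
@[reducible] noncomputable def linearOrder (σ : Seg T) : LinearOrder σ.carrier where
  toPreorder := σ.preorder
  le_antisymm x y h h' := Subtype.ext (σ.le_antisymm _ _ h h')
  le_total x y := σ.le_total _ x.2 _ y.2
  toDecidableLE := Classical.decRel _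

/-- Openness in a segment in terms of one-sided intervals around each point; at an end point the
condition on the missing side is dropped. -/
theorem isRelOpen_iff (σ : Seg T) (U : Set T) : σ.IsRelOpen U ↔
    ∀ x ∈ σ.carrier, x ∈ U →
      (x = σ.ini ∨ ∃ l, σ.le l x ∧ l ≠ x ∧ ∀ y, σ.le l y → l ≠ y → σ.le y x → y ∈ U) ∧
      (x = σ.fin ∨ ∃ u, σ.le x u ∧ u ≠ x ∧ ∀ y, σ.le x y → σ.le y u → u ≠ y → y ∈ U) := by
  let _ : LinearOrder σ.carrier := σ.linearOrder
  let _ : TopologicalSpace σ.carrier := Preorder.topology σ.carrier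
  have : OrderTopology σ.carrier := ⟨rfl⟩
  have hle : ∀ x y : σ.carrier, x ≤ y ↔ σ.le x y := fun _ _ => Iff.rfl
  have hlt : ∀ x y : σ.carrier, x < y ↔ σ.le x y ∧ (x : T) ≠ y := fun x y => by
    rw [lt_iff_le_and_ne, ne_eq, Subtype.ext_iff]
    exact Iff.rfl
  change IsOpen (Subtype.val ⁻¹' U : Set σ.carrier) ↔ _
  rw [isOpen_iff_mem_nhds]
  constructor
  · intro h x hx hxU
    have h1 := h ⟨x, hx⟩ hxU
    constructor
    · rcases eq_or_ne x σ.ini with h2 | h2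
      · exact Or.inl h2
      · obtain ⟨l, hl, hlU⟩ := exists_Ioc_subset_of_mem_nhds h1
          ⟨⟨σ.ini, σ.ini_mem⟩, (hlt _ _).2 ⟨σ.ini_le x hx, h2.symm⟩⟩
        rw [hlt] at hl
        refine Or.inr ⟨l, hl.1, hl.2, fun y hly hne hyx => ?_⟩
        exact hlU (a := ⟨y, (σ.mem_of_le _ _ hyx).1⟩) ⟨(hlt _ _).2 ⟨hly, hne⟩, hyx⟩
    · rcases eq_or_ne x σ.fin with h2 | h2
      · exact Or.inl h2
      · obtain ⟨u, hu, huU⟩ := exists_Ico_subset_of_mem_nhds h1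
          ⟨⟨σ.fin, σ.fin_mem⟩, (hlt _ _).2 ⟨σ.le_fin x hx, h2⟩⟩
        rw [hlt] at hu
        refine Or.inr ⟨u, hu.1, hu.2.symm, fun y hxy hyu hne => ?_⟩
        exact huU (a := ⟨y, (σ.mem_of_le _ _ hyu).1⟩) ⟨hxy, (hlt _ _).2 ⟨hyu, hne.symm⟩⟩
  · intro h x hxU
    obtain ⟨h1, h2⟩ := h x x.2 hxU
    have h3 : ∀ᶠ y in 𝓝 x, y ≤ x → (y : T) ∈ U := by
      rcases h1 with h1 | ⟨l, hl, hne, hU⟩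
      · refine Filter.Eventually.of_forall fun y hy => ?_
        have : (y : T) = x := σ.le_antisymm _ _ hy (h1 ▸ σ.ini_le y y.2)
        rwa [this]
      · have hl' : (⟨l, (σ.mem_of_le _ _ hl).1⟩ : σ.carrier) < x := (hlt _ _).2 ⟨hl, hne⟩
        filter_upwards [Ioi_mem_nhds hl'] with y hy hyx
        have hy' := (hlt _ _).1 hy
        exact hU y hy'.1 hy'.2 hyx
    have h4 : ∀ᶠ y in 𝓝 x, x ≤ y → (y : T) ∈ U := by
      rcases h2 with h2 | ⟨u, hu, hne, hU⟩
      · refine Filter.Eventually.of_forall fun y hy => ?_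
        have : (y : T) = x := (σ.le_antisymm _ _ hy (h2 ▸ σ.le_fin y y.2)).symm
        rwa [this]
      · have hu' : x < (⟨u, (σ.mem_of_le _ _ hu).2⟩ : σ.carrier) := (hlt _ _).2 ⟨hu, hne.symm⟩
        filter_upwards [Iio_mem_nhds hu'] with y hy hyx
        have hy' := (hlt _ _).1 hy
        exact hU y hyx hy'.1 hy'.2.symm
    filter_upwards [h3, h4] with y h5 h6
    exact (_root_.le_total y x).elim h5 h6

theorem isRelOpen_neg (σ : Seg T) (U : Set T) : σ.neg.IsRelOpen U ↔ σ.IsRelOpen U := by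
  rw [isRelOpen_iff, isRelOpen_iff]
  refine forall_congr' fun x => forall_congr' fun _ => forall_congr' fun _ => ?_
  rw [and_comm]
  refine and_congr (or_congr Iff.rfl ?_) (or_congr Iff.rfl ?_)
  · exact exists_congr fun l => and_congr Iff.rfl (and_congr Iff.rfl
      ⟨fun h y h1 h2 h3 => h y h3 h1 h2, fun h y h1 h2 h3 => h y h2 h3 h1⟩)
  · exact exists_congr fun l => and_congr Iff.rfl (and_congr Iff.rfl
      ⟨fun h y h1 h2 h3 => h y h2 h3 h1, fun h y h1 h2 h3 => h y h3 h1 h2⟩)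

theorem isParam_neg {σ : Seg T} {f : Icc (0 : ℝ) 1 → T} (h : σ.IsParam f) :
    σ.neg.IsParam (f ∘ unitInterval.symm) := by
  refine ⟨?_, fun s t => ?_⟩
  · rw [unitInterval.symm_bijective.surjective.range_comp]
    exact h.1
  · rw [← unitInterval.symm_le_symm, h.2]
    rfl

end Seg

/-! ### Segments in a line with sides -/

namespace TreeLine

open SidePoset

variable {M : Type u} [TreeLine M]

theorem exists_lt (m : M) : ∃ a, a < m := by
  obtain ⟨φ, a, b, -, h, -⟩ := chart m m le_rfl
  exact ⟨a, h.1⟩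

theorem exists_gt (m : M) : ∃ a, m < a := by
  obtain ⟨φ, a, b, -, h, -⟩ := chart m m le_rfl
  exact ⟨b, h.2⟩

theorem isOpen_Ioo (a b : M) : IsOpen (Ioo a b) :=
  (isOpen_iff _).2 fun _ hm => ⟨a, b, hm.1, hm.2, Subset.rfl⟩

theorem Ioo_mem_nhds {a b m : M} (ha : a < m) (hb : m < b) : Ioo a b ∈ 𝓝 m :=
  (isOpen_Ioo a b).mem_nhds ⟨ha, hb⟩

theorem mem_nhds_iff {m : M} {U : Set M} :
    U ∈ 𝓝 m ↔ ∃ a b, a < m ∧ m < b ∧ Ioo a b ⊆ U := by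
  constructor
  · intro h
    obtain ⟨V, hVU, hV, hm⟩ := _root_.mem_nhds_iff.1 h
    obtain ⟨a, b, h1, h2, h3⟩ := (isOpen_iff V).1 hV m hm
    exact ⟨a, b, h1, h2, h3.trans hVU⟩
  · rintro ⟨a, b, h1, h2, h3⟩
    exact Filter.mem_of_superset (Ioo_mem_nhds h1 h2) h3

/-- An order embedding of `ℝ` onto an open interval is a homeomorphism onto its open range. -/
theorem isOpenEmbedding_of_range {φ : ℝ ↪o M} {a b : M} (h : range φ = Ioo a b) :
    IsOpenEmbedding φ := by
  refine .of_continuous_injective_isOpenMap ?_ φ.injective ?_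
  · rw [continuous_iff_continuousAt]
    intro r U hU
    obtain ⟨c, d, hc, hd, hcd⟩ := mem_nhds_iff.1 hU
    have hr : φ r ∈ Ioo a b := h ▸ mem_range_self r
    obtain ⟨c', hc', h1, h2⟩ := directed_lt c a _ hc hr.1
    obtain ⟨d', hd', h3, h4⟩ := directed_gt d b _ hd hr.2
    obtain ⟨s, rfl⟩ : c' ∈ range φ := h ▸ ⟨h2, hc'.trans hr.2⟩
    obtain ⟨t, rfl⟩ : d' ∈ range φ := h ▸ ⟨hr.1.trans hd', h4⟩
    rw [φ.lt_iff_lt] at hc'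
    rw [gt_iff_lt, φ.lt_iff_lt] at hd'
    refine Filter.mem_map.2 (Filter.mem_of_superset
      (_root_.Ioo_mem_nhds hc' hd') fun x hx => hcd ?_)
    exact ⟨h1.trans (φ.lt_iff_lt.2 hx.1), (φ.lt_iff_lt.2 hx.2).trans h3⟩
  · intro U hU
    refine (isOpen_iff _).2 ?_
    rintro _ ⟨r, hr, rfl⟩
    obtain ⟨ε, hε, hU⟩ := Metric.isOpen_iff.1 hU r hr
    have h1 : ∀ x, φ x ∈ Ioo a b := fun x => h ▸ mem_range_self x
    refine ⟨φ (r - ε), φ (r + ε), φ.lt_iff_lt.2 (by linarith), φ.lt_iff_lt.2 (by linarith), ?_⟩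
    rintro y ⟨hy1, hy2⟩
    obtain ⟨x, rfl⟩ : y ∈ range φ := h ▸ ⟨(h1 _).1.trans hy1, hy2.trans (h1 _).2⟩
    rw [φ.lt_iff_lt] at hy1 hy2
    exact ⟨x, hU (by rw [Real.ball_eq_Ioo]; exact ⟨hy1, hy2⟩), rfl⟩

theorem image_Ioo {φ : ℝ ↪o M} {a b : M} (h : range φ = Ioo a b) (s t : ℝ) :
    φ '' Ioo s t = Ioo (φ s) (φ t) := by
  have h1 : ∀ x, φ x ∈ Ioo a b := fun x => h ▸ mem_range_self x
  ext y
  constructor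
  · rintro ⟨x, hx, rfl⟩
    exact ⟨φ.lt_iff_lt.2 hx.1, φ.lt_iff_lt.2 hx.2⟩
  · rintro ⟨hy1, hy2⟩
    obtain ⟨x, rfl⟩ : y ∈ range φ := h ▸ ⟨(h1 s).1.trans hy1, hy2.trans (h1 t).2⟩
    exact ⟨x, ⟨φ.lt_iff_lt.1 hy1, φ.lt_iff_lt.1 hy2⟩, rfl⟩

theorem isPreconnected_Ioo (x y : M) : IsPreconnected (Ioo x y) := by
  by_cases hxy : x < y
  · obtain ⟨φ, a, b, h, hx, hy⟩ := chart x y hxy.le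
    obtain ⟨s, rfl⟩ : x ∈ range φ := h ▸ hx
    obtain ⟨t, rfl⟩ : y ∈ range φ := h ▸ hy
    rw [← image_Ioo h]
    exact _root_.isPreconnected_Ioo.image _
      (isOpenEmbedding_of_range h).continuous.continuousOn
  · rw [Ioo_eq_empty hxy]
    exact isPreconnected_empty

/-- The interval `[a, b]`, traversed upwards. -/
def posSeg (a b : M) (h : a < b) : Seg M where
  carrier := Icc a b
  le x y := a ≤ x ∧ x ≤ y ∧ y ≤ b
  ini := a
  fin := b
  mem_of_le _ _ h := ⟨⟨h.1, h.2.1.trans h.2.2⟩, ⟨h.1.trans h.2.1, h.2.2⟩⟩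
  le_refl _ hx := ⟨hx.1, le_rfl, hx.2⟩
  le_trans _ _ _ h h' := ⟨h.1, h.2.1.trans h'.2.1, h'.2.2⟩
  le_antisymm _ _ h h' := h.2.1.antisymm h'.2.1
  le_total _ hx _ hy := (le_or_le_of_mem_Icc hx hy).imp (fun h => ⟨hx.1, h, hy.2⟩)
    (fun h => ⟨hy.1, h, hx.2⟩)
  ini_le _ hx := ⟨le_rfl, hx.1, hx.2⟩
  le_fin _ hx := ⟨hx.1, hx.2, le_rfl⟩
  ini_mem := left_mem_Icc.2 h.le
  fin_mem := right_mem_Icc.2 h.le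
  ini_ne_fin := h.ne

/-- The positive segments. -/
def posSegs (M : Type u) [TreeLine M] : Set (Seg M) := {σ | ∃ a b h, σ = posSeg a b h}

/-- All intervals, in both directions. -/
def segs (M : Type u) [TreeLine M] : Set (Seg M) := posSegs M ∪ {σ | σ.neg ∈ posSegs M}

theorem posSeg_mem (a b : M) (h : a < b) : posSeg a b h ∈ posSegs M := ⟨a, b, h, rfl⟩

theorem mem_segs {σ : Seg M} : σ ∈ segs M ↔
    ∃ a b h, σ = posSeg a b h ∨ σ = (posSeg a b h).neg := by
  constructor
  · rintro (⟨a, b, h, rfl⟩ | ⟨a, b, h, h'⟩)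
    · exact ⟨a, b, h, Or.inl rfl⟩
    · exact ⟨a, b, h, Or.inr (congrArg Seg.neg h')⟩
  · rintro ⟨a, b, h, rfl | rfl⟩
    · exact Or.inl (posSeg_mem a b h)
    · exact Or.inr (posSeg_mem a b h)

theorem sub_posSeg {a b : M} (h : a < b) (u v : M) (huv : (posSeg a b h).le u v) (hne : u ≠ v) :
    (posSeg a b h).sub u v huv hne = posSeg u v (lt_of_le_of_ne huv.2.1 hne) := by
  have h1 : ∀ x, x ∈ ((posSeg a b h).sub u v huv hne).carrier ↔ x ∈ Icc u v := fun x =>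
    ⟨fun hx => ⟨hx.1.2.1, hx.2.2.1⟩, fun hx => ⟨⟨huv.1, hx.1, hx.2.trans huv.2.2⟩,
      ⟨huv.1.trans hx.1, hx.2, huv.2.2⟩⟩⟩
  refine Seg.ext_of_le h1 (fun x y => ?_) rfl rfl
  exact ⟨fun hx => ⟨hx.1.2.1, hx.2.1.2.1, hx.2.2.2.1⟩, fun hx =>
    ⟨⟨huv.1, hx.1, (hx.2.1.trans hx.2.2).trans huv.2.2⟩,
      ⟨huv.1.trans hx.1, hx.2.1, hx.2.2.trans huv.2.2⟩,
      ⟨(huv.1.trans hx.1).trans hx.2.1, hx.2.2, huv.2.2⟩⟩⟩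

theorem sub_neg {T : Type u} (σ : Seg T) (u v : T) (huv : σ.neg.le u v) (hne : u ≠ v) :
    σ.neg.sub u v huv hne = (σ.sub v u huv hne.symm).neg := by
  refine Seg.ext_of_le (fun x => and_comm) (fun x y => ?_) rfl rfl
  exact ⟨fun h => ⟨h.2.2, h.2.1, h.1⟩, fun h => ⟨h.2.2, h.2.1, h.1⟩⟩

theorem concat_posSeg {a b c : M} (hab : a < b) (hbc : b < c)
    (hcap : (posSeg a b hab).carrier ∩ (posSeg b c hbc).carrier = {b}) :
    (posSeg a b hab).concat (posSeg b c hbc) rfl hcap = posSeg a c (hab.trans hbc) := by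
  refine Seg.ext_of_le (fun x => ⟨?_, fun hx => ?_⟩) (fun x y => ⟨?_, fun hx => ?_⟩) rfl rfl
  · rintro (hx | hx)
    · exact ⟨hx.1, hx.2.trans hbc.le⟩
    · exact ⟨hab.le.trans hx.1, hx.2⟩
  · exact (le_or_le_of_mem_Icc hx ⟨hab.le, hbc.le⟩).imp (fun h => ⟨hx.1, h⟩) (fun h => ⟨h, hx.2⟩)
  · rintro (hx | hx | hx)
    · exact ⟨hx.1, hx.2.1, hx.2.2.trans hbc.le⟩
    · exact ⟨hab.le.trans hx.1, hx.2.1, hx.2.2⟩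
    · exact ⟨hx.1.1, hx.1.2.trans hx.2.1, hx.2.2⟩
  · rcases le_or_le_of_mem_Icc (a := a) (b := c) (x := x) (y := b) ⟨hx.1, hx.2.1.trans hx.2.2⟩
      ⟨hab.le, hbc.le⟩ with h1 | h1
    · rcases le_or_le_of_mem_Icc (a := a) (b := c) (x := y) (y := b) ⟨hx.1.trans hx.2.1, hx.2.2⟩
        ⟨hab.le, hbc.le⟩ with h2 | h2
      · exact Or.inl ⟨hx.1, hx.2.1, h2⟩
      · exact Or.inr (Or.inr ⟨⟨hx.1, h1⟩, ⟨h2, hx.2.2⟩⟩)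
    · exact Or.inr (Or.inl ⟨h1, hx.2.1, hx.2.2⟩)

theorem concat_neg {T : Type u} (σ τ : Seg T) (h : σ.neg.fin = τ.neg.ini)
    (hcap : σ.neg.carrier ∩ τ.neg.carrier = {σ.neg.fin})
    (hcap' : τ.carrier ∩ σ.carrier = {τ.fin}) :
    σ.neg.concat τ.neg h hcap = (τ.concat σ h.symm hcap').neg := by
  refine Seg.ext_of_le (fun x => or_comm) (fun x y => ?_) rfl rfl
  constructor
  · rintro (h | h | h)
    · exact Or.inr (Or.inl h)
    · exact Or.inl h
    · exact Or.inr (Or.inr ⟨h.2, h.1⟩)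
  · rintro (h | h | h)
    · exact Or.inr (Or.inl h)
    · exact Or.inl h
    · exact Or.inr (Or.inr ⟨h.2, h.1⟩)

theorem concat_posSegs {σ τ : Seg M} (hσ : σ ∈ posSegs M) (hτ : τ ∈ posSegs M) (h : σ.fin = τ.ini)
    (hcap : σ.carrier ∩ τ.carrier = {σ.fin}) : σ.concat τ h hcap ∈ posSegs M := by
  obtain ⟨a, b, hab, rfl⟩ := hσ
  obtain ⟨c, d, hcd, rfl⟩ := hτ
  obtain rfl : b = c := h
  exact ⟨a, d, hab.trans hcd, concat_posSeg hab hcd hcap⟩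

/-- Two segments that meet in a single end point continue each other, because the line does not
branch at its points. -/
theorem concat_segs {σ τ : Seg M} (hσ : σ ∈ segs M) (hτ : τ ∈ segs M) (h : σ.fin = τ.ini)
    (hcap : σ.carrier ∩ τ.carrier = {σ.fin}) : σ.concat τ h hcap ∈ segs M := by
  rcases hσ with hσ | hσ <;> rcases hτ with hτ | hτ
  · exact Or.inl (concat_posSegs hσ hτ h hcap)
  · exfalso
    obtain ⟨a, b, hab, rfl⟩ := hσ
    obtain ⟨c, d, hcd, h1⟩ := hτ
    obtain rfl : τ = (posSeg c d hcd).neg := congrArg Seg.neg h1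
    obtain rfl : b = d := h
    obtain ⟨e, he, hae, hce⟩ := directed_lt a c b hab hcd
    have h2 : e ∈ (posSeg a b hab).carrier ∩ (posSeg c b hcd).neg.carrier :=
      ⟨⟨hae.le, he.le⟩, ⟨hce.le, he.le⟩⟩
    rw [hcap] at h2
    exact he.ne h2
  · exfalso
    obtain ⟨a, b, hab, h1⟩ := hσ
    obtain rfl : σ = (posSeg a b hab).neg := congrArg Seg.neg h1
    obtain ⟨c, d, hcd, rfl⟩ := hτ
    obtain rfl : a = c := h
    obtain ⟨e, he, hae, hce⟩ := directed_gt b d a hab hcd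
    have h2 : e ∈ (posSeg a b hab).neg.carrier ∩ (posSeg a d hcd).carrier :=
      ⟨⟨he.le, hae.le⟩, ⟨he.le, hce.le⟩⟩
    rw [hcap] at h2
    exact he.ne' h2
  · have hcap' : τ.neg.carrier ∩ σ.neg.carrier = {τ.neg.fin} := by
      rw [inter_comm]
      exact hcap.trans (congrArg _ h)
    exact Or.inr (by
      change (σ.neg.neg.concat τ.neg.neg h hcap).neg ∈ posSegs M
      rw [concat_neg σ.neg τ.neg h hcap hcap']
      exact concat_posSegs hτ hσ h.symm hcap')

theorem exists_isParam {a b : M} (hab : a < b) : ∃ (f : Icc (0 : ℝ) 1 → M),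
    IsEmbedding f ∧ (posSeg a b hab).IsParam f := by
  obtain ⟨φ, c, d, h, ha, hb⟩ := chart a b hab.le
  obtain ⟨s, rfl⟩ : a ∈ range φ := h ▸ ha
  obtain ⟨t, rfl⟩ : b ∈ range φ := h ▸ hb
  have hst : s < t := φ.lt_iff_lt.1 hab
  refine ⟨fun u => φ (iccHomeoI s t hst |>.symm u), ?_, ?_, fun u v => ?_⟩
  · exact (isOpenEmbedding_of_range h).isEmbedding.comp
      (IsEmbedding.subtypeVal.comp (iccHomeoI s t hst).symm.isEmbedding)
  · ext y
    constructor
    · rintro ⟨u, rfl⟩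
      exact ⟨φ.le_iff_le.2 (iccHomeoI s t hst |>.symm u).2.1,
        φ.le_iff_le.2 (iccHomeoI s t hst |>.symm u).2.2⟩
    · rintro ⟨hy1, hy2⟩
      obtain ⟨x, rfl⟩ : y ∈ range φ := h ▸ ⟨ha.1.trans_le hy1, hy2.trans_lt hb.2⟩
      exact ⟨iccHomeoI s t hst ⟨x, φ.le_iff_le.1 hy1, φ.le_iff_le.1 hy2⟩, by simp⟩
  · have h1 : ∀ u, φ s ≤ φ (iccHomeoI s t hst |>.symm u) := fun u =>
      φ.le_iff_le.2 (iccHomeoI s t hst |>.symm u).2.1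
    have h2 : ∀ u, φ (iccHomeoI s t hst |>.symm u) ≤ φ t := fun u =>
      φ.le_iff_le.2 (iccHomeoI s t hst |>.symm u).2.2
    have h3 : u ≤ v ↔ φ (iccHomeoI s t hst |>.symm u) ≤ φ (iccHomeoI s t hst |>.symm v) := by
      rw [φ.le_iff_le, iccHomeoI_symm_apply_coe, iccHomeoI_symm_apply_coe, add_le_add_iff_right,
        mul_le_mul_iff_of_pos_left (sub_pos.2 hst), Subtype.coe_le_coe]
    rw [h3]
    exact ⟨fun h => ⟨h1 u, h, h2 v⟩, fun h => h.2.1⟩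

theorem isRelOpen_posSeg {a b : M} (hab : a < b) {U : Set M} (hU : IsOpen U) :
    (posSeg a b hab).IsRelOpen U := by
  rw [Seg.isRelOpen_iff]
  intro x hx hxU
  obtain ⟨c, d, hc, hd, hcd⟩ := (isOpen_iff U).1 hU x hxU
  constructor
  · rcases hx.1.eq_or_lt with h | h
    · exact Or.inl h.symm
    · obtain ⟨l, hl, h1, h2⟩ := directed_lt a c x h hc
      refine Or.inr ⟨l, ⟨h1.le, hl.le, hx.2⟩, hl.ne, fun y hly _ hyx => hcd ?_⟩
      exact ⟨h2.trans_le hly.2.1, hyx.2.1.trans_lt hd⟩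
  · rcases hx.2.eq_or_lt with h | h
    · exact Or.inl h
    · obtain ⟨u, hu, h1, h2⟩ := directed_gt b d x h hd
      refine Or.inr ⟨u, ⟨hx.1, hu.le, h1.le⟩, hu.ne', fun y hxy hyu _ => hcd ?_⟩
      exact ⟨hc.trans_le hxy.2.1, hyu.2.1.trans_lt h2⟩

theorem isOpen_iff_isRelOpen (U : Set M) : IsOpen U ↔ ∀ σ ∈ segs M, σ.IsRelOpen U := by
  constructor
  · rintro hU σ (⟨a, b, h, rfl⟩ | ⟨a, b, h, h1⟩)
    · exact isRelOpen_posSeg h hU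
    · rw [← Seg.isRelOpen_neg, h1]
      exact isRelOpen_posSeg h hU
  · intro h
    refine (isOpen_iff _).2 ?_
    intro m hm
    obtain ⟨a, ha⟩ := exists_lt m
    obtain ⟨b, hb⟩ := exists_gt m
    obtain ⟨h1, h2⟩ := (Seg.isRelOpen_iff _ _).1
      (h _ (Or.inl (posSeg_mem a b (ha.trans hb)))) m ⟨ha.le, hb.le⟩ hm
    obtain ⟨l, hl, hlm, hlU⟩ := h1.resolve_left ha.ne'
    obtain ⟨u, hu, hum, huU⟩ := h2.resolve_left hb.ne
    refine ⟨l, u, lt_of_le_of_ne hl.2.1 hlm, lt_of_le_of_ne hu.2.1 hum.symm, fun y hy => ?_⟩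
    have hay : a ≤ y := hl.1.trans hy.1.le
    have hyb : y ≤ b := hy.2.le.trans hu.2.2
    rcases le_or_le_of_mem_Icc (a := l) (b := u) ⟨hy.1.le, hy.2.le⟩ ⟨hl.2.1, hu.2.1⟩ with h3 | h3
    · exact hlU y ⟨hl.1, hy.1.le, hyb⟩ hy.1.ne ⟨hay, h3, hb.le⟩
    · exact huU y ⟨ha.le, h3, hyb⟩ ⟨hay, hy.2.le, hu.2.2⟩ hy.2.ne'

theorem isPath_append {T : Type u} {S : Set (Seg T)} {x y z : T} {w v : List (Seg T)}
    (h : IsPath S x y w) (h' : IsPath S y z v) : IsPath S x z (w ++ v) := by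
  induction w generalizing x with
  | nil =>
    obtain rfl : x = y := h
    exact h'
  | cons σ w ih => exact ⟨h.1, h.2.1, ih h.2.2⟩

theorem joined (x y : M) : ∃ w, IsPath (segs M) x y w := by
  induction conn x y with
  | refl => exact ⟨[], rfl⟩
  | @tail u v _ huv ih =>
    obtain ⟨w, hw⟩ := ih
    rcases eq_or_ne u v with rfl | hne
    · exact ⟨w, hw⟩
    rcases huv with h | h
    · have h1 := lt_of_le_of_ne h hne
      exact ⟨w ++ [posSeg u v h1], isPath_append hw ⟨Or.inl (posSeg_mem _ _ _), rfl, rfl⟩⟩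
    · have h1 := lt_of_le_of_ne h hne.symm
      exact ⟨w ++ [(posSeg v u h1).neg], isPath_append hw ⟨Or.inr (posSeg_mem v u h1), rfl, rfl⟩⟩

theorem sub_mem_posSegs {σ : Seg M} (hσ : σ ∈ posSegs M) (a b : M) (hab : σ.le a b) (hne : a ≠ b) :
    σ.sub a b hab hne ∈ posSegs M := by
  obtain ⟨c, d, h, rfl⟩ := hσ
  rw [sub_posSeg]
  exact posSeg_mem _ _ _

theorem isOrientation : IsOrientation (segs M) (posSegs M) where
  subset := subset_union_left
  neg_notMem := by
    rintro _ ⟨a, b, h, rfl⟩ ⟨c, d, h', h1⟩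
    obtain rfl : b = c := congrArg Seg.ini h1
    obtain rfl : a = d := congrArg Seg.fin h1
    exact lt_asymm h h'
  sub_mem _ hσ := sub_mem_posSegs hσ
  joined := joined
  concat_mem _ hσ _ hτ := concat_posSegs hσ hτ

theorem exists_countable_segs :
    ∃ C : Set (Seg M), C ⊆ segs M ∧ C.Countable ∧ ⋃ σ ∈ C, σ.carrier = univ := by
  obtain ⟨D, hD, hdense⟩ := countable_dense (M := M)
  have hc : Countable {p : D × D // (p.1 : M) < p.2} := by
    have := hD.to_subtype
    infer_instance
  refine ⟨range fun p : {p : D × D // (p.1 : M) < p.2} => posSeg _ _ p.2, ?_,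
    countable_range _, eq_univ_of_forall fun m => ?_⟩
  · rintro _ ⟨p, rfl⟩
    exact Or.inl (posSeg_mem _ _ _)
  · obtain ⟨a, ha⟩ := exists_lt m
    obtain ⟨b, hb⟩ := exists_gt m
    obtain ⟨c, hc, -, h1⟩ := hdense a m ha
    obtain ⟨d, hd, h2, -⟩ := hdense m b hb
    refine mem_iUnion₂.2 ⟨_, ⟨⟨(⟨c, hc⟩, ⟨d, hd⟩), h1.trans h2⟩, rfl⟩, ?_⟩
    exact ⟨h1.le, h2.le⟩

end TreeLine
/-! ### Closed paths reduce to the empty word -/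

open SidePoset

section Words

variable {X : Type u} [SidePoset X]

open Classical in
/-- The point `m` as a list, if it lies between `x` and `y`. -/
noncomputable def mid (m x y : X) : List X := if Btw x m y then [m] else []

/-- The vertices of a path, with `m` inserted on every edge that contains it. -/
noncomputable def insertVertex (m : X) : List X → List X
  | [] => []
  | [x] => [x]
  | x :: y :: l => x :: (mid m x y ++ insertVertex m (y :: l))

/-- `v` arises from the list of vertices `l` by removing one backtracking. -/
def Backtrack (l v : List X) : Prop :=
  ∃ p a b q, l = p ++ a :: b :: a :: q ∧ v = p ++ a :: q

/-- The path with vertices `l` has a subdivision that becomes constant by removing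
backtrackings. -/
def Contracts (x : X) (l : List X) : Prop :=
  ∃ F : List X, Relation.ReflTransGen Backtrack (F.foldl (fun l m => insertVertex m l) l) [x]

theorem mid_of_btw {m x y : X} (h : Btw x m y) : mid m x y = [m] := if_pos h

theorem mid_of_not {m x y : X} (h : ¬ Btw x m y) : mid m x y = [] := if_neg h

theorem exists_insertVertex_cons (m x : X) (l : List X) :
    ∃ t, insertVertex m (x :: l) = x :: t := by
  cases l <;> exact ⟨_, rfl⟩

theorem insertVertex_append (m : X) (p : List X) (a : X) :
    ∃ p', ∀ q, insertVertex m (p ++ a :: q) = p' ++ insertVertex m (a :: q) := by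
  induction p with
  | nil => exact ⟨[], fun q => rfl⟩
  | cons b p ih =>
    obtain ⟨p', h⟩ := ih
    cases p with
    | nil => exact ⟨b :: mid m b a, fun q => rfl⟩
    | cons c p =>
      refine ⟨b :: (mid m b c ++ p'), fun q => ?_⟩
      have := h q
      simp only [List.cons_append, insertVertex, List.append_assoc] at this ⊢
      rw [this]

theorem SidePoset.Btw.split {x y m n : X} (hm : Btw x m y) (hn : Btw x n y) (hne : m ≠ n) :
    (Btw x m n ∧ Btw m n y ∧ ¬ Btw x n m ∧ ¬ Btw n m y) ∨
      (Btw x n m ∧ Btw n m y ∧ ¬ Btw x m n ∧ ¬ Btw m n y) := by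
  have h1 : ∀ {a b c : X}, a < b → ¬ Btw a c b ∨ (a < c ∧ c < b) := fun h => by
    by_contra h2
    obtain ⟨h3, h4⟩ := not_or.1 h2
    exact h3 fun h5 => h5.elim h4 fun h5 => lt_asymm h (h5.1.trans h5.2)
  have h2 : ∀ {a b c : X}, b < a → ¬ Btw a c b ∨ (b < c ∧ c < a) := fun h => by
    refine (h1 h).imp (fun h3 h4 => h3 h4.symm) id
  rcases hm with ⟨h3, h4⟩ | ⟨h3, h4⟩
  · have hn : x < n ∧ n < y := ((h1 (h3.trans h4)).resolve_left fun h => h hn)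
    rcases le_or_le_of_mem_Icc (a := x) (b := y) ⟨h3.le, h4.le⟩ ⟨hn.1.le, hn.2.le⟩ with h5 | h5
    · have h5 := lt_of_le_of_ne h5 hne
      exact Or.inl ⟨Or.inl ⟨h3, h5⟩, Or.inl ⟨h5, hn.2⟩,
        (h1 h3).elim id fun h => absurd h.2 (lt_asymm h5),
        (h1 hn.2).elim id fun h => absurd h.1 (lt_asymm h5)⟩
    · have h5 := lt_of_le_of_ne h5 hne.symm
      exact Or.inr ⟨Or.inl ⟨hn.1, h5⟩, Or.inl ⟨h5, h4⟩,
        (h1 hn.1).elim id fun h => absurd h.2 (lt_asymm h5),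
        (h1 h4).elim id fun h => absurd h.1 (lt_asymm h5)⟩
  · have hn : y < n ∧ n < x := ((h2 (h3.trans h4)).resolve_left fun h => h hn)
    rcases le_or_le_of_mem_Icc (a := y) (b := x) ⟨h3.le, h4.le⟩ ⟨hn.1.le, hn.2.le⟩ with h5 | h5
    · have h5 := lt_of_le_of_ne h5 hne
      exact Or.inr ⟨Or.inr ⟨h5, hn.2⟩, Or.inr ⟨h3, h5⟩,
        (h2 hn.2).elim id fun h => absurd h.1 (lt_asymm h5),
        (h2 h3).elim id fun h => absurd h.2 (lt_asymm h5)⟩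
    · have h5 := lt_of_le_of_ne h5 hne.symm
      exact Or.inl ⟨Or.inr ⟨h5, h4⟩, Or.inr ⟨hn.1, h5⟩,
        (h2 h4).elim id fun h => absurd h.1 (lt_asymm h5),
        (h2 hn.1).elim id fun h => absurd h.2 (lt_asymm h5)⟩

theorem SidePoset.Btw.trans_left {x y m n : X} (hm : Btw x m y) (hn : Btw x n m) : Btw x n y := by
  rcases hm with ⟨h3, h4⟩ | ⟨h3, h4⟩ <;> rcases hn with ⟨h5, h6⟩ | ⟨h5, h6⟩
  · exact Or.inl ⟨h5, h6.trans h4⟩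
  · exact absurd (h5.trans h6) (lt_asymm h3)
  · exact absurd (h5.trans h6) (lt_asymm h4)
  · exact Or.inr ⟨h3.trans h5, h6⟩

theorem SidePoset.Btw.trans_right {x y m n : X} (hm : Btw x m y) (hn : Btw m n y) : Btw x n y :=
  (hm.symm.trans_left hn.symm).symm

/-- Points can be inserted in any order, because a point on an edge lies on exactly one of the two
parts into which another point of the edge divides it. -/
theorem insertVertex_comm (m n : X) (l : List X) :
    insertVertex m (insertVertex n l) = insertVertex n (insertVertex m l) := by
  rcases eq_or_ne m n with rfl | hne
  · rfl
  induction l with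
  | nil => rfl
  | cons x l ih =>
    cases l with
    | nil => rfl
    | cons y l =>
      obtain ⟨t, ht⟩ := exists_insertVertex_cons n y l
      obtain ⟨t', ht'⟩ := exists_insertVertex_cons m y l
      rw [ht, ht'] at ih
      simp only [insertVertex, ht, ht']
      by_cases hm : Btw x m y <;> by_cases hn : Btw x n y
      · rcases hm.split hn hne with ⟨h1, h2, h3, h4⟩ | ⟨h1, h2, h3, h4⟩
        · simp [mid_of_btw, mid_of_not, insertVertex, *]
        · simp [mid_of_btw, mid_of_not, insertVertex, *]
      · have h1 : ¬ Btw x n m := fun h => hn (hm.trans_left h)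
        have h2 : ¬ Btw m n y := fun h => hn (hm.trans_right h)
        simp [mid_of_btw, mid_of_not, insertVertex, *]
      · have h1 : ¬ Btw x m n := fun h => hm (hn.trans_left h)
        have h2 : ¬ Btw n m y := fun h => hm (hn.trans_right h)
        simp [mid_of_btw, mid_of_not, insertVertex, *]
      · simp [mid_of_not, insertVertex, *]

theorem foldl_insertVertex_comm (m : X) (F l : List X) :
    F.foldl (fun l m => insertVertex m l) (insertVertex m l) =
      insertVertex m (F.foldl (fun l m => insertVertex m l) l) := by
  induction F generalizing l with
  | nil => rfl
  | cons n F ih => rw [List.foldl_cons, List.foldl_cons, insertVertex_comm, ih]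

theorem insertVertex_of_btw {m a b : X} (h : Btw a m b) (p q : List X) :
    insertVertex m (p ++ a :: m :: b :: q) = insertVertex m (p ++ a :: b :: q) := by
  obtain ⟨p', hp⟩ := insertVertex_append m p a
  rw [hp, hp]
  have h1 : ¬ Btw a m m := fun h => h.adj_right.ne rfl
  have h2 : ¬ Btw m m b := fun h => h.adj_left.ne rfl
  simp [insertVertex, mid_of_btw, mid_of_not, *]

theorem Backtrack.insertVertex {l v : List X} (h : Backtrack l v) (m : X) :
    Relation.ReflTransGen Backtrack (insertVertex m l) (insertVertex m v) := by
  obtain ⟨p, a, b, q, rfl, rfl⟩ := h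
  obtain ⟨p', hp⟩ := insertVertex_append m p a
  obtain ⟨t, ht⟩ := exists_insertVertex_cons m a q
  rw [hp, hp]
  by_cases hm : Btw a m b
  · have h1 : OrderTrees.insertVertex m (a :: b :: a :: q) = [a] ++ m :: b :: m :: (a :: t) := by
      simp [OrderTrees.insertVertex, mid_of_btw, hm, hm.symm, ht]
    rw [h1, ht]
    refine .tail (.single ⟨p' ++ [a], m, b, a :: t, by simp, rfl⟩) ⟨p', a, m, t, by simp, rfl⟩
  · have hm' : ¬ Btw b m a := fun h => hm h.symm
    have h1 : OrderTrees.insertVertex m (a :: b :: a :: q) = a :: b :: a :: t := by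
      simp [OrderTrees.insertVertex, mid_of_not, hm, hm', ht]
    rw [h1, ht]
    exact .single ⟨p', a, b, t, rfl, rfl⟩

theorem insertVertex_reflTransGen {l v : List X} (h : Relation.ReflTransGen Backtrack l v) (m : X) :
    Relation.ReflTransGen Backtrack (insertVertex m l) (insertVertex m v) := by
  induction h with
  | refl => exact .refl
  | tail _ h ih => exact ih.trans (h.insertVertex m)

/-- A backtracking that is subdivided by further points still cancels. -/
theorem Contracts.of_backtrack {x : X} {l v : List X} (h : Backtrack l v) (hv : Contracts x v) :
    Contracts x l := by
  obtain ⟨F, hF⟩ := hv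
  refine ⟨F, .trans ?_ hF⟩
  have : ∀ l v : List X, Relation.ReflTransGen Backtrack l v → Relation.ReflTransGen Backtrack
      (F.foldl (fun l m => insertVertex m l) l) (F.foldl (fun l m => insertVertex m l) v) := by
    clear hF h
    induction F with
    | nil => exact fun _ _ h => h
    | cons m F ih => exact fun l v h => ih _ _ (insertVertex_reflTransGen h m)
  exact this l v (.single h)

/-- Contractibility depends only on the path up to inserting the same vertices. -/
theorem Contracts.of_insertVertex_eq {x : X} {l v : List X} (m : X)
    (h : insertVertex m l = insertVertex m v) (hv : Contracts x v) : Contracts x l := by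
  obtain ⟨F, hF⟩ := hv
  refine ⟨m :: F, ?_⟩
  rw [List.foldl_cons, h, foldl_insertVertex_comm]
  exact insertVertex_reflTransGen hF m

theorem contracts_insert_iff {x m a b : X} (h : Btw a m b) (p q : List X) :
    Contracts x (p ++ a :: m :: b :: q) ↔ Contracts x (p ++ a :: b :: q) :=
  ⟨Contracts.of_insertVertex_eq m (insertVertex_of_btw h p q).symm,
    Contracts.of_insertVertex_eq m (insertVertex_of_btw h p q)⟩

theorem Contracts.backtrack {x a b : X} {p q : List X} (h : Contracts x (p ++ a :: q)) :
    Contracts x (p ++ a :: b :: a :: q) :=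
  .of_backtrack ⟨p, a, b, q, rfl, rfl⟩ h

/-- A vertex can be dropped when its two neighbours are comparable. -/
theorem Contracts.drop {x a b c : X} {p q : List X} (hab : Adj a b) (hbc : Adj b c)
    (hac : Adj a c) (h : Contracts x (p ++ a :: c :: q)) : Contracts x (p ++ a :: b :: c :: q) := by
  have h1 : Btw a b c ∨ Btw a c b ∨ Btw b a c := by
    rcases hab with h1 | h1 <;> rcases hbc with h2 | h2 <;> rcases hac with h3 | h3
    · exact Or.inl (Or.inl ⟨h1, h2⟩)
    · exact absurd (h1.trans h2) (lt_asymm h3)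
    · exact Or.inr (Or.inl (Or.inl ⟨h3, h2⟩))
    · exact Or.inr (Or.inr (Or.inr ⟨h3, h1⟩))
    · exact Or.inr (Or.inr (Or.inl ⟨h1, h3⟩))
    · exact Or.inr (Or.inl (Or.inr ⟨h2, h3⟩))
    · exact absurd (h2.trans h1) (lt_asymm h3)
    · exact Or.inl (Or.inr ⟨h2, h1⟩)
  rcases h1 with h1 | h1 | h1
  · exact (contracts_insert_iff h1 p q).2 h
  · rw [← contracts_insert_iff h1]
    have := Contracts.backtrack (b := b) (p := p ++ [a]) (a := c) (q := q)
      (x := x) (by simpa using h)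
    simpa using this
  · have h2 := contracts_insert_iff (x := x) h1 (p ++ [a]) q
    simp only [List.append_assoc, List.cons_append, List.nil_append] at h2
    rw [← h2]
    exact h.backtrack

/-- A common point of three consecutive edges makes the middle one superfluous. -/
theorem Contracts.shortcut {x a b c d e : X} {p q : List X} (h1 : Btw a e b) (h2 : Btw b e c)
    (h3 : Btw c e d) (h : Contracts x (p ++ a :: e :: d :: q)) :
    Contracts x (p ++ a :: b :: c :: d :: q) := by
  have h4 := contracts_insert_iff (x := x) h1 p (c :: d :: q)
  have h5 := contracts_insert_iff (x := x) h2 (p ++ [a, e]) (d :: q)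
  have h6 := contracts_insert_iff (x := x) h3 (p ++ [a, e, b, e]) q
  simp only [List.append_assoc, List.cons_append, List.nil_append] at h4 h5 h6
  rw [← h4, ← h5, ← h6]
  have h7 : Contracts x ((p ++ [a]) ++ e :: b :: e :: d :: q) := .backtrack (by simpa using h)
  have h8 : Contracts x ((p ++ [a, e, b]) ++ e :: c :: e :: d :: q) :=
    .backtrack (by simpa using h7)
  simpa using h8

end Words

namespace TreeLine

variable {M : Type u} [TreeLine M]

theorem isOpen_setOf_btw (x y : M) : IsOpen {m | Btw x m y} :=
  (isOpen_Ioo x y).union (isOpen_Ioo y x)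

theorem isPreconnected_setOf_btw (x y : M) : IsPreconnected {m | Btw x m y} := by
  by_cases h : x < y
  · have : {m | Btw x m y} = Ioo x y := by
      ext m
      exact ⟨fun h' => h'.elim id fun h' => absurd (h'.1.trans h'.2) (lt_asymm h), Or.inl⟩
    rw [this]
    exact isPreconnected_Ioo x y
  · have : {m | Btw x m y} = Ioo y x := by
      ext m
      exact ⟨fun h' => h'.elim (fun h' => absurd (h'.1.trans h'.2) h) id, Or.inr⟩
    rw [this]
    exact isPreconnected_Ioo y x

/-- Two edges that leave `x` in the same direction have a common initial part. -/
theorem exists_btw_btw {x y z : M} (hy : Adj x y) (hz : Adj x z) (hyz : ¬ Adj y z) :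
    ∃ m, Btw x m y ∧ Btw x m z := by
  rcases hy with hy | hy <;> rcases hz with hz | hz
  · obtain ⟨m, hm, h1, h2⟩ := directed_gt y z x hy hz
    exact ⟨m, Or.inl ⟨hm, h1⟩, Or.inl ⟨hm, h2⟩⟩
  · exact absurd (Or.inr (hz.trans hy)) hyz
  · exact absurd (Or.inl (hy.trans hz)) hyz
  · obtain ⟨m, hm, h1, h2⟩ := directed_lt y z x hy hz
    exact ⟨m, Or.inr ⟨h1, hm⟩, Or.inr ⟨h2, hm⟩⟩

/-- The list of vertices is a path in which consecutive edges only overlap near their common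
vertex. -/
structure IsTaut (l : List M) : Prop where
  chain : l.IsChain Adj
  turn : ∀ p a b c q, l = p ++ a :: b :: c :: q → a ≠ c ∧ ¬ Adj a c
  overlap : ∀ p a b c d q, l = p ++ a :: b :: c :: d :: q →
    ¬ ∃ e, Btw a e b ∧ Btw b e c ∧ Btw c e d

theorem IsTaut.tail {a : M} {l : List M} (h : IsTaut (a :: l)) : IsTaut l where
  chain := h.chain.of_cons
  turn p b c d q hl := h.turn (a :: p) b c d q (by rw [hl]; rfl)
  overlap p b c d e q hl := h.overlap (a :: p) b c d e q (by rw [hl]; rfl)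

/-- On each edge of a taut path with at least three edges there is a point that lies on neither of
the neighbouring edges, since the edge is connected. -/
theorem exists_free {u v w x : M} (huv : Adj u v) (hvw : Adj v w) (hwx : Adj w x)
    (huw : ¬ Adj u w) (hvx : ¬ Adj v x) (hno : ¬ ∃ e, Btw u e v ∧ Btw v e w ∧ Btw w e x) :
    ∃ m, Btw v m w ∧ ¬ Btw u m v ∧ ¬ Btw w m x := by
  by_contra hcon
  have hcov : {m | Btw v m w} ⊆ {m | Btw u m v} ∪ {m | Btw w m x} := by
    intro m hm
    by_contra h
    obtain ⟨h1, h2⟩ := not_or.1 h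
    exact hcon ⟨m, hm, h1, h2⟩
  obtain ⟨a, ha, ha'⟩ := exists_btw_btw huv.symm hvw huw
  obtain ⟨b, hb, hb'⟩ := exists_btw_btw hvw.symm hwx hvx
  obtain ⟨e, he, he1, he2⟩ := isPreconnected_setOf_btw v w _ _ (isOpen_setOf_btw u v)
    (isOpen_setOf_btw w x) hcov ⟨a, ha', ha.symm⟩ ⟨b, hb.symm, hb'⟩
  exact hno ⟨e, he1, he, he2⟩

/-- A point of the first edge of a taut path that is not on the second edge has the end of the path
on the side of the second vertex. -/
theorem IsTaut.up_iff {x₀ x w : M} {t : List M} (h : IsTaut (x :: w :: t))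
    (hlast : (w :: t).getLast? = some x₀) {m : M} (hm : Btw w m x)
    (hfree : ∀ v ∈ t.head?, ¬ Btw v m w) : m ≠ x₀ ∧ (up m x₀ ↔ up m w) := by
  induction t generalizing x w m with
  | nil =>
    obtain rfl : w = x₀ := by simpa using hlast
    exact ⟨hm.adj_left.ne.symm, Iff.rfl⟩
  | cons v t ih =>
    have hxw : Adj x w := h.chain.rel
    have hwv : Adj w v := h.tail.chain.rel
    have hturn := h.turn [] x w v t rfl
    have hvm : ¬ Btw v m w := hfree v (by simp)
    have hmv : m ≠ v := by
      rintro rfl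
      exact hturn.2 hm.adj_right.symm
    have hmw : m ≠ w := hm.adj_left.ne.symm
    have h0 : up m v ↔ up m w := up_iff_of_adj hwv.symm hmv hmw hvm
    cases t with
    | nil =>
      obtain rfl : v = x₀ := by simpa using hlast
      exact ⟨hmv, h0⟩
    | cons u t =>
      have hvu : Adj v u := h.tail.tail.chain.rel
      have hturn' := h.turn [x] w v u t rfl
      -- A free point `m'` of the next edge has `m` and the end of the path on different sides, so
      -- that by the tree axiom `m` has `m'` and the end on the same side.
      obtain ⟨m', h1, h2, h3⟩ := exists_free hvu.symm hwv.symm hxw.symm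
        (fun h => hturn'.2 h.symm) (fun h => hturn.2 h.symm)
        (fun ⟨e, he1, he2, he3⟩ => h.overlap [] x w v u t rfl ⟨e, he3.symm, he2.symm, he1.symm⟩)
      obtain ⟨h4, h5⟩ := ih h.tail (by rwa [List.getLast?_cons_cons] at hlast) h1
        (by simpa using h2)
      have hne : m' ≠ m := by
        rintro rfl
        exact hvm h1
      have h6 : up m m' ↔ up m w := by
        refine up_iff_of_adj h1.adj_right hne.symm hmw (fun h => hvm ?_)
        exact h1.trans_right h
      have h7 : up m' m ↔ up m' w := by
        refine up_iff_of_adj hm.adj_left.symm hne h1.adj_right.ne (fun h => h3 ?_)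
        exact hm.trans_left h.symm
      have h8 := (sep_of_btw h1).2.2
      have h9 : ¬ (up m' m ↔ up m' x₀) := fun h9 => h8 (h5.symm.trans (h9.symm.trans h7))
      have hmx : m ≠ x₀ := by
        rintro rfl
        exact h9 Iff.rfl
      have h10 := (isTreeSide.tree m' m x₀ hne h4 hmx).resolve_left h9
      exact ⟨hmx, h10.symm.trans h6⟩

/-- A taut path is not closed: if it has at least three edges, a free point of its second edge
separates its two ends. -/
theorem IsTaut.ne_last {x₀ x w : M} {t : List M} (h : IsTaut (x :: w :: t))
    (hlast : (w :: t).getLast? = some x₀) : x ≠ x₀ := by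
  have hxw : Adj x w := h.chain.rel
  match t, h, hlast with
  | [], h, hlast =>
    obtain rfl : w = x₀ := by simpa using hlast
    exact hxw.ne
  | [v], h, hlast =>
    obtain rfl : v = x₀ := by simpa using hlast
    exact (h.turn [] x w v [] rfl).1
  | v :: u :: t, h, hlast =>
    have hwv : Adj w v := h.tail.chain.rel
    have hvu : Adj v u := h.tail.tail.chain.rel
    have hturn := h.turn [] x w v (u :: t) rfl
    have hturn' := h.turn [x] w v u t rfl
    obtain ⟨m, h1, h2, h3⟩ := exists_free hvu.symm hwv.symm hxw.symm
      (fun h => hturn'.2 h.symm) (fun h => hturn.2 h.symm)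
      (fun ⟨e, he1, he2, he3⟩ => h.overlap [] x w v u t rfl ⟨e, he3.symm, he2.symm, he1.symm⟩)
    obtain ⟨h4, h5⟩ := h.tail.up_iff (by rwa [List.getLast?_cons_cons] at hlast) h1
      (by simpa using h2)
    have hmx : m ≠ x := by
      rintro rfl
      exact hturn.2 h1.adj_left.symm
    have h6 : up m w ↔ up m x := up_iff_of_adj hxw.symm h1.adj_right.ne hmx h3
    rintro rfl
    exact (sep_of_btw h1).2.2 (h5.symm.trans h6.symm)

/-- A closed path contracts, by induction on the number of vertices: it is not taut unless it is
constant, and otherwise one of the moves `Contracts.backtrack`, `Contracts.drop` or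
`Contracts.shortcut` makes it shorter. -/
theorem contracts_of_closed (x : M) (l : List M) (hc : l.IsChain Adj) (hh : l.head? = some x)
    (hl : l.getLast? = some x) : Contracts x l := by
  induction hn : l.length using Nat.strong_induction_on generalizing l with
  | _ n ih =>
  subst hn
  by_cases ht : IsTaut l
  · match l, ht, hh, hl with
    | [y], ht, hh, hl =>
      obtain rfl : y = x := by simpa using hh
      exact ⟨[], .refl⟩
    | y :: w :: t, ht, hh, hl =>
      obtain rfl : y = x := by simpa using hh
      exact absurd rfl (ht.ne_last (by rwa [List.getLast?_cons_cons] at hl))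
  · have h1 : (∃ p a b c q, l = p ++ a :: b :: c :: q ∧ (a = c ∨ Adj a c)) ∨
        (∃ p a b c d q, l = p ++ a :: b :: c :: d :: q ∧
          ∃ e, Btw a e b ∧ Btw b e c ∧ Btw c e d) := by
      by_contra hcon
      obtain ⟨h1, h2⟩ := not_or.1 hcon
      refine ht ⟨hc, fun p a b c q hl => ?_, fun p a b c d q hl he => h2 ⟨p, a, b, c, d, q, hl, he⟩⟩
      exact not_or.1 fun h => h1 ⟨p, a, b, c, q, hl, h⟩
    have hhead : ∀ (p : List M) (a : M) (q q' : List M),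
        (p ++ a :: q).head? = (p ++ a :: q').head? := by
      intro p a q q'
      cases p <;> rfl
    have hlast : ∀ (p : List M) (a : M) (q : List M),
        (p ++ a :: q).getLast? = (a :: q).getLast? := by
      intro p a q
      simp [List.getLast?_append]
      cases h : (a :: q).getLast? with
      | none => simp at h
      | some b => rfl
    rcases h1 with ⟨p, a, b, c, q, rfl, rfl | h1⟩ | ⟨p, a, b, c, d, q, rfl, e, h1, h2, h3⟩
    · refine Contracts.backtrack (ih _ ?_ _ ?_ ?_ ?_ rfl)
      · simp
      · rw [List.isChain_split] at hc ⊢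
        exact ⟨hc.1, hc.2.of_cons.of_cons⟩
      · rw [← hh]
        exact hhead _ _ _ _
      · rw [← hl, hlast, hlast, List.getLast?_cons_cons, List.getLast?_cons_cons]
    · have hc' := hc
      rw [List.isChain_split] at hc
      refine Contracts.drop hc.2.rel hc.2.of_cons.rel h1 (ih _ ?_ _ ?_ ?_ ?_ rfl)
      · simp
      · rw [List.isChain_split]
        exact ⟨hc.1, List.IsChain.cons_cons h1 hc.2.of_cons.of_cons⟩
      · rw [← hh]
        exact hhead _ _ _ _
      · rw [← hl, hlast, hlast, List.getLast?_cons_cons, List.getLast?_cons_cons,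
          List.getLast?_cons_cons]
    · rw [List.isChain_split] at hc
      refine Contracts.shortcut h1 h2 h3 (ih _ ?_ _ ?_ ?_ ?_ rfl)
      · simp
      · rw [List.isChain_split]
        exact ⟨hc.1, .cons_cons h1.adj_left (.cons_cons h3.adj_right hc.2.of_cons.of_cons.of_cons)⟩
      · rw [← hh]
        exact hhead _ _ _ _
      · simp only [hlast, List.getLast?_cons_cons] at hl ⊢
        exact hl

end TreeLine
namespace TreeLine

open SidePoset

variable {M : Type u} [TreeLine M]

/-! ### The order tree of a line with sides -/

open Classical in
/-- The interval between two comparable points, traversed from `x` to `y`. -/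
noncomputable def seg (x y : M) (h : Adj x y) : Seg M :=
  if hlt : x < y then posSeg x y hlt else (posSeg y x (h.resolve_left hlt)).neg

theorem seg_of_lt {x y : M} (h : x < y) : seg x y (Or.inl h) = posSeg x y h := dif_pos h

theorem seg_of_gt {x y : M} (h : y < x) : seg x y (Or.inr h) = (posSeg y x h).neg :=
  dif_neg (lt_asymm h)

theorem seg_neg {x y : M} (h : Adj x y) : (seg x y h).neg = seg y x h.symm := by
  rcases h with h | h
  · rw [seg_of_lt h, seg_of_gt h]
  · rw [seg_of_lt h, seg_of_gt h]
    rfl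

theorem seg_ini {x y : M} (h : Adj x y) : (seg x y h).ini = x := by
  rcases h with h | h
  · rw [seg_of_lt h]; rfl
  · rw [seg_of_gt h]; rfl

theorem seg_fin {x y : M} (h : Adj x y) : (seg x y h).fin = y := by
  rcases h with h | h
  · rw [seg_of_lt h]; rfl
  · rw [seg_of_gt h]; rfl

theorem mem_seg {x y z : M} (h : Adj x y) :
    z ∈ (seg x y h).carrier ↔ z = x ∨ z = y ∨ Btw x z y := by
  have key : ∀ {x y : M}, x < y → (z ∈ Icc x y ↔ z = x ∨ z = y ∨ Btw x z y) := by
    intro x y h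
    constructor
    · rintro ⟨h1, h2⟩
      rcases h1.eq_or_lt with h3 | h3
      · exact Or.inl h3.symm
      rcases h2.eq_or_lt with h4 | h4
      · exact Or.inr (Or.inl h4)
      · exact Or.inr (Or.inr (Or.inl ⟨h3, h4⟩))
    · rintro (rfl | rfl | h3 | h3)
      · exact ⟨le_rfl, h.le⟩
      · exact ⟨h.le, le_rfl⟩
      · exact ⟨h3.1.le, h3.2.le⟩
      · exact absurd (h3.1.trans h3.2) (lt_asymm h)
  rcases h with h | h
  · rw [seg_of_lt h]
    exact key h
  · rw [seg_of_gt h]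
    refine (key h).trans ?_
    constructor
    · rintro (h | h | h)
      · exact Or.inr (Or.inl h)
      · exact Or.inl h
      · exact Or.inr (Or.inr h.symm)
    · rintro (h | h | h)
      · exact Or.inr (Or.inl h)
      · exact Or.inl h
      · exact Or.inr (Or.inr h.symm)

theorem seg_mem_segs {x y : M} (h : Adj x y) : seg x y h ∈ segs M := by
  rcases h with h | h
  · rw [seg_of_lt h]
    exact Or.inl (posSeg_mem _ _ _)
  · rw [seg_of_gt h]
    exact Or.inr (posSeg_mem _ _ h)

theorem exists_eq_seg {σ : Seg M} (h : σ ∈ segs M) : ∃ x y, ∃ h : Adj x y, σ = seg x y h := by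
  obtain ⟨a, b, hab, rfl | rfl⟩ := mem_segs.1 h
  · exact ⟨a, b, Or.inl hab, (seg_of_lt hab).symm⟩
  · exact ⟨b, a, Or.inr hab, (seg_of_gt hab).symm⟩

/-- A point between `x` and `y` divides the segment from `x` to `y`. -/
theorem isSubdivision_seg_append {x m y : M} (h : Btw x m y) {L L' : List (Seg M)}
    (hL : IsSubdivision (seg x m h.adj_left) L) (hL' : IsSubdivision (seg m y h.adj_right) L') :
    IsSubdivision (seg x y h.adj) (L ++ L') := by
  obtain ⟨h1, h2⟩ | ⟨h1, h2⟩ := h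
  · rw [seg_of_lt (h1.trans h2)]
    rw [seg_of_lt h1] at hL
    rw [seg_of_lt h2] at hL'
    have p : (posSeg x y (h1.trans h2)).le x m := ⟨le_rfl, h1.le, h2.le⟩
    have p' : (posSeg x y (h1.trans h2)).le m y := ⟨h1.le, h2.le, le_rfl⟩
    exact .split (posSeg x y (h1.trans h2)) m p h1.ne p' h2.ne L L'
      ((congrArg (IsSubdivision · L) (sub_posSeg _ x m p h1.ne)).mpr hL)
      ((congrArg (IsSubdivision · L') (sub_posSeg _ m y p' h2.ne)).mpr hL')
  · rw [seg_of_gt (h1.trans h2)]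
    rw [seg_of_gt h2] at hL
    rw [seg_of_gt h1] at hL'
    have p : (posSeg y x (h1.trans h2)).le m x := ⟨h1.le, h2.le, le_rfl⟩
    have p' : (posSeg y x (h1.trans h2)).le y m := ⟨le_rfl, h1.le, h2.le⟩
    exact .split (posSeg y x (h1.trans h2)).neg m p h2.ne' p' h1.ne' L L'
      ((congrArg (IsSubdivision · L) ((sub_neg (posSeg y x (h1.trans h2)) x m p h2.ne').trans
        (congrArg Seg.neg (sub_posSeg _ m x p h2.ne)))).mpr hL)
      ((congrArg (IsSubdivision · L') ((sub_neg (posSeg y x (h1.trans h2)) m y p' h1.ne').trans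
        (congrArg Seg.neg (sub_posSeg _ y m p' h1.ne)))).mpr hL')

open Classical in
/-- The segments of the path with the given vertices. -/
noncomputable def edges : List M → List (Seg M)
  | [] => []
  | [_] => []
  | x :: y :: l => (if h : Adj x y then [seg x y h] else []) ++ edges (y :: l)

theorem edges_cons {x y : M} (h : Adj x y) (l : List M) :
    edges (x :: y :: l) = seg x y h :: edges (y :: l) := by
  rw [edges, dif_pos h]
  rfl

theorem edges_append (p : List M) (a : M) (q : List M) :
    edges (p ++ a :: q) = edges (p ++ [a]) ++ edges (a :: q) := by
  induction p with
  | nil => rfl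
  | cons b p ih =>
    cases p with
    | nil => simp [edges]
    | cons c p =>
      simp only [List.cons_append, edges, List.append_assoc] at ih ⊢
      rw [ih]

/-- Paths of segments are given by their lists of vertices. -/
theorem exists_edges_of_isPath {x y : M} {w : List (Seg M)} (h : IsPath (segs M) x y w) :
    ∃ l, (x :: l).IsChain Adj ∧ (x :: l).getLast? = some y ∧ w = edges (x :: l) := by
  induction w generalizing x with
  | nil =>
    obtain rfl : x = y := h
    exact ⟨[], .singleton _, rfl, rfl⟩
  | cons σ w ih =>
    obtain ⟨hσ, hx, hw⟩ := h
    obtain ⟨a, b, hab, rfl⟩ := exists_eq_seg hσ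
    rw [seg_ini] at hx
    subst hx
    rw [seg_fin] at hw
    obtain ⟨l, h1, h2, rfl⟩ := ih hw
    exact ⟨b :: l, .cons_cons hab h1, by rwa [List.getLast?_cons_cons], (edges_cons hab l).symm⟩

theorem isChain_insertVertex {l : List M} (h : l.IsChain Adj) (m : M) :
    (insertVertex m l).IsChain Adj := by
  induction l with
  | nil => exact h
  | cons x l ih =>
    cases l with
    | nil => exact h
    | cons y l =>
      have h1 := ih h.of_cons
      obtain ⟨t, ht⟩ := exists_insertVertex_cons m y l
      rw [insertVertex]
      rw [ht] at h1 ⊢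
      by_cases hm : Btw x m y
      · rw [mid_of_btw hm]
        exact .cons_cons hm.adj_left (.cons_cons hm.adj_right h1)
      · rw [mid_of_not hm]
        exact .cons_cons h.rel h1

theorem exists_parts_insertVertex {l : List M} (h : l.IsChain Adj) (m : M)
    {parts : List (List (Seg M))}
    (hp : List.Forall₂ IsSubdivision (edges (insertVertex m l)) parts) :
    ∃ parts', List.Forall₂ IsSubdivision (edges l) parts' ∧ parts'.flatten = parts.flatten := by
  induction l generalizing parts with
  | nil => exact ⟨parts, hp, rfl⟩
  | cons x l ih =>
    cases l with
    | nil => exact ⟨parts, hp, rfl⟩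
    | cons y l =>
      obtain ⟨t, ht⟩ := exists_insertVertex_cons m y l
      rw [edges_cons h.rel]
      have ih := fun parts => ih h.of_cons (parts := parts)
      rw [insertVertex] at hp
      rw [ht] at hp ih
      by_cases hm : Btw x m y
      · rw [mid_of_btw hm, List.singleton_append, edges_cons hm.adj_left,
          edges_cons hm.adj_right] at hp
        obtain ⟨L, q, h1, hq, rfl⟩ := List.forall₂_cons_left_iff.1 hp
        obtain ⟨L', q', h2, hq', rfl⟩ := List.forall₂_cons_left_iff.1 hq
        obtain ⟨r, hr, hr'⟩ := ih _ hq'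
        refine ⟨(L ++ L') :: r, .cons (isSubdivision_seg_append hm h1 h2) hr, ?_⟩
        simp [hr']
      · rw [mid_of_not hm, List.nil_append, edges_cons h.rel] at hp
        obtain ⟨L, q, h1, hq, rfl⟩ := List.forall₂_cons_left_iff.1 hp
        obtain ⟨r, hr, hr'⟩ := ih _ hq
        exact ⟨L :: r, .cons h1 hr, by simp [hr']⟩

/-- Inserting vertices subdivides the segments of the path. -/
theorem exists_parts (F l : List M) (h : l.IsChain Adj) :
    (F.foldl (fun l m => insertVertex m l) l).IsChain Adj ∧
    ∃ parts, List.Forall₂ IsSubdivision (edges l) parts ∧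
      parts.flatten = edges (F.foldl (fun l m => insertVertex m l) l) := by
  induction F generalizing l with
  | nil =>
    refine ⟨h, (edges l).map fun σ => [σ], ?_, ?_⟩
    · rw [List.forall₂_map_right_iff]
      exact List.forall₂_same.2 fun σ _ => .single σ
    · rw [List.foldl_nil]
      generalize edges l = w
      induction w with
      | nil => rfl
      | cons σ w ih => rw [List.map_cons, List.flatten_cons, ih, List.singleton_append]
  | cons m F ih =>
    obtain ⟨h1, parts, h2, h3⟩ := ih _ (isChain_insertVertex h m)
    obtain ⟨parts', h4, h5⟩ := exists_parts_insertVertex h m h2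
    exact ⟨h1, parts', h4, h5.trans h3⟩

theorem cancel_edges {l v : List M} (hc : l.IsChain Adj) (h : Backtrack l v) :
    v.IsChain Adj ∧ Cancel (edges l) (edges v) := by
  obtain ⟨p, a, b, q, rfl, rfl⟩ := h
  rw [List.isChain_split] at hc ⊢
  have hab : Adj a b := hc.2.rel
  refine ⟨⟨hc.1, hc.2.of_cons.of_cons⟩, edges (p ++ [a]), edges (a :: q), seg a b hab, ?_,
    edges_append p a q⟩
  rw [edges_append, edges_cons hab, edges_cons hab.symm, seg_neg]

theorem reflTransGen_cancel {l v : List M} (hc : l.IsChain Adj)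
    (h : Relation.ReflTransGen Backtrack l v) :
    v.IsChain Adj ∧ Relation.ReflTransGen Cancel (edges l) (edges v) := by
  induction h with
  | refl => exact ⟨hc, .refl⟩
  | tail _ h ih =>
    obtain ⟨h1, h2⟩ := cancel_edges ih.1 h
    exact ⟨h1, ih.2.tail h2⟩

theorem isOrderTree : IsOrderTree M (segs M) where
  neg_mem := by
    rintro σ (h | h)
    · exact Or.inr h
    · exact Or.inl h
  sub_mem := by
    rintro σ (h | h) a b hab hne
    · exact Or.inl (sub_mem_posSegs h a b hab hne)
    · refine Or.inr ?_
      exact (congrArg (· ∈ posSegs M) (congrArg Seg.neg (sub_neg σ.neg a b hab hne))).mpr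
        (sub_mem_posSegs h b a hab hne.symm)
  joined := joined
  cyclic x w hw := by
    obtain ⟨l, hc, hl, rfl⟩ := exists_edges_of_isPath hw
    obtain ⟨F, hF⟩ := contracts_of_closed x (x :: l) hc rfl hl
    obtain ⟨h1, parts, h2, h3⟩ := exists_parts F (x :: l) hc
    refine ⟨parts, h2, ?_⟩
    rw [h3]
    exact (reflTransGen_cancel h1 hF).2
  concat_mem _ hσ _ hτ := concat_segs hσ hτ
  real := by
    rintro σ (⟨a, b, h, rfl⟩ | ⟨a, b, h, h1⟩)
    · obtain ⟨f, -, hf⟩ := exists_isParam h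
      exact ⟨f, hf⟩
    · obtain ⟨f, -, hf⟩ := exists_isParam h
      obtain rfl : σ = (posSeg a b h).neg := congrArg Seg.neg h1
      exact ⟨_, Seg.isParam_neg hf⟩
  countable_union := exists_countable_segs
  isOpen_iff := isOpen_iff_isRelOpen

/-! ### Sides and connectedness -/

/-- `a` and `b` are equal or comparable, and the interval between them does not contain `z`. -/
def Step (z a b : M) : Prop := a ≠ z ∧ b ≠ z ∧ (a = b ∨ Adj a b) ∧ ¬ Btw a z b

theorem Step.symm {z a b : M} (h : Step z a b) : Step z b a :=
  ⟨h.2.1, h.1, h.2.2.1.imp Eq.symm Adj.symm, fun h' => h.2.2.2 h'.symm⟩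

theorem Step.up_iff {z a b : M} (h : Step z a b) : up z a ↔ up z b := by
  rcases h.2.2.1 with rfl | h1
  · rfl
  · exact up_iff_of_adj h1 h.1.symm h.2.1.symm h.2.2.2

theorem reflTransGen_symm {z a b : M} (h : Relation.ReflTransGen (Step z) a b) :
    Relation.ReflTransGen (Step z) b a := by
  induction h with
  | refl => exact .refl
  | tail _ h ih => exact .head h.symm ih

/-- Every point other than `z` is joined, avoiding `z`, to a point next to `z`. -/
theorem exists_adj_reflTransGen {x z : M} (hx : x ≠ z) :
    ∃ t, Adj z t ∧ Relation.ReflTransGen (Step z) x t := by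
  have key : ∀ w, (∃ t, Adj z t ∧ Relation.ReflTransGen (Step z) x t) ∨
      (w ≠ z ∧ Relation.ReflTransGen (Step z) x w) := by
    intro w
    induction conn x w with
    | refl => exact Or.inr ⟨hx, .refl⟩
    | @tail a b _ hab ih =>
      rcases ih with ih | ⟨h1, h2⟩
      · exact Or.inl ih
      rcases eq_or_ne a b with rfl | hne
      · exact Or.inr ⟨h1, h2⟩
      have hadj : Adj a b := hab.imp (fun h => lt_of_le_of_ne h hne)
        (fun h => lt_of_le_of_ne h hne.symm)
      by_cases hb : b = z
      · subst hb
        exact Or.inl ⟨a, hadj.symm, h2⟩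
      by_cases hz : Btw a z b
      · exact Or.inl ⟨a, hz.adj_left.symm, h2⟩
      · exact Or.inr ⟨hb, h2.tail ⟨h1, hb, Or.inr hadj, hz⟩⟩
  rcases key z with h | h
  · exact h
  · exact absurd rfl h.1

theorem step_of_gt {z s t : M} (hs : z < s) (ht : z < t) :
    Relation.ReflTransGen (Step z) s t := by
  obtain ⟨c, hc, h1, h2⟩ := directed_gt s t z hs ht
  refine .tail (.single ⟨hs.ne', hc.ne', Or.inr (Or.inr h1), ?_⟩)
    ⟨hc.ne', ht.ne', Or.inr (Or.inl h2), ?_⟩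
  · rintro (h | h)
    · exact lt_asymm hs h.1
    · exact lt_asymm hc h.1
  · rintro (h | h)
    · exact lt_asymm hc h.1
    · exact lt_asymm ht h.1

theorem step_of_lt {z s t : M} (hs : s < z) (ht : t < z) :
    Relation.ReflTransGen (Step z) s t := by
  obtain ⟨c, hc, h1, h2⟩ := directed_lt s t z hs ht
  refine .tail (.single ⟨hs.ne, hc.ne, Or.inr (Or.inl h1), ?_⟩)
    ⟨hc.ne, ht.ne, Or.inr (Or.inr h2), ?_⟩
  · rintro (h | h)
    · exact lt_asymm hc h.2
    · exact lt_asymm hs h.2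
  · rintro (h | h)
    · exact lt_asymm ht h.2
    · exact lt_asymm hc h.2

/-- The sides of `z` are the two classes of points that can be joined without meeting `z`. -/
theorem reflTransGen_step_iff {x y z : M} (hx : x ≠ z) (hy : y ≠ z) :
    Relation.ReflTransGen (Step z) x y ↔ (up z x ↔ up z y) := by
  have key : ∀ {x s : M}, Relation.ReflTransGen (Step z) x s → (up z x ↔ up z s) := by
    intro x s h
    induction h with
    | refl => rfl
    | tail _ h ih => exact ih.trans h.up_iff
  constructor
  · exact key
  · intro h
    obtain ⟨s, hs, hxs⟩ := exists_adj_reflTransGen hx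
    obtain ⟨t, ht, hyt⟩ := exists_adj_reflTransGen hy
    have h1 := (key hxs).symm.trans (h.trans (key hyt))
    refine hxs.trans (.trans ?_ (reflTransGen_symm hyt))
    rcases hs with hs | hs <;> rcases ht with ht | ht
    · exact step_of_gt hs ht
    · exact absurd (h1.1 (up_of_lt _ _ hs)) (not_up_of_lt _ _ ht)
    · exact absurd (h1.2 (up_of_lt _ _ ht)) (not_up_of_lt _ _ hs)
    · exact step_of_lt hs ht

/-- The sides are determined by the order. -/
theorem up_iff_exists {z x : M} : up z x ↔
    x ≠ z ∧ ∃ t, z < t ∧ Relation.ReflTransGen (Step z) x t := by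
  constructor
  · intro h
    have hx := (up_ne h).symm
    obtain ⟨t, ht⟩ := exists_gt z
    exact ⟨hx, t, ht, (reflTransGen_step_iff hx ht.ne').2 (iff_of_true h (up_of_lt _ _ ht))⟩
  · rintro ⟨hx, t, ht, h⟩
    exact ((reflTransGen_step_iff hx ht.ne').1 h).2 (up_of_lt _ _ ht)

/-- The ends of a path that avoids `z` lie on the same side of `z`. -/
theorem up_iff_of_notMem_pathSet {z x : M} {l : List M} (h : (x :: l).IsChain Adj)
    (hz : z ∉ pathSet x (edges (x :: l))) {y : M} (hy : (x :: l).getLast? = some y) :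
    y ≠ z ∧ x ≠ z ∧ (up z x ↔ up z y) := by
  induction l generalizing x with
  | nil =>
    obtain rfl : x = y := by simpa using hy
    have : x ≠ z := fun h => hz (Or.inl h.symm)
    exact ⟨this, this, Iff.rfl⟩
  | cons w l ih =>
    rw [edges_cons h.rel] at hz
    have h1 : z ∉ (seg x w h.rel).carrier := fun h1 => hz (Or.inr ⟨_, List.mem_cons_self, h1⟩)
    rw [mem_seg] at h1
    obtain ⟨h2, h3⟩ := not_or.1 h1
    obtain ⟨h3, h4⟩ := not_or.1 h3
    obtain ⟨h5, h6, h7⟩ := ih h.of_cons (by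
      rintro (h5 | ⟨σ, hσ, h5⟩)
      · exact h3 h5
      · exact hz (Or.inr ⟨σ, List.mem_cons_of_mem _ hσ, h5⟩))
        (by rwa [List.getLast?_cons_cons] at hy)
    exact ⟨h5, Ne.symm h2, (up_iff_of_adj h.rel h2 h3 h4).trans h7⟩

/-- A chain that avoids `z` gives a path that avoids `z`. -/
theorem exists_path_of_step {x y z : M} (hx : x ≠ z) (h : Relation.ReflTransGen (Step z) x y) :
    ∃ w, IsPath (segs M) x y w ∧ z ∉ pathSet x w := by
  induction h with
  | refl =>
    refine ⟨[], rfl, ?_⟩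
    rintro (h | ⟨σ, hσ, -⟩)
    · exact hx h.symm
    · cases hσ
  | @tail a b _ h ih =>
    obtain ⟨w, hw, hz⟩ := ih
    rcases h.2.2.1 with rfl | h1
    · exact ⟨w, hw, hz⟩
    · refine ⟨w ++ [seg a b h1], isPath_append hw ⟨seg_mem_segs _, seg_ini _, seg_fin _⟩, ?_⟩
      rintro (h2 | ⟨σ, hσ, h2⟩)
      · exact hx h2.symm
      · rcases List.mem_append.1 hσ with hσ | hσ
        · exact hz (Or.inr ⟨σ, hσ, h2⟩)
        · obtain rfl := List.mem_singleton.1 hσ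
          rw [mem_seg] at h2
          rcases h2 with h2 | h2 | h2
          · exact h.1 h2.symm
          · exact h.2.1 h2.symm
          · exact h.2.2.2 h2

/-- The geodesic spine consists of the end points and the points that separate them. -/
theorem spine_eq_hull (x y : M) : spine (segs M) x y = Hull up x y := by
  ext z
  constructor
  · intro hz
    by_contra hcon
    obtain ⟨hx, h1⟩ := not_or.1 hcon
    obtain ⟨hy, h1⟩ := not_or.1 h1
    have h2 : up z x ↔ up z y := by
      by_contra h2
      exact h1 ⟨hx, hy, h2⟩
    obtain ⟨w, hw, hzw⟩ := exists_path_of_step (Ne.symm hx)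
      ((reflTransGen_step_iff (Ne.symm hx) (Ne.symm hy)).2 h2)
    exact hzw (hz w hw)
  · intro hz w hw
    obtain ⟨l, hc, hl, rfl⟩ := exists_edges_of_isPath hw
    by_contra hcon
    obtain ⟨h1, h2, h3⟩ := up_iff_of_notMem_pathSet hc hcon hl
    rcases hz with hz | hz | hz
    · exact h2 hz.symm
    · exact h1 hz.symm
    · exact hz.2.2 h3

end TreeLine
namespace TreeLine

open SidePoset

variable {M : Type u} [TreeLine M]

/-! ### The oriented manifold and its embedded intervals -/

/-- The sides of `z` are open and closed in the complement of `z`. -/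
theorem eventually_up_iff {z n : M} (h : n ≠ z) : ∀ᶠ m in 𝓝 n, m ≠ z ∧ (up z n ↔ up z m) := by
  obtain ⟨a, b, ha, hb, hz⟩ : ∃ a b, a < n ∧ n < b ∧ z ∉ Ioo a b := by
    obtain ⟨a, ha⟩ := exists_lt n
    obtain ⟨b, hb⟩ := exists_gt n
    by_cases hz : z ∈ Ioo a b
    · rcases le_or_le_of_mem_Icc (Ioo_subset_Icc_self hz) ⟨ha.le, hb.le⟩ with h1 | h1
      · exact ⟨z, b, lt_of_le_of_ne h1 h.symm, hb, fun h => lt_irrefl _ h.1⟩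
      · exact ⟨a, z, ha, lt_of_le_of_ne h1 h, fun h => lt_irrefl _ h.2⟩
    · exact ⟨a, b, ha, hb, hz⟩
  filter_upwards [Ioo_mem_nhds ha hb] with m hm
  have hmz : m ≠ z := by
    rintro rfl
    exact hz hm
  refine ⟨hmz, ?_⟩
  rcases eq_or_ne n m with rfl | hne
  · rfl
  have hadj : Adj n m := (le_or_le_of_mem_Icc ⟨ha.le, hb.le⟩ (Ioo_subset_Icc_self hm)).imp
    (fun h => lt_of_le_of_ne h hne) (fun h => lt_of_le_of_ne h hne.symm)
  refine up_iff_of_adj hadj h.symm hmz.symm fun hb' => hz ?_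
  rcases hb' with h1 | h1
  · exact ⟨ha.trans h1.1, h1.2.trans hm.2⟩
  · exact ⟨hm.1.trans h1.1, h1.2.trans hb⟩

/-- A connected set that avoids `z` lies on one side of `z`. -/
theorem up_iff_of_isPreconnected {z x y : M} {C : Set M} (hC : IsPreconnected C) (hz : z ∉ C)
    (hx : x ∈ C) (hy : y ∈ C) : up z x ↔ up z y := by
  have hne : ∀ {n}, n ∈ C → n ≠ z := fun hn h => hz (h ▸ hn)
  by_contra hcon
  have h1 : IsOpen {n | n ≠ z ∧ up z n} := isOpen_iff_mem_nhds.2 fun n hn => by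
    filter_upwards [eventually_up_iff hn.1] with m hm
    exact ⟨hm.1, hm.2.1 hn.2⟩
  have h2 : IsOpen {n | n ≠ z ∧ ¬ up z n} := isOpen_iff_mem_nhds.2 fun n hn => by
    filter_upwards [eventually_up_iff hn.1] with m hm
    exact ⟨hm.1, fun h => hn.2 (hm.2.2 h)⟩
  have hcov : C ⊆ {n | n ≠ z ∧ up z n} ∪ {n | n ≠ z ∧ ¬ up z n} := fun n hn =>
    (em (up z n)).imp (fun h => ⟨hne hn, h⟩) (fun h => ⟨hne hn, h⟩)
  have h3 : (C ∩ {n | n ≠ z ∧ up z n}).Nonempty ∧ (C ∩ {n | n ≠ z ∧ ¬ up z n}).Nonempty := by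
    by_cases hux : up z x
    · exact ⟨⟨x, hx, hne hx, hux⟩, ⟨y, hy, hne hy, fun h => hcon (iff_of_true hux h)⟩⟩
    · refine ⟨⟨y, hy, hne hy, ?_⟩, ⟨x, hx, hne hx, hux⟩⟩
      by_contra h
      exact hcon (iff_of_false hux h)
  obtain ⟨w, -, hw, hw'⟩ := hC _ _ h1 h2 hcov h3.1 h3.2
  exact hw'.2 hw.2

theorem isPreconnected_Icc {x y : M} (hxy : x ≤ y) : IsPreconnected (Icc x y) := by
  obtain ⟨φ, a, b, h, hx, hy⟩ := chart x y hxy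
  obtain ⟨s, rfl⟩ : x ∈ range φ := h ▸ hx
  obtain ⟨t, rfl⟩ : y ∈ range φ := h ▸ hy
  have : Icc (φ s) (φ t) = φ '' Icc s t := by
    ext w
    constructor
    · rintro ⟨h1, h2⟩
      obtain ⟨r, rfl⟩ : w ∈ range φ := h ▸ ⟨hx.1.trans_le h1, h2.trans_lt hy.2⟩
      exact ⟨r, ⟨φ.le_iff_le.1 h1, φ.le_iff_le.1 h2⟩, rfl⟩
    · rintro ⟨r, hr, rfl⟩
      exact ⟨φ.le_iff_le.2 hr.1, φ.le_iff_le.2 hr.2⟩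
  rw [this]
  exact _root_.isPreconnected_Icc.image _ (isOpenEmbedding_of_range h).continuous.continuousOn

theorem Step.connectedComponentIn_eq {z a b : M} (h : Step z a b) :
    connectedComponentIn {z}ᶜ a = connectedComponentIn {z}ᶜ b := by
  have key : ∀ {a b : M}, Step z a b → a ≤ b →
      connectedComponentIn {z}ᶜ a = connectedComponentIn {z}ᶜ b := by
    intro a b h hab
    refine _root_.connectedComponentIn_eq ?_
    refine (isPreconnected_Icc hab).subset_connectedComponentIn (left_mem_Icc.2 hab) ?_
      (right_mem_Icc.2 hab)
    rintro w hw rfl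
    exact h.2.2.2 (Or.inl ⟨lt_of_le_of_ne hw.1 h.1, lt_of_le_of_ne hw.2 h.2.1.symm⟩)
  rcases h.2.2.1 with rfl | h1 | h1
  · rfl
  · exact key h h1.le
  · exact (key h.symm h1.le).symm

theorem secondCountable : SecondCountableTopology M := by
  obtain ⟨D, hD, hdense⟩ := countable_dense (M := M)
  have hb : TopologicalSpace.IsTopologicalBasis ((fun p : M × M => Ioo p.1 p.2) '' D ×ˢ D) := by
    refine TopologicalSpace.isTopologicalBasis_of_isOpen_of_nhds ?_ fun m U hm hU => ?_
    · rintro _ ⟨p, -, rfl⟩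
      exact isOpen_Ioo _ _
    · obtain ⟨a, b, ha, hb, hab⟩ := (isOpen_iff U).1 hU m hm
      obtain ⟨c, hc, h1, h2⟩ := hdense a m ha
      obtain ⟨d, hd, h3, h4⟩ := hdense m b hb
      exact ⟨_, ⟨(c, d), ⟨hc, hd⟩, rfl⟩, ⟨h2, h3⟩,
        fun x hx => hab ⟨h1.trans hx.1, hx.2.trans h4⟩⟩
  exact hb.secondCountableTopology ((hD.prod hD).image _)

/-- Order embeddings of `ℝ` induce the same orientation, also after an order automorphism. -/
theorem sameOrientation_of_strictMono {φ ψ : ℝ → M} (hφ : StrictMono φ) (hψ : StrictMono ψ) :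
    SameOrientation φ ψ := by
  refine fun s t _ => ⟨univ, Filter.univ_mem, fun s₁ _ s₂ _ h t₁ t₂ h1 h2 => ?_⟩
  have h3 := hφ h
  rw [h1, h2] at h3
  exact hψ.lt_iff_lt.1 h3

/-- The atlas of all order embeddings of `ℝ` onto open intervals. -/
def atlas (M : Type u) [TreeLine M] : OrientedAtlas M where
  secondCountable := secondCountable
  charts := {f | ∃ (φ : ℝ ↪o M) (a b : M), range φ = Ioo a b ∧ f = φ}
  isOpenEmbedding := by
    rintro _ ⟨φ, a, b, h, rfl⟩
    exact isOpenEmbedding_of_range h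
  cover x := by
    obtain ⟨φ, a, b, h, hx, -⟩ := chart x x le_rfl
    exact ⟨φ, ⟨φ, a, b, h, rfl⟩, h ▸ hx⟩
  sameOrientation := by
    rintro _ ⟨φ, a, b, h, rfl⟩ _ ⟨ψ, c, d, h', rfl⟩
    exact sameOrientation_of_strictMono φ.strictMono ψ.strictMono

/-- The component above `x` is the upper side of `x`: components lie on one side, and all points of
a side are joined by intervals that avoid `x`. -/
theorem plus_eq (x : M) : (atlas M).plus x = {y | up x y} := by
  ext y
  constructor
  · rintro ⟨_, ⟨φ, a, b, h, rfl⟩, s, t, hst, rfl, hy⟩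
    have hlt : φ s < φ t := φ.lt_iff_lt.2 hst
    have h1 : φ t ∈ ({φ s}ᶜ : Set M) := hlt.ne'
    refine (up_iff_of_isPreconnected isPreconnected_connectedComponentIn
      (fun h => connectedComponentIn_subset ({φ s}ᶜ) (φ t) h rfl)
      (mem_connectedComponentIn h1) hy).1 (up_of_lt _ _ hlt)
  · intro hy
    obtain ⟨φ, a, b, h, hx, -⟩ := chart x x le_rfl
    obtain ⟨s, hs⟩ : x ∈ range φ := h ▸ hx
    refine ⟨φ, ⟨φ, a, b, h, rfl⟩, s, s + 1, lt_add_one s, hs, ?_⟩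
    have hlt : x < φ (s + 1) := hs ▸ φ.lt_iff_lt.2 (lt_add_one s)
    have hyx : y ≠ x := (up_ne hy).symm
    have h1 : Relation.ReflTransGen (Step x) y (φ (s + 1)) :=
      (reflTransGen_step_iff hyx hlt.ne').2 (iff_of_true hy (up_of_lt _ _ hlt))
    have h2 : ∀ {w}, Relation.ReflTransGen (Step x) y w →
        connectedComponentIn {x}ᶜ y = connectedComponentIn {x}ᶜ w := by
      intro w h
      induction h with
      | refl => rfl
      | tail _ h ih => exact ih.trans h.connectedComponentIn_eq
    rw [← h2 h1]
    exact mem_connectedComponentIn hyx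

/-- The order of the manifold in terms of its sides. -/
theorem atlas_le_iff {x y : M} : (atlas M).le x y ↔ x = y ∨ (up x y ∧ ¬ up y x) := by
  unfold OrientedAtlas.le
  rw [plus_eq, plus_eq]
  constructor
  · intro h
    rcases eq_or_ne x y with hxy | hne
    · exact Or.inl hxy
    have hyx : ¬ up y x := fun h' => up_irrefl x (h h')
    refine Or.inr ⟨?_, hyx⟩
    obtain ⟨z, hz⟩ := exists_gt y
    have h1 : up x z := h (up_of_lt _ _ hz)
    refine (up_iff_up y z x hz hne (up_ne h1) fun h2 => hyx (up_of_lt _ _ h2.1)).2 h1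
  · rintro (rfl | ⟨h1, h2⟩) z hz
    · exact hz
    · have hz : up y z := hz
      have hzx : x ≠ z := by
        rintro rfl
        exact h2 hz
      rcases isTreeSide.tree x y z (up_ne h1) hzx (up_ne hz) with h | h
      · exact h.1 h1
      · exact absurd (h.2 hz) h2

section Arcs

/-- A continuous injective path in `M` is locally strictly monotone. -/
theorem strictMonoOn_or_strictAntiOn_of_subset {F : ℝ → M} {a b : ℝ} (hab : a ≤ b)
    (hF : ContinuousOn F (Icc a b)) (hinj : InjOn F (Icc a b)) {c d : M}
    (hsub : F '' Icc a b ⊆ Ioo c d) : StrictMonoOn F (Icc a b) ∨ StrictAntiOn F (Icc a b) := by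
  have hcd : c ≤ d := by
    have := hsub ⟨a, left_mem_Icc.2 hab, rfl⟩
    exact (this.1.trans this.2).le
  have hFa := hsub ⟨a, left_mem_Icc.2 hab, rfl⟩
  obtain ⟨φ, c', d', h, hc, hd⟩ := chart c d hcd
  have hsub' : ∀ t ∈ Icc a b, F t ∈ range φ := fun t ht => by
    have := hsub ⟨t, ht, rfl⟩
    exact h ▸ ⟨hc.1.trans this.1, this.2.trans hd.2⟩
  have hinv : ∀ t ∈ Icc a b, φ (Function.invFun φ (F t)) = F t := fun t ht =>
    Function.invFun_eq (hsub' t ht)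
  have h1 : ContinuousOn (fun t => Function.invFun φ (F t)) (Icc a b) := by
    rw [(isOpenEmbedding_of_range h).isInducing.continuousOn_iff]
    exact hF.congr hinv
  have h2 : InjOn (fun t => Function.invFun φ (F t)) (Icc a b) := by
    intro s hs t ht hst
    refine hinj hs ht ?_
    rw [← hinv s hs, ← hinv t ht]
    exact congrArg φ hst
  refine (h1.strictMonoOn_of_injOn_Icc' hab h2).imp (fun h3 s hs t ht hst => ?_)
    (fun h3 s hs t ht hst => ?_)
  · rw [← hinv s hs, ← hinv t ht]
    exact φ.lt_iff_lt.2 (h3 hs ht hst)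
  · rw [← hinv s hs, ← hinv t ht]
    exact φ.lt_iff_lt.2 (h3 hs ht hst)

/-- Strict monotonicity extends over overlapping intervals. -/
theorem strictMonoOn_or_strictAntiOn_union {F : ℝ → M} {a b c d : ℝ} (hab : a ≤ b) (hbc : b < c)
    (hcd : c ≤ d) (h1 : StrictMonoOn F (Icc a c) ∨ StrictAntiOn F (Icc a c))
    (h2 : StrictMonoOn F (Icc b d) ∨ StrictAntiOn F (Icc b d)) :
    StrictMonoOn F (Icc a d) ∨ StrictAntiOn F (Icc a d) := by
  have hb1 : b ∈ Icc a c := ⟨hab, hbc.le⟩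
  have hc1 : c ∈ Icc a c := ⟨hab.trans hbc.le, le_rfl⟩
  have hb2 : b ∈ Icc b d := ⟨le_rfl, hbc.le.trans hcd⟩
  have hc2 : c ∈ Icc b d := ⟨hbc.le, hcd⟩
  have hsub : Icc c d ⊆ Icc b d := Icc_subset_Icc_left hbc.le
  rw [← Icc_union_Icc_eq_Icc hc1.1 hcd]
  have hg : IsGreatest (Icc a c) c := isGreatest_Icc hc1.1
  have hl : IsLeast (Icc c d) c := isLeast_Icc hcd
  rcases h1 with h1 | h1 <;> rcases h2 with h2 | h2
  · exact Or.inl (h1.union (h2.mono hsub) hg hl)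
  · exact absurd (h1 hb1 hc1 hbc) (lt_asymm (h2 hb2 hc2 hbc))
  · exact absurd (h1 hb1 hc1 hbc) (lt_asymm (h2 hb2 hc2 hbc))
  · exact Or.inr (h1.union (h2.mono hsub) hg hl)

/-- A continuous injective path is strictly monotone.  It is so on short intervals, by a Lebesgue
number for a cover by intervals of `M`, and this extends along `[0, 1]`. -/
theorem strictMonoOn_or_strictAntiOn {F : ℝ → M} (hF : ContinuousOn F (Icc 0 1))
    (hinj : InjOn F (Icc 0 1)) : StrictMonoOn F (Icc 0 1) ∨ StrictAntiOn F (Icc 0 1) := by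
  obtain ⟨δ, hδ, hloc⟩ : ∃ δ > 0, ∀ a b, 0 ≤ a → a ≤ b → b ≤ 1 → b - a < δ →
      StrictMonoOn F (Icc a b) ∨ StrictAntiOn F (Icc a b) := by
    have hopen : ∀ m : M, ∃ c d : M, m ∈ Ioo c d := fun m => by
      obtain ⟨a, ha⟩ := exists_lt m
      obtain ⟨b, hb⟩ := exists_gt m
      exact ⟨a, b, ha, hb⟩
    choose c d hcd using hopen
    have hU : ∀ t : Icc (0 : ℝ) 1, ∃ U : Set ℝ, IsOpen U ∧
        Icc 0 1 ∩ F ⁻¹' Ioo (c (F t)) (d (F t)) = Icc 0 1 ∩ U := fun t =>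
      (continuousOn_iff'.1 hF _ (isOpen_Ioo (c (F t)) (d (F t)))).imp fun U hU =>
        ⟨hU.1, by rw [inter_comm, hU.2, inter_comm]⟩
    choose U hUo hU using hU
    obtain ⟨δ, hδ, hball⟩ := lebesgue_number_lemma_of_metric (isCompact_Icc (a := (0 : ℝ)) (b := 1))
      hUo (fun t ht => mem_iUnion.2 ⟨⟨t, ht⟩, by
        have : t ∈ Icc 0 1 ∩ F ⁻¹' Ioo (c (F t)) (d (F t)) := ⟨ht, hcd _⟩
        rw [hU ⟨t, ht⟩] at this
        exact this.2⟩)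
    refine ⟨δ, hδ, fun a b ha hab hb hlt => ?_⟩
    have hsub : Icc a b ⊆ Icc 0 1 := Icc_subset_Icc ha hb
    obtain ⟨i, hi⟩ := hball a ⟨ha, hab.trans hb⟩
    refine strictMonoOn_or_strictAntiOn_of_subset hab (hF.mono hsub) (hinj.mono hsub)
      (c := c (F i)) (d := d (F i)) ?_
    rintro _ ⟨t, ht, rfl⟩
    have h1 : t ∈ Icc 0 1 ∩ U i := ⟨hsub ht, hi (by
      rw [Metric.mem_ball, Real.dist_eq, abs_of_nonneg (sub_nonneg.2 ht.1)]
      linarith [ht.2])⟩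
    rw [← hU i] at h1
    exact h1.2
  have key : ∀ (n : ℕ) (b : ℝ), 0 ≤ b → b ≤ 1 → b ≤ (n + 1) * (δ / 2) →
      StrictMonoOn F (Icc 0 b) ∨ StrictAntiOn F (Icc 0 b) := by
    intro n
    induction n with
    | zero =>
      intro b h0 h1 hb
      refine hloc 0 b le_rfl h0 h1 ?_
      have : b ≤ δ / 2 := by simpa using hb
      linarith
    | succ n ih =>
      intro b h0 h1 hb
      push_cast at hb
      by_cases hbδ : b < δ
      · exact hloc 0 b le_rfl h0 h1 (by linarith)
      · have h2 : δ ≤ b := not_lt.1 hbδ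
        refine strictMonoOn_or_strictAntiOn_union (b := b - 3 * δ / 4) (c := b - δ / 2)
          (by linarith) (by linarith) (by linarith) (ih _ (by linarith) (by linarith)
          (by linarith)) (hloc _ _ (by linarith) (by linarith) h1 (by linarith))
  obtain ⟨n, hn⟩ := exists_nat_gt (1 / (δ / 2))
  refine key n 1 zero_le_one le_rfl ?_
  rw [div_lt_iff₀ (by linarith)] at hn
  linarith

/-- A strictly increasing continuous path runs through the whole interval between its ends. -/
theorem eq_posSeg {σ : Seg M} {f : Icc (0 : ℝ) 1 → M} (hf : Continuous f) (hmono : StrictMono f)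
    (hσ : σ.IsParam f) : σ = posSeg (f 0) (f 1) (hmono zero_lt_one) := by
  have hc : σ.carrier = Icc (f 0) (f 1) := by
    rw [← hσ.1]
    apply Subset.antisymm
    · rintro _ ⟨t, rfl⟩
      exact ⟨hmono.monotone t.2.1, hmono.monotone t.2.2⟩
    · rintro z ⟨hz0, hz1⟩
      by_contra hz
      have h0 : f 0 ≠ z := fun h => hz ⟨0, h⟩
      have h1 : z ≠ f 1 := fun h => hz ⟨1, h.symm⟩
      exact (sep_of_btw (Or.inl ⟨lt_of_le_of_ne hz0 h0, lt_of_le_of_ne hz1 h1⟩)).2.2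
        (up_iff_of_isPreconnected (isPreconnected_range hf) hz (mem_range_self _)
          (mem_range_self _))
  have hle : ∀ s t, σ.le (f s) (f t) ↔ f s ≤ f t := fun s t =>
    (hσ.2 s t).symm.trans hmono.le_iff_le.symm
  have hmem : ∀ x ∈ σ.carrier, ∃ t, f t = x := fun x hx => by
    rw [← hσ.1] at hx
    exact hx
  refine Seg.ext_of_le (fun x => by rw [hc]; rfl) (fun x y => ?_) ?_ ?_
  · constructor
    · intro h
      have h1 := σ.mem_of_le _ _ h
      obtain ⟨s, rfl⟩ := hmem _ h1.1
      obtain ⟨t, rfl⟩ := hmem _ h1.2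
      rw [hc] at h1
      exact ⟨h1.1.1, (hle s t).1 h, h1.2.2⟩
    · rintro ⟨h1, h2, h3⟩
      obtain ⟨s, rfl⟩ := hmem x (hc ▸ ⟨h1, h2.trans h3⟩)
      obtain ⟨t, rfl⟩ := hmem y (hc ▸ ⟨h1.trans h2, h3⟩)
      exact (hle s t).2 h2
  · obtain ⟨s, hs⟩ := hmem _ σ.ini_mem
    have h0 : f 0 ∈ σ.carrier := hσ.1 ▸ mem_range_self 0
    refine σ.le_antisymm _ _ (σ.ini_le _ h0) ?_
    rw [← hs]
    exact (hσ.2 0 s).1 s.2.1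
  · obtain ⟨s, hs⟩ := hmem _ σ.fin_mem
    have h1 : f 1 ∈ σ.carrier := hσ.1 ▸ mem_range_self 1
    refine σ.le_antisymm _ _ ?_ (σ.le_fin _ h1)
    rw [← hs]
    exact (hσ.2 s 1).1 s.2.2

/-- The embedded compact intervals of the manifold are the intervals of the order. -/
theorem arcs_eq_segs : arcs M = segs M := by
  apply Subset.antisymm
  · rintro σ ⟨f, hf, hσ⟩
    have hF : ContinuousOn (IccExtend zero_le_one f) (Icc 0 1) :=
      hf.continuous.Icc_extend'.continuousOn
    have hval : ∀ t (ht : t ∈ Icc (0 : ℝ) 1), IccExtend zero_le_one f t = f ⟨t, ht⟩ := fun t ht =>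
      IccExtend_of_mem _ _ ht
    have hinj : InjOn (IccExtend zero_le_one f) (Icc 0 1) := fun s hs t ht hst => by
      rw [hval s hs, hval t ht] at hst
      exact congrArg Subtype.val (hf.injective hst)
    rcases strictMonoOn_or_strictAntiOn hF hinj with h | h
    · have hmono : StrictMono f := fun s t hst => by
        have := h s.2 t.2 hst
        rwa [hval s s.2, hval t t.2] at this
      rw [eq_posSeg hf.continuous hmono hσ]
      exact Or.inl (posSeg_mem _ _ _)
    · have hanti : StrictMono (f ∘ unitInterval.symm) := fun s t hst => by
        have := h (unitInterval.symm t).2 (unitInterval.symm s).2 (unitInterval.strictAnti_symm hst)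
        rwa [hval _ (unitInterval.symm t).2, hval _ (unitInterval.symm s).2] at this
      refine Or.inr ?_
      change σ.neg ∈ posSegs M
      rw [eq_posSeg (hf.continuous.comp unitInterval.continuous_symm) hanti (Seg.isParam_neg hσ)]
      exact posSeg_mem _ _ _
  · rintro σ (⟨a, b, h, rfl⟩ | ⟨a, b, h, h1⟩)
    · exact exists_isParam h
    · obtain ⟨f, hf, hf'⟩ := exists_isParam h
      obtain rfl : σ = (posSeg a b h).neg := congrArg Seg.neg h1
      exact ⟨_, hf.comp unitInterval.symmHomeomorph.isEmbedding, Seg.isParam_neg hf'⟩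

end Arcs

/-! ### Automorphisms -/

section Action

variable {G : Type u} [Group G] [MonoAction G M]

open MonoAction

theorem Step.smul (g : G) {z a b : M} (h : Step z a b) : Step (g • z) (g • a) (g • b) := by
  refine ⟨fun h' => h.1 (MulAction.injective g h'), fun h' => h.2.1 (MulAction.injective g h'),
    h.2.2.1.imp (congrArg (g • ·))
      (Or.imp (smul_lt_smul_iff g).2 (smul_lt_smul_iff g).2), fun h' => h.2.2.2 ?_⟩
  exact h'.imp (And.imp (smul_lt_smul_iff g).1 (smul_lt_smul_iff g).1)
    (And.imp (smul_lt_smul_iff g).1 (smul_lt_smul_iff g).1)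

/-- Order automorphisms preserve sides, because the order determines them. -/
theorem up_smul_iff (g : G) {x y : M} : up (g • x) (g • y) ↔ up x y := by
  have key : ∀ (g : G) {x y : M}, up x y → up (g • x) (g • y) := by
    intro g x y h
    obtain ⟨hne, t, ht, h⟩ := up_iff_exists.1 h
    refine up_iff_exists.2 ⟨fun h' => hne (MulAction.injective g h'), g • t,
      (smul_lt_smul_iff g).2 ht, ?_⟩
    clear ht
    induction h with
    | refl => exact .refl
    | tail _ h ih => exact ih.tail (h.smul g)
  refine ⟨fun h => ?_, key g⟩
  have := key g⁻¹ h
  rwa [inv_smul_smul, inv_smul_smul] at this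

instance : ContinuousConstSMul G M where
  continuous_const_smul g := by
    rw [continuous_def]
    intro U hU
    refine (isOpen_iff _).2 fun m hm => ?_
    obtain ⟨a, b, ha, hb, hab⟩ := (isOpen_iff U).1 hU _ hm
    refine ⟨g⁻¹ • a, g⁻¹ • b, (inv_smul_lt_iff g).2 ha, ?_, fun x hx => hab ⟨?_, ?_⟩⟩
    · rwa [← smul_lt_smul_iff g, smul_inv_smul]
    · exact (inv_smul_lt_iff g).1 hx.1
    · have := (smul_lt_smul_iff g).2 hx.2
      rwa [smul_inv_smul] at this

theorem map_posSeg (g : G) {a b : M} (h : a < b) : (posSeg a b h).map (MulAction.toPerm g) =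
    posSeg (g • a) (g • b) ((smul_lt_smul_iff g).2 h) := by
  have h1 : ∀ {x y : M}, g⁻¹ • x ≤ y ↔ x ≤ g • y := fun {x y} => by
    rw [← smul_le_smul_iff g, smul_inv_smul]
  have h2 : ∀ {x y : M}, x ≤ g⁻¹ • y ↔ g • x ≤ y := fun {x y} => by
    rw [← smul_le_smul_iff g, smul_inv_smul]
  refine Seg.ext_of_le (fun x => ?_) (fun x y => ?_) rfl rfl
  · constructor
    · rintro ⟨y, hy, rfl⟩
      exact ⟨smul_mono g _ _ hy.1, smul_mono g _ _ hy.2⟩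
    · intro hx
      exact ⟨g⁻¹ • x, ⟨h2.2 hx.1, h1.2 hx.2⟩, smul_inv_smul g x⟩
  · exact and_congr h2 (and_congr (smul_le_smul_iff g⁻¹) h1)

theorem preservesOrientedTree : PreservesOrientedTree G (segs M) (posSegs M) := by
  have key : ∀ g : G, ∀ σ ∈ posSegs M, σ.map (MulAction.toPerm g) ∈ posSegs M := by
    rintro g _ ⟨a, b, h, rfl⟩
    rw [map_posSeg]
    exact posSeg_mem _ _ _
  exact fun g => ⟨fun σ hσ => hσ.imp (key g σ) fun h => key g σ.neg h, key g⟩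

theorem isPreservedBy : (atlas M).IsPreservedBy G := by
  rintro g _ ⟨φ, a, b, h, rfl⟩ _ ⟨ψ, c, d, h', rfl⟩
  exact sameOrientation_of_strictMono
    (fun s t hst => (smul_lt_smul_iff g).2 (φ.strictMono hst)) ψ.strictMono

end Action

end TreeLine
namespace TreeLine

open SidePoset

variable {M : Type u} [TreeLine M]

/-! ### Simple connectedness -/

/-- The homotopy class contains a path inside one chart. -/
def IsLocalClass {x y : M} (q : Path.Homotopic.Quotient x y) : Prop :=
  ∃ p : Path x y, Path.Homotopic.Quotient.mk p = q ∧ ∃ (φ : ℝ ↪o M) (a b : M), range φ = Ioo a b ∧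
    range p ⊆ range φ

/-- Paths in a chart with the same end points are homotopic, since `ℝ` is contractible. -/
theorem homotopic_of_range_subset {φ : ℝ ↪o M} {a b : M} (h : range φ = Ioo a b) {x y : M}
    (p q : Path x y) (hp : range p ⊆ range φ) (hq : range q ⊆ range φ) : Path.Homotopic p q := by
  obtain ⟨s, rfl⟩ : x ∈ range φ := hp ⟨0, p.source⟩
  obtain ⟨t, rfl⟩ : y ∈ range φ := hp ⟨1, p.target⟩
  have hφ := isOpenEmbedding_of_range h
  have key : ∀ p : Path (φ s) (φ t), range p ⊆ range φ →
      ∃ p' : Path s t, p'.map hφ.continuous = p := by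
    intro p hp
    have hinv : ∀ r, φ (Function.invFun φ (p r)) = p r := fun r =>
      Function.invFun_eq (hp ⟨r, rfl⟩)
    refine ⟨⟨⟨fun r => Function.invFun φ (p r), ?_⟩, ?_, ?_⟩, ?_⟩
    · rw [hφ.isInducing.continuous_iff]
      exact p.continuous.congr fun r => (hinv r).symm
    · exact φ.injective ((hinv 0).trans p.source)
    · exact φ.injective ((hinv 1).trans p.target)
    · ext r
      exact hinv r
  obtain ⟨p', rfl⟩ := key p hp
  obtain ⟨q', rfl⟩ := key q hq
  exact (SimplyConnectedSpace.paths_homotopic p' q').map ⟨φ, hφ.continuous⟩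

/-- In a chart, any two points are joined by a path that is contained in every chart that contains
both points. -/
theorem exists_straight {φ : ℝ ↪o M} {a b : M} (h : range φ = Ioo a b) {x y : M}
    (hx : x ∈ Ioo a b) (hy : y ∈ Ioo a b) : ∃ p : Path x y, range p ⊆ Ioo a b ∧
      ∀ c d, x ∈ Ioo c d → y ∈ Ioo c d → range p ⊆ Ioo c d := by
  obtain ⟨s, rfl⟩ : x ∈ range φ := h ▸ hx
  obtain ⟨t, rfl⟩ : y ∈ range φ := h ▸ hy
  obtain ⟨p, hp⟩ := (convex_uIcc s t).isPathConnected ⟨s, left_mem_uIcc⟩ |>.joinedIn s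
    left_mem_uIcc t right_mem_uIcc
  have key : ∀ c d, φ s ∈ Ioo c d → φ t ∈ Ioo c d →
      range (p.map (isOpenEmbedding_of_range h).continuous) ⊆ Ioo c d := by
    rintro c d hs ht _ ⟨r, rfl⟩
    change φ (p r) ∈ Ioo c d
    rcases le_total s t with hst | hst
    · have := hp r
      rw [uIcc_of_le hst] at this
      exact ⟨hs.1.trans_le (φ.le_iff_le.2 this.1), (φ.le_iff_le.2 this.2).trans_lt ht.2⟩
    · have := hp r
      rw [uIcc_of_ge hst] at this
      exact ⟨ht.1.trans_le (φ.le_iff_le.2 this.1), (φ.le_iff_le.2 this.2).trans_lt hs.2⟩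
  exact ⟨_, key a b hx hy, key⟩

/-- The paths inside a chart form a single homotopy class, also for two different charts, because
some path lies in both charts. -/
theorem IsLocalClass.unique {x y : M} {q q' : Path.Homotopic.Quotient x y} (h : IsLocalClass q)
    (h' : IsLocalClass q') : q = q' := by
  obtain ⟨p, rfl, φ, a, b, hφ, hp⟩ := h
  obtain ⟨p', rfl, φ', a', b', hφ', hp'⟩ := h'
  obtain ⟨r, hr, hr'⟩ := exists_straight hφ (hφ ▸ hp ⟨0, p.source⟩) (hφ ▸ hp ⟨1, p.target⟩)
  have h2 := hr' a' b' (hφ' ▸ hp' ⟨0, p'.source⟩) (hφ' ▸ hp' ⟨1, p'.target⟩)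
  rw [← hφ] at hr
  rw [← hφ'] at h2
  exact Path.Homotopic.Quotient.eq.2 ((homotopic_of_range_subset hφ p r hp hr).trans
    (homotopic_of_range_subset hφ' r p' h2 hp'))

theorem IsLocalClass.symm {x y : M} {q : Path.Homotopic.Quotient x y} (h : IsLocalClass q) :
    IsLocalClass q.symm := by
  obtain ⟨p, rfl, φ, a, b, hφ, hp⟩ := h
  refine ⟨p.symm, rfl, φ, a, b, hφ, ?_⟩
  rwa [Path.symm_range]

theorem isLocalClass_refl (x : M) : IsLocalClass (Path.Homotopic.Quotient.refl x) := by
  obtain ⟨φ, a, b, hφ, hx, -⟩ := chart x x le_rfl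
  refine ⟨Path.refl x, rfl, φ, a, b, hφ, ?_⟩
  rintro _ ⟨t, rfl⟩
  exact hφ ▸ hx

theorem exists_isLocalClass {x y : M} (h : Adj x y) :
    ∃ q : Path.Homotopic.Quotient x y, IsLocalClass q := by
  have key : ∀ {x y : M}, x < y → ∃ q : Path.Homotopic.Quotient x y, IsLocalClass q := by
    intro x y h
    obtain ⟨φ, a, b, hφ, hx, hy⟩ := chart x y h.le
    obtain ⟨p, hp, -⟩ := exists_straight hφ hx hy
    exact ⟨_, p, rfl, φ, a, b, hφ, hφ ▸ hp⟩
  rcases h with h | h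
  · exact key h
  · obtain ⟨q, hq⟩ := key h
    exact ⟨_, hq.symm⟩

theorem IsLocalClass.split {x m y : M} (hm : Btw x m y) {q : Path.Homotopic.Quotient x y}
    (h : IsLocalClass q) : ∃ (q₁ : Path.Homotopic.Quotient x m)
      (q₂ : Path.Homotopic.Quotient m y), IsLocalClass q₁ ∧ IsLocalClass q₂ ∧
        q = q₁.trans q₂ := by
  have hq := h
  obtain ⟨p, rfl, φ, a, b, hφ, hp⟩ := h
  have hx : x ∈ Ioo a b := hφ ▸ hp ⟨0, p.source⟩
  have hy : y ∈ Ioo a b := hφ ▸ hp ⟨1, p.target⟩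
  have hm' : m ∈ Ioo a b := hm.elim (fun h => ⟨hx.1.trans h.1, h.2.trans hy.2⟩)
    (fun h => ⟨hy.1.trans h.1, h.2.trans hx.2⟩)
  obtain ⟨p₁, hp₁, -⟩ := exists_straight hφ hx hm'
  obtain ⟨p₂, hp₂, -⟩ := exists_straight hφ hm' hy
  refine ⟨_, _, ⟨p₁, rfl, φ, a, b, hφ, hφ ▸ hp₁⟩, ⟨p₂, rfl, φ, a, b, hφ, hφ ▸ hp₂⟩, ?_⟩
  refine hq.unique ⟨p₁.trans p₂, rfl, φ, a, b, hφ, ?_⟩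
  rw [Path.trans_range, hφ]
  exact union_subset hp₁ hp₂

/-- The homotopy class `q` is the class of the path with the given vertices. -/
inductive Traces : List M → (x y : M) → Path.Homotopic.Quotient x y → Prop
  | nil (x : M) : Traces [x] x x (Path.Homotopic.Quotient.refl x)
  | cons {x y z : M} {l : List M} (h : Adj x y) {e : Path.Homotopic.Quotient x y}
      (he : IsLocalClass e) {q : Path.Homotopic.Quotient y z} (hq : Traces (y :: l) y z q) :
      Traces (x :: y :: l) x z (e.trans q)

theorem Traces.closed {l : List M} {x y : M} {q : Path.Homotopic.Quotient x y}
    (h : Traces l x y q) : l.IsChain Adj ∧ l.head? = some x ∧ l.getLast? = some y := by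
  induction h with
  | nil x => exact ⟨.singleton _, rfl, rfl⟩
  | cons h _ _ ih =>
    exact ⟨.cons_cons h ih.1, rfl, by rw [List.getLast?_cons_cons]; exact ih.2.2⟩

theorem Traces.insertVertex {l : List M} {x y : M} {q : Path.Homotopic.Quotient x y}
    (h : Traces l x y q) (m : M) : Traces (insertVertex m l) x y q := by
  induction h with
  | nil x => exact .nil x
  | @cons x y z l h e he q hq ih =>
    obtain ⟨t, ht⟩ := exists_insertVertex_cons m y l
    rw [OrderTrees.insertVertex]
    rw [ht] at ih ⊢
    by_cases hm : Btw x m y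
    · rw [mid_of_btw hm]
      obtain ⟨q₁, q₂, h1, h2, rfl⟩ := he.split hm
      rw [Path.Homotopic.Quotient.trans_assoc]
      exact .cons hm.adj_left h1 (.cons hm.adj_right h2 ih)
    · rw [mid_of_not hm]
      exact .cons h he ih

theorem Traces.backtrack {p : List M} {a b : M} {r : List M} {x y : M}
    {q : Path.Homotopic.Quotient x y} (h : Traces (p ++ a :: b :: a :: r) x y q) :
    Traces (p ++ a :: r) x y q := by
  induction p generalizing x with
  | nil =>
    cases h with
    | cons h he hq =>
    cases hq with
    | cons h' he' hq =>
    rw [← Path.Homotopic.Quotient.trans_assoc, ← he.symm.unique he',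
      Path.Homotopic.Quotient.trans_symm, Path.Homotopic.Quotient.refl_trans]
    exact hq
  | cons c p ih =>
    cases p with
    | nil =>
      cases h with
      | cons h he hq => exact .cons h he (ih hq)
    | cons d p =>
      cases h with
      | cons h he hq => exact .cons h he (ih hq)

/-- A loop along edges is null-homotopic, because its list of vertices contracts. -/
theorem Traces.eq_refl {l : List M} {x : M} {q : Path.Homotopic.Quotient x x}
    (h : Traces l x x q) : q = Path.Homotopic.Quotient.refl x := by
  obtain ⟨h1, h2, h3⟩ := h.closed
  obtain ⟨F, hF⟩ := contracts_of_closed x l h1 h2 h3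
  have h4 : Traces (F.foldl (fun l m => OrderTrees.insertVertex m l) l) x x q := by
    clear hF h1 h2 h3
    induction F generalizing l with
    | nil => exact h
    | cons m F ih => exact ih (h.insertVertex m)
  have h5 : ∀ v, Relation.ReflTransGen Backtrack
      (F.foldl (fun l m => OrderTrees.insertVertex m l) l) v → Traces v x x q := by
    intro v hv
    induction hv with
    | refl => exact h4
    | tail _ h ih =>
      obtain ⟨p, a, b, r, rfl, rfl⟩ := h
      exact ih.backtrack
  have h6 := h5 _ hF
  cases h6 with
  | nil => rfl

theorem Traces.append {l : List M} {x y z : M} {q : Path.Homotopic.Quotient x y}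
    (h : Traces l x y q) {e : Path.Homotopic.Quotient y z} (he : IsLocalClass e) :
    ∃ l', Traces (x :: l') x z (q.trans e) := by
  induction h with
  | nil x =>
    rw [Path.Homotopic.Quotient.refl_trans]
    rcases eq_or_ne x z with rfl | hne
    · rw [he.unique (isLocalClass_refl x)]
      exact ⟨[], .nil x⟩
    · have hadj : Adj x z := by
        obtain ⟨p, rfl, φ, a, b, hφ, hp⟩ := he
        exact (le_or_le_of_mem_Icc (Ioo_subset_Icc_self (hφ ▸ hp ⟨0, p.source⟩))
          (Ioo_subset_Icc_self (hφ ▸ hp ⟨1, p.target⟩))).imp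
          (fun h => lt_of_le_of_ne h hne) (fun h => lt_of_le_of_ne h hne.symm)
      refine ⟨[z], ?_⟩
      rw [← Path.Homotopic.Quotient.trans_refl e]
      exact .cons hadj he (.nil z)
  | cons h he' _ ih =>
    obtain ⟨l', hl'⟩ := ih he
    rw [Path.Homotopic.Quotient.trans_assoc]
    exact ⟨_, .cons h he' hl'⟩

/-- Every path is homotopic to one along edges: this is a locally constant condition on initial
pieces of the path. -/
theorem exists_traces {x y : M} (γ : Path x y) :
    ∃ l, Traces l x y (Path.Homotopic.Quotient.mk γ) := by
  let C : unitInterval → Prop := fun t =>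
    ∃ l, Traces l (γ 0) (γ t) (Path.Homotopic.Quotient.mk (γ.subpath 0 t))
  have hstep : ∀ s t, IsLocalClass (Path.Homotopic.Quotient.mk (γ.subpath s t)) → C s → C t := by
    rintro s t h ⟨l, hl⟩
    obtain ⟨l', hl'⟩ := hl.append h
    rw [← Path.Homotopic.Quotient.mk_trans,
      Path.Homotopic.Quotient.eq.2 ⟨Path.Homotopy.subpathTransSubpath γ 0 s t⟩] at hl'
    exact ⟨_, hl'⟩
  have hloc : IsLocallyConstant C := by
    rw [IsLocallyConstant.iff_eventually_eq]
    intro t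
    obtain ⟨φ, a, b, hφ, ht, -⟩ := chart (γ t) (γ t) le_rfl
    have h1 : γ ⁻¹' Ioo a b ∈ 𝓝 t := γ.continuous.continuousAt (Ioo_mem_nhds ht.1 ht.2)
    obtain ⟨ε, hε, hball⟩ := Metric.mem_nhds_iff.1 h1
    filter_upwards [Metric.ball_mem_nhds t hε] with s hs
    have h2 : IsLocalClass (Path.Homotopic.Quotient.mk (γ.subpath s t)) := by
      refine ⟨_, rfl, φ, a, b, hφ, ?_⟩
      rw [Path.range_subpath, hφ]
      rintro _ ⟨r, hr, rfl⟩
      refine hball ?_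
      rw [Metric.mem_ball, Subtype.dist_eq, Real.dist_eq] at hs ⊢
      rw [abs_sub_comm] at hs ⊢
      exact (abs_sub_right_of_mem_uIcc (show (r : ℝ) ∈ uIcc (s : ℝ) t from hr)).trans_lt hs
    refine propext ⟨hstep s t h2, hstep t s ?_⟩
    have h3 := h2.symm
    rwa [← Path.Homotopic.Quotient.mk_symm, Path.symm_subpath] at h3
  have h0 : C 0 := by
    refine ⟨[γ 0], ?_⟩
    rw [Path.subpath_self]
    exact .nil _
  have h1 : C 1 := (hloc.apply_eq_of_preconnectedSpace 0 1).mp h0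
  obtain ⟨l, hl⟩ := h1
  rw [Path.subpath_zero_one] at hl
  refine ⟨l, ?_⟩
  have key : ∀ (x' y' : M) (hx : x' = x) (hy : y' = y), Traces l x' y'
      (Path.Homotopic.Quotient.mk (γ.cast hx hy)) →
      Traces l x y (Path.Homotopic.Quotient.mk γ) := by
    rintro _ _ rfl rfl h
    exact h
  exact key _ _ γ.source γ.target hl

theorem joined_of_conn (x y : M) : Joined x y := by
  have h1 : ∀ a b : M, Adj a b → Joined a b := fun a b h => by
    obtain ⟨q, p, -⟩ := exists_isLocalClass h
    exact ⟨p⟩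
  induction conn x y with
  | refl => exact Joined.refl x
  | @tail a b _ h ih =>
    rcases eq_or_ne a b with rfl | hne
    · exact ih
    · exact ih.trans (h1 a b (h.imp (fun h => lt_of_le_of_ne h hne)
        fun h => lt_of_le_of_ne h hne.symm))

theorem simplyConnectedSpace [Nonempty M] : SimplyConnectedSpace M := by
  rw [simply_connected_iff_loops_nullhomotopic]
  refine ⟨⟨inferInstance, joined_of_conn⟩, fun x γ => ?_⟩
  obtain ⟨l, hl⟩ := exists_traces γ
  exact Path.Homotopic.Quotient.eq.1 hl.eq_refl

end TreeLine
/-! ### Ends -/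

/-- A bounded sequence in which later terms lie between earlier and still later ones is eventually
monotone, and hence converges. -/
theorem exists_tendsto_of_mem_uIcc {t : ℕ → ℝ} {a b : ℝ} (hb : ∀ i, t i ∈ Icc a b)
    (h : ∀ i j k, i ≤ j → j ≤ k → t j ∈ uIcc (t i) (t k)) :
    ∃ r, Filter.Tendsto t Filter.atTop (𝓝 r) := by
  by_cases hi : ∃ i, t 0 < t i
  · obtain ⟨i, hi⟩ := hi
    have h1 : ∀ k, i ≤ k → t 0 < t k := by
      intro k hk
      rcases mem_uIcc.1 (h 0 i k (Nat.zero_le _) hk) with h1 | h1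
      · exact hi.trans_le h1.2
      · exact absurd h1.2 (not_le.2 hi)
    have h2 : Monotone fun k => t (k + i) := by
      intro j k hjk
      have hk := h1 (k + i) (Nat.le_add_left _ _)
      rcases mem_uIcc.1 (h 0 (j + i) (k + i) (Nat.zero_le _) (by lia)) with h2 | h2
      · exact h2.2
      · exact absurd (h2.1.trans h2.2) (not_le.2 hk)
    refine ⟨_, (Filter.tendsto_add_atTop_iff_nat i).1 (tendsto_atTop_ciSup h2 ⟨b, ?_⟩)⟩
    rintro _ ⟨k, rfl⟩
    exact (hb _).2
  · push Not at hi
    have h2 : Antitone t := by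
      intro j k hjk
      rcases mem_uIcc.1 (h 0 j k (Nat.zero_le _) hjk) with h2 | h2
      · exact (hi k).trans h2.1
      · exact h2.1
    refine ⟨_, tendsto_atTop_ciInf h2 ⟨a, ?_⟩⟩
    rintro _ ⟨k, rfl⟩
    exact (hb _).1

namespace TreeLine

open SidePoset Filter

variable {M : Type u} [TreeLine M]

theorem hull_eq_Icc {x y : M} (h : x ≤ y) : Hull up x y = Icc x y := by
  ext z
  constructor
  · rintro (rfl | rfl | hz)
    · exact ⟨le_rfl, h⟩
    · exact ⟨h, le_rfl⟩
    · by_contra hcon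
      rcases h.lt_or_eq with h1 | rfl
      · exact hz.2.2 (up_iff_up x y z h1 hz.1 hz.2.1 fun h2 => hcon ⟨h2.1.le, h2.2.le⟩)
      · exact hz.2.2 Iff.rfl
  · intro hz
    rcases hz.1.lt_or_eq with h1 | rfl
    · rcases hz.2.lt_or_eq with h2 | rfl
      · exact Or.inr (Or.inr (sep_of_btw (Or.inl ⟨h1, h2⟩)))
      · exact right_mem_hull _ _
    · exact left_mem_hull _ _

theorem hull_subset_Icc {c d x y : M} (hx : x ∈ Icc c d) (hy : y ∈ Icc c d) :
    Hull up x y ⊆ Icc c d := by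
  rcases le_or_le_of_mem_Icc hx hy with h | h
  · rw [hull_eq_Icc h]
    exact Icc_subset_Icc hx.1 hy.2
  · rw [hull_comm, hull_eq_Icc h]
    exact Icc_subset_Icc hy.1 hx.2

/-- The sequence `p` runs along an infinite ray that starts at `x`. -/
structure IsRay (x : M) (p : ℕ → M) : Prop where
  mono : ∀ i j, i ≤ j → Hull up x (p i) ⊆ Hull up x (p j)
  not_tendsto : ¬ ∃ y, Tendsto p atTop (𝓝 y)

/-- The points of the ray from `x` along `p`. -/
def rayHull (x : M) (p : ℕ → M) : Set M := ⋃ i, Hull up x (p i)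

theorem isInfiniteRay_iff {ρ : Set M} :
    IsInfiniteRay (segs M) ρ ↔ ∃ x p, IsRay x p ∧ ρ = rayHull x p := by
  simp only [IsInfiniteRay, spine_eq_hull]
  constructor
  · rintro ⟨x, p, h1, rfl, h2⟩
    refine ⟨x, p, ⟨fun i j hij => ?_, h2⟩, rfl⟩
    rcases hij.lt_or_eq with h | rfl
    · exact h1 i j h
    · exact Subset.rfl
  · rintro ⟨x, p, h, rfl⟩
    exact ⟨x, p, fun i j hij => h.mono i j hij.le, rfl, h.not_tendsto⟩

namespace IsRay

variable {x : M} {p : ℕ → M}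

theorem mem_hull (h : IsRay x p) {i j k : ℕ} (hij : i ≤ j) (hjk : j ≤ k) :
    p j ∈ Hull up (p i) (p k) :=
  isTreeSide.mem_hull_of_mem (h.mono i j hij (right_mem_hull _ _))
    (h.mono j k hjk (right_mem_hull _ _))

/-- A ray leaves every compact interval: inside one it would be monotone and converge. -/
theorem not_frequently_mem_Icc (h : IsRay x p) (c d : M) : ¬ ∃ᶠ i in atTop, p i ∈ Icc c d := by
  intro hf
  rw [frequently_atTop] at hf
  obtain ⟨i₀, -, hi₀⟩ := hf 0
  have hmem : ∀ k, i₀ ≤ k → p k ∈ Icc c d := by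
    intro k hk
    obtain ⟨j, hj, hpj⟩ := hf k
    exact hull_subset_Icc hi₀ hpj (h.mem_hull hk hj)
  obtain ⟨φ, a, b, hφ, hc, hd⟩ := chart c d (hi₀.1.trans hi₀.2)
  obtain ⟨s, rfl⟩ : c ∈ range φ := hφ ▸ hc
  obtain ⟨r, rfl⟩ : d ∈ range φ := hφ ▸ hd
  have hex : ∀ k, ∃ t, φ t = p (k + i₀) := by
    intro k
    have h1 := hmem (k + i₀) (Nat.le_add_left _ _)
    have h2 : p (k + i₀) ∈ Ioo a b := ⟨hc.1.trans_le h1.1, h1.2.trans_lt hd.2⟩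
    rwa [← hφ] at h2
  choose t ht using hex
  obtain ⟨l, hl⟩ := exists_tendsto_of_mem_uIcc (t := t) (a := s) (b := r)
    (fun k => by
      have h1 := hmem (k + i₀) (Nat.le_add_left _ _)
      rw [← ht] at h1
      exact ⟨φ.le_iff_le.1 h1.1, φ.le_iff_le.1 h1.2⟩)
    (fun i j k hij hjk => by
      have h1 := h.mem_hull (i := i + i₀) (j := j + i₀) (k := k + i₀) (by lia) (by lia)
      rw [← ht, ← ht, ← ht] at h1
      rcases le_total (t i) (t k) with h2 | h2
      · rw [hull_eq_Icc (φ.le_iff_le.2 h2)] at h1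
        exact mem_uIcc.2 (Or.inl ⟨φ.le_iff_le.1 h1.1, φ.le_iff_le.1 h1.2⟩)
      · rw [hull_comm, hull_eq_Icc (φ.le_iff_le.2 h2)] at h1
        exact mem_uIcc.2 (Or.inr ⟨φ.le_iff_le.1 h1.1, φ.le_iff_le.1 h1.2⟩))
  refine h.not_tendsto ⟨φ l, (tendsto_add_atTop_iff_nat i₀).1 ?_⟩
  have h1 := ((isOpenEmbedding_of_range hφ).continuous.tendsto l).comp hl
  exact h1.congr fun k => ht k

/-- A ray leaves every hull, because a hull is covered by finitely many compact intervals. -/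
theorem not_frequently_mem_hull (h : IsRay x p) (a b : M) :
    ¬ ∃ᶠ i in atTop, p i ∈ Hull up a b := by
  induction conn a b with
  | refl =>
    rw [hull_eq_Icc le_rfl]
    exact h.not_frequently_mem_Icc a a
  | @tail c d _ hcd ih =>
    intro hf
    have h1 := hf.mono fun i hi => hull_subset_union a d c hi
    rcases frequently_or_distrib.1 h1 with h2 | h2
    · exact ih h2
    · rcases hcd with h3 | h3
      · rw [hull_eq_Icc h3] at h2
        exact h.not_frequently_mem_Icc _ _ h2
      · rw [hull_comm, hull_eq_Icc h3] at h2
        exact h.not_frequently_mem_Icc _ _ h2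

end IsRay

/-- Eventually the sequence lies above `q` if `s` holds, and on the other side of `q` if not. -/
def EndSide (p : ℕ → M) (q : M) (s : Prop) : Prop := ∀ᶠ i in atTop, p i ≠ q ∧ (up q (p i) ↔ s)

/-- Once the ray has changed from one side of `q` to the other, `q` stays in the hull between its
points and it cannot change back. -/
theorem IsRay.exists_endSide {x : M} {p : ℕ → M} (h : IsRay x p) (q : M) : ∃ s, EndSide p q s := by
  have hne : ∀ᶠ i in atTop, p i ≠ q := by
    have h1 := h.not_frequently_mem_Icc q q
    rw [not_frequently] at h1
    exact h1.mono fun i hi h2 => hi (by rw [h2]; exact left_mem_Icc.2 le_rfl)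
  obtain ⟨N, hN⟩ := eventually_atTop.1 hne
  by_cases hj : ∃ j, N ≤ j ∧ ¬ (up q (p N) ↔ up q (p j))
  · obtain ⟨j, hj, hside⟩ := hj
    refine ⟨up q (p j), eventually_atTop.2 ⟨j, fun k hk => ⟨hN k (hj.trans hk), ?_⟩⟩⟩
    have h1 : q ∈ Hull up (p N) (p k) :=
      isTreeSide.hull_subset_left (h.mem_hull hj hk)
        (Or.inr (Or.inr ⟨(hN N le_rfl).symm, (hN j hj).symm, hside⟩))
    rcases h1 with h1 | h1 | h1
    · exact absurd h1.symm (hN N le_rfl)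
    · exact absurd h1.symm (hN k (hj.trans hk))
    · have h2 := h1.2.2
      tauto
  · push Not at hj
    exact ⟨up q (p N), eventually_atTop.2 ⟨N, fun k hk => ⟨hN k hk, (hj k hk).symm⟩⟩⟩

/-- A subray ends on the same side of every point as the ray: otherwise it would stay between the
starting point of the ray and the point in question. -/
theorem EndSide.iff_of_subset {x x' q : M} {p p' : ℕ → M} {s s' : Prop} (h : IsRay x p)
    (h' : IsRay x' p') (hsub : rayHull x' p' ⊆ rayHull x p) (hs : EndSide p q s)
    (hs' : EndSide p' q s') : s ↔ s' := by
  by_contra hne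
  refine h'.not_frequently_mem_hull x q (Eventually.frequently (hs'.mono fun j hj => ?_))
  obtain ⟨i₀, hi₀⟩ := mem_iUnion.1 (hsub (mem_iUnion.2 ⟨j, right_mem_hull _ _⟩))
  obtain ⟨i, hi, hi'⟩ := (hs.and (eventually_ge_atTop i₀)).exists
  have hmem : p' j ∈ Hull up (p i) x := by
    rw [hull_comm]
    exact h.mono i₀ i hi' hi₀
  rw [hull_comm]
  refine isTreeSide.mem_hull_of_mem (Or.inr (Or.inr ⟨hi.1.symm, hj.1.symm, fun h1 => hne ?_⟩)) hmem
  rw [← hi.2, h1, hj.2]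

/-- Rays with the same end lie eventually on the same side of every point. -/
theorem EndSide.iff_of_sameEnd {x x' q : M} {p p' : ℕ → M} {s s' : Prop} (h : IsRay x p)
    (h' : IsRay x' p') (hsame : SameEnd (segs M) (rayHull x p) (rayHull x' p'))
    (hs : EndSide p q s) (hs' : EndSide p' q s') : s ↔ s' := by
  obtain ⟨ρ, hρ, hsub⟩ := hsame
  obtain ⟨y, r, hr, rfl⟩ := isInfiniteRay_iff.1 hρ
  obtain ⟨t, ht⟩ := hr.exists_endSide q
  exact (EndSide.iff_of_subset h hr (fun z hz => (hsub hz).1) hs ht).trans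
    (EndSide.iff_of_subset h' hr (fun z hz => (hsub hz).2) hs' ht).symm

section Action

variable {G : Type u} [Group G] [MonoAction G M]

theorem image_hull (g : G) (x y : M) :
    (fun z => g • z) '' Hull up x y = Hull up (g • x) (g • y) := by
  have key : ∀ (g : G) (x y : M), (fun z => g • z) '' Hull up x y ⊆ Hull up (g • x) (g • y) := by
    rintro g x y _ ⟨z, rfl | rfl | hz, rfl⟩
    · exact left_mem_hull _ _
    · exact right_mem_hull _ _
    · refine Or.inr (Or.inr ⟨fun h => hz.1 (MulAction.injective g h),
        fun h => hz.2.1 (MulAction.injective g h), ?_⟩)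
      rw [up_smul_iff, up_smul_iff]
      exact hz.2.2
  refine (key g x y).antisymm fun z hz => ⟨g⁻¹ • z, ?_, smul_inv_smul g z⟩
  have := key g⁻¹ _ _ ⟨z, hz, rfl⟩
  rwa [inv_smul_smul, inv_smul_smul] at this

theorem image_rayHull (g : G) (x : M) (p : ℕ → M) :
    (fun z => g • z) '' rayHull x p = rayHull (g • x) (fun i => g • p i) := by
  simp only [rayHull, image_iUnion, image_hull]

theorem IsRay.smul (g : G) {x : M} {p : ℕ → M} (h : IsRay x p) :
    IsRay (g • x) (fun i => g • p i) where
  mono i j hij := by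
    rw [← image_hull, ← image_hull]
    exact image_mono (h.mono i j hij)
  not_tendsto := by
    rintro ⟨y, hy⟩
    refine h.not_tendsto ⟨g⁻¹ • y, (hy.const_smul g⁻¹).congr fun i => ?_⟩
    rw [inv_smul_smul]

theorem EndSide.smul (g : G) {p : ℕ → M} {q : M} {s : Prop} (h : EndSide p q s) :
    EndSide (fun i => g • p i) (g • q) s :=
  h.mono fun i hi => ⟨fun h1 => hi.1 (MulAction.injective g h1), by rw [up_smul_iff]; exact hi.2⟩

/-- A fixed end lies on an invariantly chosen side of each point. -/
theorem exists_side_of_representsFixedEnd {ρ : Set M} (h : RepresentsFixedEnd G (segs M) ρ) :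
    ∃ s : M → Prop, (∀ (g : G) q, s (g • q) ↔ s q) ∧
      ∀ q q', ∃ x, x ≠ q ∧ x ≠ q' ∧ (up q x ↔ s q) ∧ (up q' x ↔ s q') := by
  obtain ⟨x, p, hp, rfl⟩ := isInfiniteRay_iff.1 h.1
  choose s hs using hp.exists_endSide
  refine ⟨s, fun g q => ?_, fun q q' => ?_⟩
  · have h1 := h.2 g
    rw [image_rayHull] at h1
    exact (EndSide.iff_of_sameEnd (hp.smul g) hp h1 ((hs q).smul g) (hs (g • q))).symm
  · obtain ⟨i, hi, hi'⟩ := ((hs q).and (hs q')).exists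
    exact ⟨p i, hi.1, hi'.1, hi.2, hi'.2⟩

end Action

/-! ### The two ends of a totally ordered line -/

theorem exists_seq_gt [Nonempty M] (htot : ∀ a b : M, a ≤ b ∨ b ≤ a) :
    ∃ p : ℕ → M, Monotone p ∧ ∀ z, ∃ i, z < p i := by
  obtain ⟨D, hD, hdense⟩ := countable_dense (M := M)
  have := hD.to_subtype
  have hcof : ∀ z : M, ∃ d : D, z < d := fun z => by
    obtain ⟨a, ha⟩ := exists_gt z
    obtain ⟨d, hd, h1, -⟩ := hdense z a ha
    exact ⟨⟨d, hd⟩, h1⟩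
  have : Nonempty D := ‹Nonempty M›.elim fun z => (hcof z).nonempty
  have : IsDirectedOrder D := ⟨fun a b => (htot a b).elim (fun h => ⟨b, h, le_rfl⟩)
    (fun h => ⟨a, le_rfl, h⟩)⟩
  obtain ⟨p, hp, hlim⟩ := exists_seq_monotone_tendsto_atTop_atTop D
  refine ⟨fun i => p i, fun i j hij => hp hij, fun z => ?_⟩
  obtain ⟨d, hd⟩ := hcof z
  obtain ⟨i, hi⟩ := (hlim.eventually_ge_atTop d).exists
  exact ⟨i, hd.trans_le hi⟩

theorem exists_seq_lt [Nonempty M] (htot : ∀ a b : M, a ≤ b ∨ b ≤ a) :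
    ∃ p : ℕ → M, Antitone p ∧ ∀ z, ∃ i, p i < z := by
  obtain ⟨D, hD, hdense⟩ := countable_dense (M := M)
  have := hD.to_subtype
  have hcof : ∀ z : M, ∃ d : D, (d : M) < z := fun z => by
    obtain ⟨a, ha⟩ := exists_lt z
    obtain ⟨d, hd, -, h1⟩ := hdense a z ha
    exact ⟨⟨d, hd⟩, h1⟩
  have : Nonempty Dᵒᵈ := ‹Nonempty M›.elim fun z => (hcof z).nonempty
  have : IsDirectedOrder Dᵒᵈ := ⟨fun a b =>
    (htot (OrderDual.ofDual a : D) (OrderDual.ofDual b : D)).elim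
      (fun h => ⟨a, le_rfl, h⟩) (fun h => ⟨b, h, le_rfl⟩)⟩
  have : Countable Dᵒᵈ := inferInstanceAs (Countable D)
  obtain ⟨p, hp, hlim⟩ := exists_seq_monotone_tendsto_atTop_atTop Dᵒᵈ
  refine ⟨fun i => (OrderDual.ofDual (p i) : D), fun i j hij => hp hij, fun z => ?_⟩
  obtain ⟨d, hd⟩ := hcof z
  obtain ⟨i, hi⟩ := (hlim.eventually_ge_atTop (OrderDual.toDual d)).exists
  exact ⟨i, lt_of_le_of_lt (show ((OrderDual.ofDual (p i) : D) : M) ≤ d from hi) hd⟩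

theorem exists_isRay_Ici (htot : ∀ a b : M, a ≤ b ∨ b ≤ a) (x : M) :
    ∃ p, IsRay x p ∧ rayHull x p = Ici x ∧ ∀ q, EndSide p q True := by
  have : Nonempty M := ⟨x⟩
  obtain ⟨p, hp, hcof⟩ := exists_seq_gt htot
  obtain ⟨i₀, hi₀⟩ := hcof x
  have hev : ∀ z, ∀ᶠ i in atTop, z < p (i + i₀) := fun z => by
    obtain ⟨i, hi⟩ := hcof z
    exact eventually_atTop.2 ⟨i, fun j hj => hi.trans_le (hp (by lia))⟩
  have hx : ∀ i, x ≤ p (i + i₀) := fun i => hi₀.le.trans (hp (by lia))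
  refine ⟨fun i => p (i + i₀), ⟨fun i j hij => ?_, ?_⟩, ?_, fun q => ?_⟩
  · rw [hull_eq_Icc (hx i), hull_eq_Icc (hx j)]
    exact Icc_subset_Icc_right (hp (by lia))
  · rintro ⟨y, hy⟩
    obtain ⟨a, ha⟩ := exists_lt y
    obtain ⟨b, hb⟩ := exists_gt y
    obtain ⟨i, h1, h2⟩ := ((hy.eventually (Ioo_mem_nhds ha hb)).and (hev b)).exists
    exact lt_asymm h1.2 h2
  · ext z
    simp only [rayHull, mem_iUnion]
    constructor
    · rintro ⟨i, hi⟩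
      rw [hull_eq_Icc (hx i)] at hi
      exact hi.1
    · intro hz
      obtain ⟨i, hi⟩ := (hev z).exists
      exact ⟨i, by rw [hull_eq_Icc (hx i)]; exact ⟨hz, hi.le⟩⟩
  · exact (hev q).mono fun i hi => ⟨hi.ne', by simpa using up_of_lt _ _ hi⟩

theorem exists_isRay_Iic (htot : ∀ a b : M, a ≤ b ∨ b ≤ a) (x : M) :
    ∃ p, IsRay x p ∧ rayHull x p = Iic x ∧ ∀ q, EndSide p q False := by
  have : Nonempty M := ⟨x⟩
  obtain ⟨p, hp, hcof⟩ := exists_seq_lt htot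
  obtain ⟨i₀, hi₀⟩ := hcof x
  have hev : ∀ z, ∀ᶠ i in atTop, p (i + i₀) < z := fun z => by
    obtain ⟨i, hi⟩ := hcof z
    exact eventually_atTop.2 ⟨i, fun j hj => lt_of_le_of_lt (hp (by lia)) hi⟩
  have hx : ∀ i, p (i + i₀) ≤ x := fun i => le_trans (hp (by lia)) hi₀.le
  have hull : ∀ i, Hull up x (p (i + i₀)) = Icc (p (i + i₀)) x := fun i => by
    rw [hull_comm, hull_eq_Icc (hx i)]
  refine ⟨fun i => p (i + i₀), ⟨fun i j hij => ?_, ?_⟩, ?_, fun q => ?_⟩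
  · rw [hull, hull]
    exact Icc_subset_Icc_left (hp (by lia))
  · rintro ⟨y, hy⟩
    obtain ⟨a, ha⟩ := exists_lt y
    obtain ⟨b, hb⟩ := exists_gt y
    obtain ⟨i, h1, h2⟩ := ((hy.eventually (Ioo_mem_nhds ha hb)).and (hev a)).exists
    exact lt_asymm h1.1 h2
  · ext z
    simp only [rayHull, mem_iUnion, hull]
    constructor
    · rintro ⟨i, hi⟩
      exact hi.2
    · intro hz
      obtain ⟨i, hi⟩ := (hev z).exists
      exact ⟨i, hi.le, hz⟩
  · exact (hev q).mono fun i hi => ⟨hi.ne, by simpa using not_up_of_lt _ _ hi⟩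

theorem isInfiniteRay_Ici (htot : ∀ a b : M, a ≤ b ∨ b ≤ a) (x : M) :
    IsInfiniteRay (segs M) (Ici x) := by
  obtain ⟨p, hp, h, -⟩ := exists_isRay_Ici htot x
  exact isInfiniteRay_iff.2 ⟨x, p, hp, h.symm⟩

theorem isInfiniteRay_Iic (htot : ∀ a b : M, a ≤ b ∨ b ≤ a) (x : M) :
    IsInfiniteRay (segs M) (Iic x) := by
  obtain ⟨p, hp, h, -⟩ := exists_isRay_Iic htot x
  exact isInfiniteRay_iff.2 ⟨x, p, hp, h.symm⟩

section Action

variable {G : Type u} [Group G] [MonoAction G M]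

theorem representsFixedEnd_Ici (htot : ∀ a b : M, a ≤ b ∨ b ≤ a) (x : M) :
    RepresentsFixedEnd G (segs M) (Ici x) := by
  refine ⟨isInfiniteRay_Ici htot x, fun g => ?_⟩
  obtain ⟨z, hz, hz'⟩ : ∃ z, g • x ≤ z ∧ x ≤ z := (htot (g • x) x).elim
    (fun h => ⟨x, h, le_rfl⟩) (fun h => ⟨g • x, le_rfl, h⟩)
  refine ⟨Ici z, isInfiniteRay_Ici htot z, fun w hw => ⟨⟨g⁻¹ • w, ?_, smul_inv_smul g w⟩,
    hz'.trans hw⟩⟩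
  rw [mem_Ici, ← MonoAction.smul_le_smul_iff g, smul_inv_smul]
  exact hz.trans hw

theorem representsFixedEnd_Iic (htot : ∀ a b : M, a ≤ b ∨ b ≤ a) (x : M) :
    RepresentsFixedEnd G (segs M) (Iic x) := by
  refine ⟨isInfiniteRay_Iic htot x, fun g => ?_⟩
  obtain ⟨z, hz, hz'⟩ : ∃ z, z ≤ g • x ∧ z ≤ x := (htot (g • x) x).elim
    (fun h => ⟨g • x, le_rfl, h⟩) (fun h => ⟨x, h, le_rfl⟩)
  refine ⟨Iic z, isInfiniteRay_Iic htot z, fun w hw => ⟨⟨g⁻¹ • w, ?_, smul_inv_smul g w⟩,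
    le_trans hw hz'⟩⟩
  rw [mem_Iic, ← MonoAction.smul_le_smul_iff g, smul_inv_smul]
  exact le_trans hw hz

/-- A group that acts on a totally ordered line fixes both ends. -/
theorem not_fixesUniqueEnd_of_total (htot : ∀ a b : M, a ≤ b ∨ b ≤ a) :
    ¬ FixesUniqueEnd G (segs M) := by
  rintro ⟨ρ, hρ, huniq⟩
  obtain ⟨x, p, hp, rfl⟩ := isInfiniteRay_iff.1 hρ.1
  obtain ⟨s, hs⟩ := hp.exists_endSide x
  obtain ⟨p₁, hp₁, h₁, hs₁⟩ := exists_isRay_Ici htot x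
  obtain ⟨p₂, hp₂, h₂, hs₂⟩ := exists_isRay_Iic htot x
  have e₁ := huniq _ (representsFixedEnd_Ici htot x)
  have e₂ := huniq _ (representsFixedEnd_Iic htot x)
  rw [← h₁] at e₁
  rw [← h₂] at e₂
  have := (EndSide.iff_of_sameEnd hp₁ hp e₁ (hs₁ x) hs).trans
    (EndSide.iff_of_sameEnd hp₂ hp e₂ (hs₂ x) hs).symm
  exact this.1 trivial

end Action

end TreeLine
/-! ### The elements of the group as points of the line -/

/-- A set with sides is totally ordered if it has a totally ordered subset that is unbounded in both
directions. -/
theorem le_or_le_of_cofinal {X ι : Type u} [SidePoset X] {f : ι → X}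
    (hf : ∀ i j, f i ≤ f j ∨ f j ≤ f i) (hlo : ∀ x, ∃ i, f i ≤ x) (hhi : ∀ x, ∃ i, x ≤ f i)
    (a b : X) : a ≤ b ∨ b ≤ a := by
  obtain ⟨c, hc, hc'⟩ : ∃ c, c ≤ a ∧ c ≤ b := by
    obtain ⟨i, hi⟩ := hlo a
    obtain ⟨j, hj⟩ := hlo b
    exact (hf i j).elim (fun h => ⟨f i, hi, h.trans hj⟩) (fun h => ⟨f j, h.trans hi, hj⟩)
  obtain ⟨d, hd, hd'⟩ : ∃ d, a ≤ d ∧ b ≤ d := by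
    obtain ⟨i, hi⟩ := hhi a
    obtain ⟨j, hj⟩ := hhi b
    exact (hf i j).elim (fun h => ⟨f j, hi.trans h, hj⟩) (fun h => ⟨f i, hi, hj.trans h⟩)
  exact SidePoset.le_or_le_of_mem_Icc ⟨hc, hd⟩ ⟨hc', hd'⟩

namespace DCut

open SidePoset TurnTree TreeLine

variable {P : Type u} [TurnTree P] [Countable P]

/-- The point of the line that represents an element of `P`. -/
def point (p : P) : DCut (Fill P ×ₗ ℚ) := of (toLex (Fill.elt p, 0))

theorem point_injective : Function.Injective (point (P := P)) := by
  intro p q h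
  have h1 := congrArg (fun x => (ofLex x).1) (of_injective h)
  simpa using h1

theorem up_point_iff {p q : P} : up (point p) (point q) ↔ side p q := by
  refine up_of_iff.trans ⟨?_, fun h => Or.inl h⟩
  rintro (h | h)
  · exact h
  · exact absurd h.2 (lt_irrefl _)

/-- Distinct points that represent elements of `P` lie on different sides of another point. -/
theorem exists_sep_point {p q : P} (hpq : p ≠ q) : ∃ z, Sep up z (point p) (point q) := by
  have h0 : ∀ (r : ℚ), up (toLex (Fill.elt p, r) : Fill P ×ₗ ℚ) (toLex (Fill.elt q, (0 : ℚ))) ↔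
      side p q := by
    refine fun r => ⟨?_, fun h => Or.inl h⟩
    rintro (h | h)
    · exact h
    · exact absurd (Fill.elt.inj h.1) hpq
  have h1 : ∀ (r : ℚ), up (toLex (Fill.elt p, r) : Fill P ×ₗ ℚ) (toLex (Fill.elt p, (0 : ℚ))) ↔
      r < 0 := by
    refine fun r => ⟨?_, fun h => Or.inr ⟨rfl, h⟩⟩
    rintro (h | h)
    · exact absurd h (up_irrefl _)
    · exact h.2
  have h2 : ∀ r : ℚ, r ≠ 0 → (r < 0 ↔ ¬ side p q) → Sep up (of (toLex (Fill.elt p, r)))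
      (point p) (point q) := by
    intro r hr h
    refine ⟨fun h3 => hr ?_, fun h3 => hpq ?_, ?_⟩
    · simpa using congrArg (fun x => (ofLex x).2) (of_injective h3)
    · simpa using congrArg (fun x => (ofLex x).1) (of_injective h3)
    · rw [point, point, up_of_iff, up_of_iff, h0, h1]
      tauto
  by_cases hs : side p q
  · exact ⟨_, h2 1 one_ne_zero (by simp [hs])⟩
  · exact ⟨_, h2 (-1) (by simp) (by simp [hs])⟩

section Total

/-- In a totally ordered set without extreme elements every point of the line lies between points
of the set. -/
theorem exists_point_lt [PartialOrder P] (htot : ∀ p q : P, p ≤ q ∨ q ≤ p)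
    (hside : ∀ p q : P, side p q ↔ p < q) (hmin : ∀ p : P, ∃ q, q < p) (m : DCut (Fill P ×ₗ ℚ)) :
    ∃ p, point p ≤ m := by
  have key : ∀ α : Fill P, ∃ p, Fill.elt p < α := by
    have hlt : ∀ {p q : P}, p < q → (Fill.elt p : Fill P) < Fill.elt q := fun {p q} h =>
      Fill.lt_iff.2 ⟨(hside p q).2 h, fun z hz => (hside z q).2 (((hside z p).1 hz).trans h)⟩
    intro α
    cases α with
    | elt x =>
      obtain ⟨y, hy⟩ := hmin x
      exact ⟨y, hlt hy⟩
    | cut L hL =>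
      obtain ⟨-, x, y, rfl | rfl⟩ := id hL
      · exact ⟨x, Fill.elt_lt_cut (Below.peak x y)⟩
      · obtain ⟨z, hz, hz'⟩ : ∃ z, z < x ∧ z < y := by
          rcases htot x y with h | h
          · obtain ⟨z, hz⟩ := hmin x
            exact ⟨z, hz, hz.trans_le h⟩
          · obtain ⟨z, hz⟩ := hmin y
            exact ⟨z, hz.trans_le h, hz⟩
        refine ⟨z, Fill.elt_lt_cut ⟨⟨(hside _ _).2 hz, (hside _ _).2 hz'⟩, fun w hw h => hw ?_⟩⟩
        have hwz := (hside _ _).1 h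
        exact ⟨(hside _ _).2 (hwz.trans hz), (hside _ _).2 (hwz.trans hz')⟩
  obtain ⟨q, hq⟩ := m.lower_nonempty
  obtain ⟨p, hp⟩ := key (ofLex q).1
  exact ⟨p, (of_lt_iff.2 (m.lower_down (toLex (Fill.elt p, 0)) q
    (Thick.lt_iff.2 (Or.inl hp)) hq)).le⟩

theorem exists_lt_point [PartialOrder P] (htot : ∀ p q : P, p ≤ q ∨ q ≤ p)
    (hside : ∀ p q : P, side p q ↔ p < q) (hmax : ∀ p : P, ∃ q, p < q) (m : DCut (Fill P ×ₗ ℚ)) :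
    ∃ p, m ≤ point p := by
  have key : ∀ α : Fill P, ∃ p, α < Fill.elt p := by
    have hlt : ∀ {p q : P}, p < q → (Fill.elt p : Fill P) < Fill.elt q := fun {p q} h =>
      Fill.lt_iff.2 ⟨(hside p q).2 h, fun z hz => (hside z q).2 (((hside z p).1 hz).trans h)⟩
    intro α
    cases α with
    | elt x =>
      obtain ⟨y, hy⟩ := hmax x
      exact ⟨y, hlt hy⟩
    | cut L hL =>
      obtain ⟨-, x, y, rfl | rfl⟩ := id hL
      · obtain ⟨z, hz, hz'⟩ : ∃ z, x < z ∧ y < z := by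
          rcases htot x y with h | h
          · obtain ⟨z, hz⟩ := hmax y
            exact ⟨z, lt_of_le_of_lt h hz, hz⟩
          · obtain ⟨z, hz⟩ := hmax x
            exact ⟨z, hz, lt_of_le_of_lt h hz⟩
        have hL' : ∀ w ∈ peakSet x y, side w z := by
          rintro w (rfl | h | rfl | h)
          · exact (hside _ _).2 hz
          · exact (hside _ _).2 (((hside _ _).1 h).trans hz)
          · exact (hside _ _).2 hz'
          · exact (hside _ _).2 (((hside _ _).1 h).trans hz')
        exact ⟨z, Fill.cut_lt_elt ⟨fun h => lt_irrefl z ((hside _ _).1 (hL' z h)), hL'⟩⟩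
      · exact ⟨x, Fill.cut_lt_elt (Above.valley x y)⟩
  obtain ⟨q, hq⟩ := m.upper_nonempty
  obtain ⟨p, hp⟩ := key (ofLex q).1
  exact ⟨p, (lt_of_iff.2 (m.upper_up q (toLex (Fill.elt p, 0))
    (Thick.lt_iff.2 (Or.inl hp)) hq)).le⟩

theorem le_or_le_of_total [PartialOrder P] (htot : ∀ p q : P, p ≤ q ∨ q ≤ p)
    (hside : ∀ p q : P, side p q ↔ p < q) (hmin : ∀ p : P, ∃ q, q < p)
    (hmax : ∀ p : P, ∃ q, p < q) (m n : DCut (Fill P ×ₗ ℚ)) : m ≤ n ∨ n ≤ m := by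
  refine le_or_le_of_cofinal (fun p q => ?_) (exists_point_lt htot hside hmin)
    (exists_lt_point htot hside hmax) m n
  have key : ∀ {p q : P}, p ≤ q → point p ≤ point q := by
    intro p q h
    rcases h.lt_or_eq with h | rfl
    · refine of_le_of (le_of_lt (Thick.lt_iff.2 (Or.inl (Fill.lt_iff.2 ⟨?_, fun z hz => ?_⟩))))
      · exact (hside p q).2 h
      · exact (hside z q).2 (((hside z p).1 hz).trans h)
    · exact le_rfl
  exact (htot p q).imp key key

end Total

variable {G : Type u} [Group G] [TurnAction G P]

theorem smul_point (g : G) (p : P) : g • point p = point (g • p) := by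
  rw [point, smul_of, MonoAction.smul_toLex, Fill.smul_elt]
  rfl

end DCut

/-- Points without disjoint neighbourhoods lie on the same side of every other point. -/
theorem TreeLine.up_iff_of_not_disjoint {M : Type u} [TreeLine M] {a b z : M}
    (h : ¬ Disjoint (𝓝 a) (𝓝 b)) (ha : a ≠ z) (hb : b ≠ z) :
    SidePoset.up z a ↔ SidePoset.up z b := by
  by_contra hcon
  refine h (Filter.disjoint_iff.2 ⟨_, eventually_up_iff ha, _, eventually_up_iff hb, ?_⟩)
  rw [Set.disjoint_left]
  exact fun m h1 h2 => hcon (h1.2.trans h2.2.symm)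

/-! ### Groups with an invariant extension -/

namespace SCExtension

open SidePoset TurnTree TreeLine DCut

variable {G : Type u} [PartialOrder G] (E : SCExtension G)

/-- The side function of a rectifiable extension, ranked by the number of classes between two
elements. -/
@[reducible] noncomputable def turnTree (hrect : E.IsRectifiable) : TurnTree G where
  side := E.up
  isTreeSide := E.isTreeSide
  rank := E.classCount
  rank_comm := E.classCount_comm
  rank_lt hc hu hv huv h :=
    E.classCount_lt hrect hc hu hv (E.not_comparable_of_up huv h)

/-- If any two group elements have some point on the same kind of side, upper for both or lower for
both and the same kind for all pairs, then all incomparable pairs have the same type.  As the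
extension is not trivial, there are none. -/
theorem comparable_of_side (hnontriv : ¬ E.IsTrivial) {M : Type u} [SidePoset M] {f : G → M}
    (hf : Function.Injective f) (hup : ∀ g h, SidePoset.up (f g) (f h) ↔ E.up g h) {c : Prop}
    (hc : ∀ g h, ∃ x, x ≠ f g ∧ x ≠ f h ∧ (SidePoset.up (f g) x ↔ c) ∧
      (SidePoset.up (f h) x ↔ c)) (g h : G) : g ≤ h ∨ h ≤ g := by
  have key : ∀ g h : G, g ≠ h → (E.up g h ↔ c) ∨ (E.up h g ↔ c) := by
    intro g h hne
    obtain ⟨x, h1, h2, h3, h4⟩ := hc g h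
    rw [← hup, ← hup, ← h3]
    exact (SidePoset.isTreeSide.tree (f g) (f h) x (fun h => hne (hf h)) h1.symm h2.symm).imp id
      fun h5 => h5.trans (h4.trans h3.symm)
  by_contra hcon
  push Not at hcon
  refine hnontriv ⟨⟨g, h, hcon.1, hcon.2⟩, ?_⟩
  by_cases hct : c
  · refine Or.inl fun x y hxy hyx => (E.simU_or_simL x y hxy hyx).resolve_right fun hl => ?_
    have h1 := E.simL_iff_up.1 hl
    have h2 := key x y h1.1
    tauto
  · refine Or.inr fun x y hxy hyx => (E.simU_or_simL x y hxy hyx).resolve_left fun hl => ?_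
    have h1 := E.simU_iff_up.1 hl
    have h2 := key x y (E.up_ne h1.1)
    tauto

theorem up_iff_lt_of_total (htot : ∀ g h : G, g ≤ h ∨ h ≤ g) (g h : G) : E.up g h ↔ g < h := by
  refine ⟨fun h1 => h1.resolve_right fun h2 => ?_, Or.inl⟩
  have h3 := E.not_comparable_of_simU g h h2
  have := htot g h
  tauto

variable [Group G]

theorem up_mul_iff (hinv : E.IsLeftInvariant) (g x y : G) : E.up (g * x) (g * y) ↔ E.up x y := by
  have key : ∀ g x y : G, E.up x y → E.up (g * x) (g * y) := by
    rintro g x y (h | h)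
    · refine Or.inl (lt_of_le_of_ne ((hinv g x y).1 h.le) fun h1 => h.ne (mul_left_cancel h1))
    · exact Or.inr ((hinv g x y).2.1 h)
  refine ⟨fun h => ?_, key g x y⟩
  have := key g⁻¹ _ _ h
  rwa [inv_mul_cancel_left, inv_mul_cancel_left] at this

end SCExtension

/-- A nontrivial group with a left-invariant total order has no extreme elements. -/
theorem exists_lt_of_total {G : Type u} [Group G] [Nontrivial G] [PartialOrder G]
    (hmul : ∀ f g h : G, g ≤ h → f * g ≤ f * h) (htot : ∀ g h : G, g ≤ h ∨ h ≤ g) (g : G) :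
    (∃ h, h < g) ∧ ∃ h, g < h := by
  have hlt : ∀ f : G, ∀ {g h}, g < h → f * g < f * h := fun f {g h} h1 =>
    lt_of_le_of_ne (hmul f g h h1.le) fun h2 => h1.ne (mul_left_cancel h2)
  obtain ⟨f, hf⟩ := exists_ne (1 : G)
  have key : ∀ f : G, 1 < f → (∃ h, h < g) ∧ ∃ h, g < h := by
    intro f hf
    have h1 := hlt (g * f⁻¹) hf
    have h2 := hlt g hf
    simp only [mul_one, inv_mul_cancel_right] at h1 h2
    exact ⟨⟨_, h1⟩, ⟨_, h2⟩⟩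
  rcases htot 1 f with h | h
  · exact key f (lt_of_le_of_ne h hf.symm)
  · have h1 := hlt f⁻¹ (lt_of_le_of_ne h hf)
    simp only [mul_one, inv_mul_cancel] at h1
    exact key f⁻¹ h1

/-! ### The action on the line -/

namespace SCExtension

open SidePoset TurnTree TreeLine DCut

variable {G : Type u} [PartialOrder G] (E : SCExtension G) [Group G]

/-- The line of a rectifiable left-invariant extension, with the action of the group and the orbit
map of a point whose sides are those of the extension. -/
theorem exists_line [Countable G] [Nontrivial G] (hinv : E.IsLeftInvariant)
    (hrect : E.IsRectifiable) : ∃ (M : Type u) (_ : TreeLine M) (_ : MonoAction G M) (f : G → M),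
      Function.Injective f ∧ (∀ g h, g • f h = f (g * h)) ∧
      (∀ g h, SidePoset.up (f g) (f h) ↔ E.up g h) ∧
      (∀ g h, g ≠ h → ∃ z, Sep SidePoset.up z (f g) (f h)) ∧
      ((∀ g h : G, g ≤ h ∨ h ≤ g) →
        (∀ a : M, (∃ g, f g ≤ a) ∧ ∃ g, a ≤ f g) ∧ ∀ a b : M, a ≤ b ∨ b ≤ a) := by
  let _ : TurnTree G := E.turnTree hrect
  let _ : TurnAction G G := { side_smul := E.up_mul_iff hinv }
  refine ⟨DCut (Fill G ×ₗ ℚ), inferInstance, inferInstance, point, point_injective,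
    fun g h => smul_point g h, fun g h => up_point_iff, fun g h => exists_sep_point,
    fun htot => ?_⟩
  have hex := exists_lt_of_total (fun f g h => (hinv f g h).1) htot
  have hside := E.up_iff_lt_of_total htot
  exact ⟨fun m => ⟨exists_point_lt htot hside (fun g => (hex g).1) m,
    exists_lt_point htot hside (fun g => (hex g).2) m⟩,
    le_or_le_of_total htot hside (fun g => (hex g).1) fun g => (hex g).2⟩

end SCExtension

namespace TreeLine

open SidePoset

variable {G : Type u} [Group G] [PartialOrder G] {E : SCExtension G} {M : Type u} [TreeLine M]
  [MonoAction G M] {f : G → M}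

/-- A generalized fixed point would be separated from all its translates by some point of the orbit,
unless it lies on the same kind of side of the whole orbit. -/
theorem isNontrivialAction [Nontrivial G] (hnontriv : ¬ E.IsTrivial) (hf : Function.Injective f)
    (hmul : ∀ g h, g • f h = f (g * h)) (hup : ∀ g h, up (f g) (f h) ↔ E.up g h)
    (hsep : ∀ g h, g ≠ h → ∃ z, Sep up z (f g) (f h))
    (htotal : (∀ g h : G, g ≤ h ∨ h ≤ g) → ∀ a : M, (∃ g, f g ≤ a) ∧ ∃ g, a ≤ f g) :
    IsNontrivialAction G M := by
  rintro ⟨x, hx⟩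
  by_cases hmem : ∃ h, f h = x
  · obtain ⟨h, rfl⟩ := hmem
    obtain ⟨g, hg⟩ := exists_ne (1 : G)
    obtain ⟨z, hz⟩ := hsep (g * h) h (by simpa using hg)
    have h1 := hx g
    rw [hmul] at h1
    exact hz.2.2 (up_iff_of_not_disjoint h1 hz.1.symm hz.2.1.symm)
  · push Not at hmem
    have hconst : ∀ h, up (f h) x ↔ up (f 1) x := by
      intro h
      have h1 : h • x ≠ f h := fun h2 => hmem 1 (MulAction.injective h (by
        change h • f 1 = h • x
        rw [hmul, mul_one, h2]))
      rw [← up_iff_of_not_disjoint (hx h) h1 (hmem h).symm, ← up_smul_iff h (x := f 1), hmul,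
        mul_one]
    have htot := E.comparable_of_side hnontriv hf hup (c := up (f 1) x)
      fun g h => ⟨x, (hmem g).symm, (hmem h).symm, hconst g, hconst h⟩
    obtain ⟨⟨g, hg⟩, ⟨h, hh⟩⟩ := htotal htot x
    have h1 := up_of_lt _ _ (lt_of_le_of_ne hg (hmem g))
    have h2 := not_up_of_lt _ _ (lt_of_le_of_ne hh (hmem h).symm)
    exact h2 ((hconst h).2 ((hconst g).1 h1))

/-- A fixed end lies on the same kind of side of the whole orbit, so that the order is total and
both ends of the line are fixed. -/
theorem not_fixesUniqueEnd (hnontriv : ¬ E.IsTrivial) (hf : Function.Injective f)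
    (hmul : ∀ g h, g • f h = f (g * h)) (hup : ∀ g h, up (f g) (f h) ↔ E.up g h)
    (htotal : (∀ g h : G, g ≤ h ∨ h ≤ g) → ∀ a b : M, a ≤ b ∨ b ≤ a) :
    ¬ FixesUniqueEnd G (segs M) := by
  intro h
  obtain ⟨ρ, hρ, -⟩ := id h
  obtain ⟨s, hs, hside⟩ := exists_side_of_representsFixedEnd hρ
  have hconst : ∀ g, s (f g) ↔ s (f 1) := fun g => by
    rw [← hs g (f 1), hmul, mul_one]
  refine not_fixesUniqueEnd_of_total (htotal (E.comparable_of_side hnontriv hf hup (c := s (f 1))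
    fun g h => ?_)) h
  obtain ⟨x, h1, h2, h3, h4⟩ := hside (f g) (f h)
  exact ⟨x, h1, h2, h3.trans (hconst g), h4.trans (hconst h)⟩

end TreeLine
end OrderTrees

open OrderTrees in
theorem theorem4p1 (G : Type u) [Group G] [Countable G] [Nontrivial G] [PartialOrder G]
    (E : SCExtension G) (hinv : E.IsLeftInvariant) (hrect : E.IsRectifiable)
    (hnontriv : ¬ E.IsTrivial) :
    (∃ (T : Type u) (_ : TopologicalSpace T) (S Sp : Set (Seg T)) (_ : MulAction G T),
      IsOrderTree T S ∧ IsOrientation S Sp ∧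
      ContinuousConstSMul G T ∧ PreservesOrientedTree G S Sp ∧
      FaithfulSMul G T ∧ IsNontrivialAction G T ∧ ¬ FixesUniqueEnd G S) ∧
    (∃ (M : Type u) (_ : TopologicalSpace M) (A : OrientedAtlas M) (_ : MulAction G M),
      SimplyConnectedSpace M ∧
      ContinuousConstSMul G M ∧ A.IsPreservedBy G ∧
      FaithfulSMul G M ∧ IsNontrivialAction G M ∧ ¬ FixesUniqueEnd G (arcs M) ∧
      ∃ x : M, MulAction.stabilizer G x = ⊥ ∧ ∀ g h : G, g ≤ h ↔ A.le (g • x) (h • x)) := by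
  obtain ⟨M, _, _, f, hf, hmul, hup, hsep, htotal⟩ := E.exists_line hinv hrect
  have : Nonempty M := ⟨f 1⟩
  have hfaithful : FaithfulSMul G M := ⟨fun {g h} hgh => by
    have h1 := hgh (f 1)
    rw [hmul, hmul, mul_one, mul_one] at h1
    exact hf h1⟩
  have haction : IsNontrivialAction G M :=
    TreeLine.isNontrivialAction hnontriv hf hmul hup hsep fun htot => (htotal htot).1
  have hends : ¬ FixesUniqueEnd G (TreeLine.segs M) :=
    TreeLine.not_fixesUniqueEnd hnontriv hf hmul hup fun htot => (htotal htot).2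
  refine ⟨⟨M, inferInstance, TreeLine.segs M, TreeLine.posSegs M, inferInstance,
    TreeLine.isOrderTree, TreeLine.isOrientation, inferInstance, TreeLine.preservesOrientedTree,
    hfaithful, haction, hends⟩,
    ⟨M, inferInstance, TreeLine.atlas M, inferInstance, TreeLine.simplyConnectedSpace,
    inferInstance, TreeLine.isPreservedBy, hfaithful, haction, ?_, f 1, ?_, fun g h => ?_⟩⟩
  · rwa [TreeLine.arcs_eq_segs]
  · refine (Subgroup.eq_bot_iff_forall _).2 fun g hg => hf ?_
    have h1 : g • f 1 = f 1 := hg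
    rwa [hmul, mul_one] at h1
  · rw [TreeLine.atlas_le_iff, hmul, hmul, mul_one, mul_one, hup, hup, ← E.lt_iff_up, hf.eq_iff,
      le_iff_eq_or_lt]
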